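/- Throughout, fix $d\ge 1$, $T>0$, $1\le m<\infty$, $\alpha,\delta\in\mathbb R^d$ with $-1<\alpha_i<0$ and $\delta_i\ge 0$ for all $i$, and a probability space $(\Omega,\mathcal F,\mathbb P)$ with a multiparameter filtration $(\mathcal F_t)$ which is commuting, i.e. $\mathbb E^i_t\mathbb E^j_s=\mathbb E^j_s\mathbb E^i_t$ a.s. for all $i,j\in[d]$ and all $s,t$. **Notation.** $[d]=\{1,\dots,d\}$; inequalities between vectors are componentwise. For $\theta\subset[d]$, $\pi^\theta_xy$ is the vector with the coordinates of $x$ in $\theta$ and those of $y$ outside $\theta$; $\square^\theta_{x,y}F=\sum_{\theta'\subset\theta}(-1)^{\#(\theta\setminus\theta')}F(\pi^{\theta'}_yx)$; $|x|^{a}_{c,\theta}=\prod_{i\in\theta}|x_i|^{a_i}$ and $|x|^a_c=|x|^a_{c,[d]}$; $\lambda^a_\theta=\prod_{i\in\theta}\lambda_i^{a_i}$ and $\lambda^a=\lambda^a_{[d]}$; $\mathbb E^\eta_x$ is the conditional expectation given $\mathcal F^\eta_x=\bigvee_s\mathcal F_{\pi^\eta_xs}$, and $\mathbb E^i_x=\mathbb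 E^{\{i\}}_x$; $\psi^\lambda_x(y)=\prod_i\lambda_i^{-1}\,\psi\big((y_1-x_1)/\lambda_1,\dots,(y_d-x_d)/\lambda_d\big)$. Let $r$ be the smallest integer with $r\ge\sum_i|\alpha_i|$ and $\|\psi\|_{C^r}=\sum_{|n|\le r}\|\partial^n\psi\|_\infty$. A random distribution on $[0,T]^d$ is an a.s. linear map $f$ from the $C^r$ functions with support in $[0,T]^d$ to random variables which is continuous in probability. **Spaces.** $C^{\alpha,\delta}L_m$ consists of the random distributions $f$ on $[0,T]^d$ such that $f(\psi)$ is $\mathcal F_x$-measurable (up to a null set) if $\psi$ has support in $(-\infty,x]$, such that $f(\psi^\lambda_x)\in L_m(\Omega)$ for all $\psi,x,\lambda$ as in the supremum below, and such that $$\|f\|_{C^{\alpha,\delta}L_m}=\sup_{\psi,x,\lambda,\eta}\frac{\|\mathbb E^\eta_xf(\psi^\lambda_x)\|_m}{\lambda^\alpha\lambda^\delta_\eta}<\infty ,$$ the supremum being over $\eta\subset[d]$, $C^r$ functions $\psi$ with support in $[1/4,3/4]^d$ and $\|\psi\|_{C^r}=1$, $\lambda\in(0,1]^d$ and $x$ with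 $[x,x+\lambda]\subset[0,T]^d$. The space $C^{\alpha+1,\delta}L_m$ consists of the random fields $Y$ on $[0,T]^d$ with $Y_t\in L_m(\Omega)$ and $Y_t$ $\mathcal F_t$-measurable for all $t$, such that for all $\eta\subset\theta\subset[d]$ $$\|\square Y\|_{\theta,\eta,m}=\sup_{x,y\in[0,T]^d,\;x_i\le y_i\,(i\in\theta)}\frac{\|\mathbb E^\eta_x\square^\theta_{x,y}Y\|_m}{|x-y|^{\alpha+1}_{c,\theta}\,|x-y|^\delta_{c,\eta}}<\infty\qquad(0/0:=0),$$ with norm $\|Y\|_{C^{\alpha+1,\delta}L_m}=\sup_x\|Y_x\|_m+\sum_{\eta\subset\theta\subset[d],\,\theta\ne\emptyset}\|\square Y\|_{\theta,\eta,m}$. **Wavelets.** Let $\varphi,\hat\varphi\in C^r_c(\mathbb R)$ be the scaling function and the mother wavelet of an orthonormal wavelet basis. That is, with $g^n_k(y)=2^{n/2}g(2^ny-k)$ for $n\in\mathbb N$, $k\in\mathbb Z$: $\varphi$ is a finite linear combination of the $\varphi^1_k$; $\int x^p\hat\varphi(x)\,dx=0$ for all integers $0\le p\le r$; for each $n$ the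 functions $\varphi^n_k$ and $\hat\varphi^p_k$ ($p\ge n$, $k\in\mathbb Z$) form a complete orthonormal system of $L^2(\mathbb R)$; and $\mathrm{span}\{\varphi^{n+1}_k\}_k=\mathrm{span}\{\varphi^n_k\}_k+\mathrm{span}\{\hat\varphi^n_k\}_k$. For $n\in\mathbb N^d$ put $\phi^n_k(y)=\prod_i\varphi^{n_i}_{k_i}(y_i)$ and $P_ng=\sum_{k\in\mathbb Z^d}\langle\phi^n_k,g\rangle\phi^n_k$. **Integrals.** The interior primitive is $\oint_s^tf(dy)=\lim_{n\to\infty}f(P_n1_{(s,t]})$, a limit in $L_m$ as all $n_i\to\infty$ (it is $0$ if $s_i=t_i$ for some $i$). For $s\le t$ in $[0,T]^d$ and $u=\frac12(s+t)$ put $$\int_s^tf(dy)=\sum_{\theta\subset[d]}\ \sum_{k\in\mathbb N^d}\oint_{a^{\theta,k}}^{b^{\theta,k}}f(dy),$$ where $[a^{\theta,k}_i,b^{\theta,k}_i]$ is $[s_i+2^{-k_i-1}(u_i-s_i),\,s_i+2^{-k_i}(u_i-s_i)]$ for $i\in\theta$ and $[t_i-2^{-k_i}(t_i-u_i),\,t_i-2^{-k_i-1}(t_i-u_i)]$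 for $i\notin\theta$, and the inner sum is an unconditional sum in $L_m$. **Claim.** There is a constant $C$, which does not depend on $f$, such that the following holds for every $f\in C^{\alpha,\delta}L_m$. 1. For all $0<s\le t<T\mathbf 1$ the limit $\oint_s^tf(dy)$ exists in $L_m$. For $0<s\le u\le t<T\mathbf 1$ and $i\in[d]$, a.s. $\oint_s^t f(dy)=\oint_s^{\pi^{\{i\}}_ut}f(dy)+\oint_{\pi^{\{i\}}_us}^tf(dy)$. For $0<s\le t<T\mathbf 1$ and all $\epsilon\in(0,\infty)^d$ such that $\hat s,\hat t\in[0,T]^d$, where $\hat s_i=s_i-\epsilon_i|t_i-s_i|$ and $\hat t_i=t_i+\epsilon_i|t_i-s_i|$, and for all $\eta\subset[d]$, $$\Big\|\oint_s^tf(dy)\Big\|_m\le C\,(\epsilon\wedge\mathbf 1)^\alpha\,\|f\|_{C^{\alpha,\delta}L_m}\,|t-s|_c^{\alpha+1},\qquad \Big\|\mathbb E^\eta_{\hat s}\oint_s^tf(dy)\Big\|_m\le C\,(\epsilon\wedge\mathbf 1)^\alpha\,\|f\|_{C^{\alpha,\delta}L_m}\,|t-s|_c^{\alpha+1}\,|t-s|^\delta_{c,\eta}.$$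 2. For all $s\le t$ in $[0,T]^d$ the dyadic sums defining $\int_s^tf(dy)$ converge in $L_m$. The integral $\int_s^t f(dy)$ agrees a.s. with $\oint_s^t f(dy)$ if $0<s\le t<T\mathbf 1$, is additive in the sense of 1. for all $s\le u\le t$ in $[0,T]^d$, is $\mathcal F_t$-measurable (up to a null set), and satisfies, for all $\eta\subset[d]$, $$\Big\|\int_s^tf(dy)\Big\|_m\le C\,\|f\|_{C^{\alpha,\delta}L_m}\,|t-s|_c^{\alpha+1},\qquad\Big\|\mathbb E^\eta_s\int_s^tf(dy)\Big\|_m\le C\,\|f\|_{C^{\alpha,\delta}L_m}\,|t-s|_c^{\alpha+1}\,|t-s|_{c,\eta}^\delta.$$ 3. There is a process $Y$ on $[0,T]^d$, unique up to modification, which vanishes on the boundary $\bigcup_{i}\{x\in[0,T]^d:x_i=0\}$ and satisfies, for all $x\le y$ in $[0,T]^d$, a.s. $\square^{[d]}_{x,y}Y=\int_x^yf(dz)$. For all $\theta\subset[d]$ and $x,y\in[0,T]^d$ with $x_i\le y_i$ for $i\in\theta$, a.s. $\square^\theta_{x,y}Y=\int_{\pi^\theta_x\mathbf 0}^{\pi^\theta_yx}f(dz)$.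 The process $Y$ (for a suitable modification) lies in $C^{\alpha+1,\delta}L_m$, and $\|Y\|_{C^{\alpha+1,\delta}L_m}\le C\,\|f\|_{C^{\alpha,\delta}L_m}$. -/

import Mathlib

open MeasureTheory Filter Topology
open scoped ENNReal NNReal

namespace RectInt

noncomputable section

/-! ## Coordinates, rectangular increments -/

/-- The cube `[0,T]^d`. -/
def box (d : ℕ) (T : ℝ) : Set (Fin d → ℝ) := Set.Icc (fun _ => 0) (fun _ => T)

/-- `π^θ_x y`: the coordinates in `θ` are those of `x`, the other ones are those of `y`. -/
def coordProj {d : ℕ} (θ : Finset (Fin d)) (x y : Fin d → ℝ) : Fin d → ℝ :=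
  fun i => if i ∈ θ then x i else y i

/-- `□^θ_{x,y} F = ∑_{θ' ⊆ θ} (-1)^{#(θ \ θ')} F(π^{θ'}_y x)`, for a function `F` on `ℝ^d`. -/
def rectIncr {d : ℕ} (θ : Finset (Fin d)) (x y : Fin d → ℝ) (F : (Fin d → ℝ) → ℝ) : ℝ :=
  ∑ θ' ∈ θ.powerset, (-1 : ℝ) ^ (θ \ θ').card * F (coordProj θ' y x)

/-- `|x|^a_{c,θ} = ∏_{i ∈ θ} |x_i|^{a_i}`. -/
def multiPow {d : ℕ} (θ : Finset (Fin d)) (x a : Fin d → ℝ) : ℝ :=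
  ∏ i ∈ θ, |x i| ^ (a i)

/-! ## Test functions -/

/-- `∂ψ/∂x_i`. -/
def pderiv {d : ℕ} (i : Fin d) (ψ : (Fin d → ℝ) → ℝ) : (Fin d → ℝ) → ℝ :=
  fun x => fderiv ℝ ψ x (Pi.single i 1)

/-- `∂^n ψ = ∂_{x_1}^{n_1} ⋯ ∂_{x_d}^{n_d} ψ` for a multi-index `n`. -/
def mixedPDeriv {d : ℕ} (n : Fin d → ℕ) (ψ : (Fin d → ℝ) → ℝ) : (Fin d → ℝ) → ℝ :=
  (List.finRange d).foldr (fun i g => (pderiv i)^[n i] g) ψ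

/-- `‖ψ‖_{C^r} = ∑_{|n| ≤ r} ‖∂^n ψ‖_∞` (used for compactly supported functions of class `C^r`,
for which all the suprema are finite). -/
def crNorm {d : ℕ} (r : ℕ) (ψ : (Fin d → ℝ) → ℝ) : ℝ :=
  ∑ n ∈ (Fintype.piFinset fun _ : Fin d => Finset.range (r + 1)).filter (fun n => ∑ i, n i ≤ r),
    ⨆ x, |mixedPDeriv n ψ x|

/-- `ψ ∈ C^r(K)`: `ψ` is of class `C^r` with support in `K`. For `K` compact these are the test
functions of order `r` supported in `K`. -/
def IsTest {d : ℕ} (r : ℕ) (K : Set (Fin d → ℝ)) (ψ : (Fin d → ℝ) → ℝ) : Prop :=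
  ContDiff ℝ r ψ ∧ tsupport ψ ⊆ K

/-- `B^r([1/4,3/4]^d)`: test functions with support in `[1/4,3/4]^d` and `C^r` norm one. -/
def testBall (d r : ℕ) : Set ((Fin d → ℝ) → ℝ) :=
  {ψ | IsTest r (Set.Icc (fun _ => 1 / 4) (fun _ => 3 / 4)) ψ ∧ crNorm r ψ = 1}

/-- `ψ_x^lam(y) = lam^{-1} ψ((y_1 - x_1)/lam_1, …, (y_d - x_d)/lam_d)`. -/
def rescale {d : ℕ} (ψ : (Fin d → ℝ) → ℝ) (x lam : Fin d → ℝ) : (Fin d → ℝ) → ℝ :=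
  fun y => (∏ i, (lam i)⁻¹) * ψ (fun i => (y i - x i) / lam i)

/-- The pairs `(x, lam)` with `x ∈ [0,T]^d`, `lam ∈ (0,1]^d` and `[x, x + lam] ⊆ [0,T]^d`. -/
def IsScale {d : ℕ} (T : ℝ) (x lam : Fin d → ℝ) : Prop :=
  ∀ i, 0 < lam i ∧ lam i ≤ 1 ∧ 0 ≤ x i ∧ x i + lam i ≤ T

/-- The order of the distributions of regularity `α`: the smallest integer `r ≥ ∑ |α_i|`. -/
def distOrder {d : ℕ} (α : Fin d → ℝ) : ℕ := ⌈∑ i, |α i|⌉₊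

/-! ## Wavelets -/

/-- `g^n_x(y) = 2^{n/2} g(2^n (y - x))` at the grid point `x = 2^{-n} k`. -/
def dilate (g : ℝ → ℝ) (n : ℕ) (k : ℤ) (y : ℝ) : ℝ :=
  (2 : ℝ) ^ ((n : ℝ) / 2) * g ((2 : ℝ) ^ n * (y - (k : ℝ) / 2 ^ n))

/-- `φ` and `φ'` are the father and the mother of a compactly supported orthonormal wavelet basis
of class `C^r`. -/
structure IsWaveletPair (r : ℕ) (φ φ' : ℝ → ℝ) : Prop where
  contDiff : ContDiff ℝ r φ
  contDiff' : ContDiff ℝ r φ'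
  hasCompactSupport : HasCompactSupport φ
  hasCompactSupport' : HasCompactSupport φ'
  /-- self-replication, with finitely many non-zero coefficients -/
  selfReplicable : ∃ a : ℤ →₀ ℝ, ∀ x, φ x = a.sum fun k c => c * dilate φ 1 k x
  moments : ∀ p : ℕ, p ≤ r → ∫ x, x ^ p * φ' x = 0
  orthonormal : ∀ (n : ℕ) (j k : ℤ),
    ∫ x, dilate φ n j x * dilate φ n k x = if j = k then 1 else 0
  orthonormal' : ∀ (n p : ℕ) (j k : ℤ),
    ∫ x, dilate φ' n j x * dilate φ' p k x = if n = p ∧ j = k then 1 else 0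
  orthogonal : ∀ (n p : ℕ), n ≤ p → ∀ j k : ℤ, ∫ x, dilate φ n j x * dilate φ' p k x = 0
  complete : ∀ (n : ℕ) (g : ℝ → ℝ), MemLp g 2 volume →
    (∀ j : ℤ, ∫ x, dilate φ n j x * g x = 0) →
    (∀ p : ℕ, n ≤ p → ∀ k : ℤ, ∫ x, dilate φ' p k x * g x = 0) → g =ᵐ[volume] 0
  /-- the level `n` wavelets complete the level `n` scaling functions to the next level
  (orthogonality is contained in `orthogonal`) -/
  span_succ : ∀ n : ℕ,
    Submodule.span ℝ (Set.range (dilate φ n)) ⊔ Submodule.span ℝ (Set.range (dilate φ' n)) =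
      Submodule.span ℝ (Set.range (dilate φ (n + 1)))

/-- `φ^n_x(y) = ∏_i φ^{n_i}_{x_i}(y_i)` at the grid point `x = (2^{-n_i} k_i)_i`. -/
def scalingFn {d : ℕ} (φ : ℝ → ℝ) (n : Fin d → ℕ) (k : Fin d → ℤ) (y : Fin d → ℝ) : ℝ :=
  ∏ i, dilate φ (n i) (k i) (y i)

/-- The projection `P_n g = ∑_x ⟨φ^n_x, g⟩ φ^n_x` onto the span of the `φ^n_x`; the sum over the grid
is locally finite because `φ` has compact support. -/
def waveletProj {d : ℕ} (φ : ℝ → ℝ) (n : Fin d → ℕ) (g : (Fin d → ℝ) → ℝ) : (Fin d → ℝ) → ℝ :=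
  fun z => ∑ᶠ k : Fin d → ℤ, (∫ y, scalingFn φ n k y * g y) * scalingFn φ n k z

/-- The indicator function of `(s,t] = ∏_i (s_i,t_i]`. -/
def rectIndicator {d : ℕ} (s t : Fin d → ℝ) : (Fin d → ℝ) → ℝ :=
  (Set.univ.pi fun i => Set.Ioc (s i) (t i)).indicator fun _ => 1

/-! ## Filtrations, random distributions and random fields -/

section Probability

variable {d : ℕ} {Ω : Type*} {mΩ : MeasurableSpace Ω}

/-- `F^η_x`, the sigma-algebra generated by all `F_{π^η_x s}`. A filtration indexed by `[0,T]^d` only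
is extended to `ℝ^d` by `F_s := F_{(s ∨ 0) ∧ T}`; this changes none of the `F^η_x`, `x ∈ [0,T]^d`. -/
abbrev marginal (ℱ : Filtration (Fin d → ℝ) mΩ) (η : Finset (Fin d)) (x : Fin d → ℝ) :
    MeasurableSpace Ω :=
  ⨆ s : Fin d → ℝ, ℱ (coordProj η x s)

/-- Commuting filtrations: `E^i_t E^j_s = E^j_s E^i_t`. -/
def IsCommuting (ℱ : Filtration (Fin d → ℝ) mΩ) (P : Measure Ω) : Prop :=
  ∀ (i j : Fin d) (s t : Fin d → ℝ) (X : Ω → ℝ), Integrable X P →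
    P[P[X | marginal ℱ {j} s] | marginal ℱ {i} t] =ᵐ[P]
      P[P[X | marginal ℱ {i} t] | marginal ℱ {j} s]

/-- Random distributions of order `r` on `[0,T]^d`: almost surely linear maps from the test functions
in `C^r([0,T]^d)` to random variables which are continuous in probability. Linear maps into `L_m(Ω)`
with `‖f(ψ)‖_m ≤ C ‖ψ‖_{C^r}` and random variables with values in the distributions of order `r`
are of this kind. The values of `f` at other functions play no role. -/
structure IsRandomDistribution (T : ℝ) (r : ℕ) (P : Measure Ω)
    (f : ((Fin d → ℝ) → ℝ) → Ω → ℝ) : Prop where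
  aestronglyMeasurable : ∀ ψ, IsTest r (box d T) ψ → AEStronglyMeasurable (f ψ) P
  map_add : ∀ ψ₁ ψ₂, IsTest r (box d T) ψ₁ → IsTest r (box d T) ψ₂ →
    f (ψ₁ + ψ₂) =ᵐ[P] f ψ₁ + f ψ₂
  map_smul : ∀ (c : ℝ) (ψ), IsTest r (box d T) ψ → f (c • ψ) =ᵐ[P] c • f ψ
  continuous : ∀ (ψ : ℕ → (Fin d → ℝ) → ℝ) (ψ₀ : (Fin d → ℝ) → ℝ),
    (∀ k, IsTest r (box d T) (ψ k)) → IsTest r (box d T) ψ₀ →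
    Tendsto (fun k => crNorm r (ψ k - ψ₀)) atTop (𝓝 0) →
    TendstoInMeasure P (fun k => f (ψ k)) atTop (f ψ₀)

/-- The norm of `C^{α,δ}L_m` for `α < 0`: the supremum over all `ψ ∈ B^r([1/4,3/4]^d)`, all `x`, `lam`
with `[x, x + lam] ⊆ [0,T]^d` and all `η` of `‖E^η_x f(ψ_x^lam)‖_m / (lam^α lam^δ_η)`. -/
def negHolderNorm (T : ℝ) (m : ℝ≥0∞) (α δ : Fin d → ℝ) (P : Measure Ω)
    (ℱ : Filtration (Fin d → ℝ) mΩ) (f : ((Fin d → ℝ) → ℝ) → Ω → ℝ) : ℝ≥0∞ :=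
  ⨆ (ψ : (Fin d → ℝ) → ℝ) (_ : ψ ∈ testBall d (distOrder α)) (x : Fin d → ℝ) (lam : Fin d → ℝ)
    (_ : IsScale T x lam) (η : Finset (Fin d)),
    eLpNorm (P[f (rescale ψ x lam) | marginal ℱ η x]) m P /
      ENNReal.ofReal (multiPow Finset.univ lam α * multiPow η lam δ)

/-- The space `C^{α,δ}L_m` for `α < 0`. -/
structure MemNegHolder (T : ℝ) (m : ℝ≥0∞) (α δ : Fin d → ℝ) (P : Measure Ω)
    (ℱ : Filtration (Fin d → ℝ) mΩ) (f : ((Fin d → ℝ) → ℝ) → Ω → ℝ) : Prop where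
  isRandomDistribution : IsRandomDistribution T (distOrder α) P f
  adapted : ∀ x ∈ box d T, ∀ ψ, IsTest (distOrder α) (box d T ∩ Set.Iic x) ψ →
    AEStronglyMeasurable[ℱ x] (f ψ) P
  memLp : ∀ ψ ∈ testBall d (distOrder α), ∀ x lam, IsScale T x lam →
    MemLp (f (rescale ψ x lam)) m P
  norm_lt_top : negHolderNorm T m α δ P ℱ f < ∞

/-- `‖□Y‖_{θ,η,m}`: the supremum over `x, y ∈ [0,T]^d` with `x_i ≤ y_i` for `i ∈ θ` of
`‖E^η_x □^θ_{x,y} Y‖_m / (|x-y|^α_{c,θ} |x-y|^δ_{c,η})`, with `0/0 = 0`. -/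
def incrSeminorm (T : ℝ) (m : ℝ≥0∞) (α δ : Fin d → ℝ) (P : Measure Ω)
    (ℱ : Filtration (Fin d → ℝ) mΩ) (Y : (Fin d → ℝ) → Ω → ℝ) (θ η : Finset (Fin d)) : ℝ≥0∞ :=
  ⨆ (x ∈ box d T) (y ∈ box d T) (_ : ∀ i ∈ θ, x i ≤ y i),
    eLpNorm (P[fun ω => rectIncr θ x y (fun z => Y z ω) | marginal ℱ η x]) m P /
      ENNReal.ofReal (multiPow θ (x - y) α * multiPow η (x - y) δ)

/-- The space `C^{α,δ}L_m` of random fields on `[0,T]^d`, for `α ∈ [0,1]^d`. -/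
structure MemHolder (T : ℝ) (m : ℝ≥0∞) (α δ : Fin d → ℝ) (P : Measure Ω)
    (ℱ : Filtration (Fin d → ℝ) mΩ) (Y : (Fin d → ℝ) → Ω → ℝ) : Prop where
  adapted : ∀ t ∈ box d T, StronglyMeasurable[ℱ t] (Y t)
  memLp : ∀ t ∈ box d T, MemLp (Y t) m P
  incrSeminorm_lt_top : ∀ θ η : Finset (Fin d), η ⊆ θ → incrSeminorm T m α δ P ℱ Y θ η < ∞

/-- The norm of `C^{α,δ}L_m` for `α ∈ [0,1]^d`:
`sup_x ‖Y_x‖_m + ∑_{η ⊆ θ, θ ≠ ∅} ‖□Y‖_{θ,η,m}`. -/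
def holderNorm (T : ℝ) (m : ℝ≥0∞) (α δ : Fin d → ℝ) (P : Measure Ω)
    (ℱ : Filtration (Fin d → ℝ) mΩ) (Y : (Fin d → ℝ) → Ω → ℝ) : ℝ≥0∞ :=
  (⨆ x ∈ box d T, eLpNorm (Y x) m P) +
    ∑ θ ∈ Finset.univ.filter (fun θ : Finset (Fin d) => θ.Nonempty), ∑ η ∈ θ.powerset,
      incrSeminorm T m α δ P ℱ Y θ η

/-! ## The integral of a random distribution -/

/-- `X i` converges in `L_m` to `Z` along the filter `l`. -/
def TendstoLm {ι : Type*} (m : ℝ≥0∞) (P : Measure Ω) (l : Filter ι) (X : ι → Ω → ℝ) (Z : Ω → ℝ) :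
    Prop :=
  MemLp Z m P ∧ Tendsto (fun i => eLpNorm (X i - Z) m P) l (𝓝 0)

open Classical in
/-- The limit in `L_m` of `X i` along `l` (and `0` if there is none). -/
def limLm {ι : Type*} (m : ℝ≥0∞) (P : Measure Ω) (l : Filter ι) (X : ι → Ω → ℝ) : Ω → ℝ :=
  if h : ∃ Z, TendstoLm m P l X Z then h.choose else 0

/-- The approximations `f(P_n 1_{(s,t]})`. -/
def interiorApprox (φ : ℝ → ℝ) (f : ((Fin d → ℝ) → ℝ) → Ω → ℝ) (s t : Fin d → ℝ)
    (n : Fin d → ℕ) : Ω → ℝ :=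
  f (waveletProj φ n (rectIndicator s t))

/-- The interior primitive `∮_s^t f(dy) = lim_n f(P_n 1_{(s,t]})`, the limit being taken in `L_m` as
all components of `n` tend to infinity. -/
def interiorPrimitive (m : ℝ≥0∞) (P : Measure Ω) (φ : ℝ → ℝ) (f : ((Fin d → ℝ) → ℝ) → Ω → ℝ)
    (s t : Fin d → ℝ) : Ω → ℝ :=
  limLm m P atTop (interiorApprox φ f s t)

/-- Lower corner of the dyadic cell number `k` of `[a,b]`. In the directions `i ∈ θ` the cells
accumulate at `a_i`: `[a_i + 2^{-k-1}(b_i - a_i), a_i + 2^{-k}(b_i - a_i)]`, `k = 0, 1, …`; in the other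
directions they accumulate at `b_i`: `[b_i - 2^{-k}(b_i - a_i), b_i - 2^{-k-1}(b_i - a_i)]`. -/
def cellLo (θ : Finset (Fin d)) (a b : Fin d → ℝ) (k : Fin d → ℕ) : Fin d → ℝ :=
  fun i => if i ∈ θ then a i + (1 / 2) ^ (k i + 1) * (b i - a i)
    else b i - (1 / 2) ^ (k i) * (b i - a i)

/-- Upper corner of the dyadic cell number `k` of `[a,b]`. -/
def cellHi (θ : Finset (Fin d)) (a b : Fin d → ℝ) (k : Fin d → ℕ) : Fin d → ℝ :=
  fun i => if i ∈ θ then a i + (1 / 2) ^ (k i) * (b i - a i)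
    else b i - (1 / 2) ^ (k i + 1) * (b i - a i)

/-- The finite partial sums of the interior primitives over the dyadic cells of `[a,b]`. -/
def dyadicApprox (m : ℝ≥0∞) (P : Measure Ω) (φ : ℝ → ℝ) (f : ((Fin d → ℝ) → ℝ) → Ω → ℝ)
    (θ : Finset (Fin d)) (a b : Fin d → ℝ) (S : Finset (Fin d → ℕ)) : Ω → ℝ :=
  ∑ k ∈ S, interiorPrimitive m P φ f (cellLo θ a b k) (cellHi θ a b k)

/-- The dyadic expansion `∑_k ∮ f(dy)` over the dyadic cells of `[a,b]`, as an unconditional sum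
in `L_m`. -/
def dyadicPrimitive (m : ℝ≥0∞) (P : Measure Ω) (φ : ℝ → ℝ) (f : ((Fin d → ℝ) → ℝ) → Ω → ℝ)
    (θ : Finset (Fin d)) (a b : Fin d → ℝ) : Ω → ℝ :=
  limLm m P atTop (dyadicApprox m P φ f θ a b)

/-- The midpoint `(s + t)/2`. -/
def mid (s t : Fin d → ℝ) : Fin d → ℝ := fun i => (s i + t i) / 2

/-- `∫_s^t f(dy) = ∑_θ ∫_{π^θ_s u}^{π^θ_u t} f(dy)` with `u = (s+t)/2`: the rectangle is cut into
`2^d` blocks at its midpoint, and in each block the dyadic cells accumulate at the vertex which is also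
a vertex of the whole rectangle. -/
def primitiveIntegral (m : ℝ≥0∞) (P : Measure Ω) (φ : ℝ → ℝ) (f : ((Fin d → ℝ) → ℝ) → Ω → ℝ)
    (s t : Fin d → ℝ) : Ω → ℝ :=
  ∑ θ : Finset (Fin d),
    dyadicPrimitive m P φ f θ (coordProj θ s (mid s t)) (coordProj θ (mid s t) t)

end Probability

end

end RectInt

/-!
The bound on `f(ψ_x^lam)` in `L_m` makes the wavelet expansion of the indicator function of a rectangle
absolutely convergent when it is evaluated at `f`; no cancellation between the terms is needed.

*Interior primitive.* `P_n 1_{(s,t]}` is a tensor product of one-dimensional projections, and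
`P_{n+1} = P_n + Q_n` in one dimension (`proj1_succ`), where `Q_n` projects onto the mother wavelets of
level `n`. Since the mother has integral zero, `Q_n 1_{(s,t]}` involves only the boundedly many wavelets
of level `n` whose support contains `s` or `t`, so that it contributes about
`2^{-n/2} ⬝ 2^{-n/2} 2^{-nα} = 2^{-n(1+α)}`, which is summable because `α > -1`. The expansion
starts at the level `N` with `2^{-N}` of order `(ε ∧ 1)(t - s)`, at which the supports fit into the
margins of the rectangle; there are about `2^N (t - s)` scaling functions of that level, with total
contribution `(t - s) 2^{-Nα}`. This gives existence (`WaveletBounds.exists_tendsto`) and the bound of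
the limit (`WaveletBounds.norm_lim_le`). Identities between indicator functions pass to the limit
(`IsOfOrder.eq_sum`).

*Integral.* The dyadic cells of `[s,t]` keep a distance from the boundary of `[s,t]` of at least their
length, so the bound with `ε = 1` applies and the sum over the cells is geometric
(`IsOfOrder.norm_boxPrim_le`). The first cells of all blocks fill a rectangle which exhausts `[s,t]`.
An additive function of rectangles with a bound by powers of the side lengths is continuous
(`norm_sub_le_of_additive`); therefore the integral agrees with the interior primitive
(`IsOfOrder.boxPrim_eq_rectPrim`), whose bound is then uniform up to the boundary, and the
integral over `[s,t]` is the limit of the primitives of the rectangles which are obtained by moving the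
corners into the interior (`IsOfOrder.tendsto_clamp`). Additivity up to the boundary follows. The
increments of `Y_t = ∫_0^t f` are integrals of `f` by additivity (`sum_powerset_smul_of_additive`).

*Conditioning.* All of this is carried out for one linear map `Φ` from functions into the Banach
space `L_m`, which represents `f` on the test functions (`IsRandomDistribution.exists_linearMap`), and
for the maps `L ∘ Φ` with `L` a bounded operator on `L_m`, assuming a bound at the rescaled test functions
with support in a rectangle `[a,b]` (`TestBound`). With `L` the identity this gives the unconditional
bounds; with `L` the conditional expectation given `F^η_a` the conditional ones, by the tower property;
and with `L` the identity minus the conditional expectation given `F_t`, where the bound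
at test functions supported in `(-∞,t]` is zero, it gives adaptedness.
-/

namespace RectInt

noncomputable section

/-! ### One-dimensional wavelet expansions of indicator functions -/

section OneDim

/-- The indicator function of the interval `(s,t]`. -/
def ind (s t : ℝ) : ℝ → ℝ := (Set.Ioc s t).indicator fun _ => 1

/-- The coefficient `⟨g^n_k, h⟩`. -/
def coef (g : ℝ → ℝ) (n : ℕ) (k : ℤ) (h : ℝ → ℝ) : ℝ := ∫ y, dilate g n k y * h y

/-- The one-dimensional partial expansion `∑_k ⟨g^n_k, h⟩ g^n_k` at level `n`. -/
def proj1 (g : ℝ → ℝ) (n : ℕ) (h : ℝ → ℝ) : ℝ → ℝ :=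
  fun y => ∑ᶠ k : ℤ, coef g n k h * dilate g n k y

/-- The indices `k` for which `[2^{-n}(k - R), 2^{-n}(k + R)]` meets `[a,b]`. -/
def near (R : ℝ) (n : ℕ) (a b : ℝ) : Finset ℤ := Finset.Icc ⌈2 ^ n * a - R⌉ ⌊2 ^ n * b + R⌋

lemma mem_near {R : ℝ} {n : ℕ} {a b : ℝ} {k : ℤ} :
    k ∈ near R n a b ↔ 2 ^ n * a - R ≤ k ∧ (k : ℝ) ≤ 2 ^ n * b + R := by
  simp [near, Int.ceil_le, Int.le_floor]

lemma card_near_le {R : ℝ} (hR : 0 ≤ R) (n : ℕ) {a b : ℝ} (hab : a ≤ b) :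
    ((near R n a b).card : ℝ) ≤ 2 ^ n * (b - a) + 2 * R + 1 := by
  have h2 : (0 : ℝ) < 2 ^ n := by positivity
  have h0 : 2 ^ n * a ≤ 2 ^ n * b := by gcongr
  rw [near, Int.card_Icc]
  have h1 := Int.le_ceil (2 ^ n * a - R)
  have h2 := Int.floor_le (2 ^ n * b + R)
  rcases le_total 0 (⌊2 ^ n * b + R⌋ + 1 - ⌈2 ^ n * a - R⌉) with h | h
  · have : (((⌊2 ^ n * b + R⌋ + 1 - ⌈2 ^ n * a - R⌉).toNat : ℤ) : ℝ) =
        ((⌊2 ^ n * b + R⌋ + 1 - ⌈2 ^ n * a - R⌉ : ℤ) : ℝ) := by rw [Int.toNat_of_nonneg h]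
    rw [Int.cast_natCast] at this
    rw [this]
    push_cast
    linarith
  · rw [Int.toNat_of_nonpos h]
    push_cast
    nlinarith

variable {g : ℝ → ℝ} {R : ℝ} {n : ℕ} {k : ℤ} {s t : ℝ}

lemma dilate_eq (g : ℝ → ℝ) (n : ℕ) (k : ℤ) (y : ℝ) :
    dilate g n k y = (2 : ℝ) ^ ((n : ℝ) / 2) * g (2 ^ n * y - k) := by
  have h2 : (2 : ℝ) ^ n ≠ 0 := by positivity
  rw [dilate]
  congr 2
  field_simp

lemma sq_two_rpow_half (n : ℕ) : (2 : ℝ) ^ ((n : ℝ) / 2) * (2 : ℝ) ^ ((n : ℝ) / 2) = 2 ^ n := by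
  rw [← Real.rpow_add (by norm_num), add_halves, Real.rpow_natCast]

lemma abs_le_of_dilate_ne_zero (hg : ∀ x, g x ≠ 0 → |x| ≤ R) {y : ℝ}
    (h : dilate g n k y ≠ 0) : |2 ^ n * y - k| ≤ R := by
  rw [dilate_eq] at h
  exact hg _ (right_ne_zero_of_mul h)

lemma continuous_dilate (hg : Continuous g) : Continuous (dilate g n k) := by
  unfold dilate
  fun_prop

lemma hasCompactSupport_dilate (hg : ∀ x, g x ≠ 0 → |x| ≤ R) :
    HasCompactSupport (dilate g n k) := by
  have h2 : (0 : ℝ) < 2 ^ n := by positivity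
  refine HasCompactSupport.intro (isCompact_Icc (a := (k - R) / 2 ^ n) (b := (k + R) / 2 ^ n)) ?_
  intro x hx
  by_contra h
  have := abs_le.1 (abs_le_of_dilate_ne_zero hg h)
  refine hx ⟨?_, ?_⟩
  · rw [div_le_iff₀ h2]
    linarith
  · rw [le_div_iff₀ h2]
    linarith

lemma integral_comp_scale (F : ℝ → ℝ) (n : ℕ) (k : ℤ) :
    ∫ y, F (2 ^ n * y - k) = (2 ^ n)⁻¹ * ∫ y, F y := by
  rw [Measure.integral_comp_mul_left (fun y => F (y - k)) ((2 : ℝ) ^ n),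
    integral_sub_right_eq_self F (k : ℝ), abs_of_pos (by positivity), smul_eq_mul]

lemma integrable_dilate (hg : Continuous g) (hgR : ∀ x, g x ≠ 0 → |x| ≤ R) :
    Integrable (dilate g n k) :=
  (continuous_dilate hg).integrable_of_hasCompactSupport (hasCompactSupport_dilate hgR)

lemma mul_ind (F : ℝ → ℝ) : (fun y => F y * ind s t y) = (Set.Ioc s t).indicator F := by
  ext y
  by_cases h : y ∈ Set.Ioc s t <;> simp [ind, h]

lemma integral_dilate (g : ℝ → ℝ) :
    ∫ y, dilate g n k y = ((2 : ℝ) ^ ((n : ℝ) / 2))⁻¹ * ∫ y, g y := by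
  simp_rw [dilate_eq]
  rw [integral_const_mul, integral_comp_scale, ← sq_two_rpow_half n]
  have : (2 : ℝ) ^ ((n : ℝ) / 2) ≠ 0 := by positivity
  field_simp

/-- The coefficients of an indicator function at level `n` are of order `2^{-n/2}`. -/
lemma abs_coef_ind_le (hg : Continuous g) (hgR : ∀ x, g x ≠ 0 → |x| ≤ R) :
    |coef g n k (ind s t)| ≤ ((2 : ℝ) ^ ((n : ℝ) / 2))⁻¹ * ∫ y, |g y| := by
  rw [coef, mul_ind]
  have h1 : ∀ y, dilate (fun z => |g z|) n k y = |dilate g n k y| := by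
    intro y
    rw [dilate_eq, dilate_eq, abs_mul, abs_of_pos (show (0 : ℝ) < 2 ^ ((n : ℝ) / 2) by positivity)]
  rw [← integral_dilate (k := k)]
  simp_rw [h1]
  refine (abs_integral_le_integral_abs).trans (integral_mono_of_nonneg
    (ae_of_all _ fun _ => abs_nonneg _) (integrable_dilate hg hgR).abs (ae_of_all _ fun y => ?_))
  by_cases h : y ∈ Set.Ioc s t <;> simp [h]

lemma coef_ind_eq_zero (hgR : ∀ x, g x ≠ 0 → |x| ≤ R) (hk : k ∉ near R n s t) :
    coef g n k (ind s t) = 0 := by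
  rw [coef, mul_ind]
  refine integral_eq_zero_of_ae (ae_of_all _ fun y => ?_)
  by_cases h : y ∈ Set.Ioc s t
  · by_contra h0
    rw [Set.indicator_of_mem h] at h0
    have h1 := abs_le.1 (abs_le_of_dilate_ne_zero hgR h0)
    have h2 : (0 : ℝ) < 2 ^ n := by positivity
    have h3 := mul_le_mul_of_nonneg_left h.1.le h2.le
    have h4 := mul_le_mul_of_nonneg_left h.2 h2.le
    exact hk (mem_near.2 ⟨by linarith, by linarith⟩)
  · simp [h]

/-- A wavelet with vanishing integral sees an interval only through its end points. -/
lemma coef_ind_eq_zero_of_integral (hgR : ∀ x, g x ≠ 0 → |x| ≤ R)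
    (h0 : ∫ x, g x = 0) (hk : k ∉ near R n s s ∪ near R n t t) :
    coef g n k (ind s t) = 0 := by
  by_cases hk' : k ∈ near R n s t
  swap
  · exact coef_ind_eq_zero hgR hk'
  have h2 : (0 : ℝ) < 2 ^ n := by positivity
  simp only [Finset.mem_union, mem_near, not_or, not_and, not_le] at hk hk'
  have h5 := hk.1 hk'.1
  have h6 : (k : ℝ) < 2 ^ n * t - R := by
    by_contra h
    exact absurd (hk.2 (not_lt.1 h)) (not_lt.2 hk'.2)
  rw [coef, mul_ind]
  have : (Set.Ioc s t).indicator (dilate g n k) = dilate g n k := by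
    rw [Set.indicator_eq_self]
    intro y hy
    have h1 := abs_le.1 (abs_le_of_dilate_ne_zero hgR hy)
    constructor
    · refine lt_of_mul_lt_mul_left ?_ h2.le
      linarith
    · refine le_of_mul_le_mul_left ?_ h2
      linarith
  rw [this, integral_dilate, h0, mul_zero]

lemma proj1_ind_eq_sum {S : Finset ℤ}
    (hS : ∀ k ∉ S, coef g n k (ind s t) = 0) (y : ℝ) :
    proj1 g n (ind s t) y = ∑ k ∈ S, coef g n k (ind s t) * dilate g n k y := by
  refine finsum_eq_sum_of_support_subset _ fun k hk => ?_
  by_contra h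
  exact hk (by simp [hS k (by simpa using h)])

lemma integral_mul_sum {w : ℝ → ℝ} (hw : Continuous w) (hw' : HasCompactSupport w)
    (hg : Continuous g) (S : Finset ℤ) (c : ℤ → ℝ) :
    ∫ y, w y * ∑ k ∈ S, c k * dilate g n k y = ∑ k ∈ S, c k * ∫ y, w y * dilate g n k y := by
  simp_rw [Finset.mul_sum]
  rw [integral_finsetSum]
  · refine Finset.sum_congr rfl fun k _ => ?_
    rw [← integral_const_mul]
    congr 1 with y
    ring
  · intro k _
    refine Continuous.integrable_of_hasCompactSupport ?_ (hw'.mul_right)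
    exact hw.mul (continuous_const.mul (continuous_dilate hg))

/-- `P_{n+1} = P_n + Q_n` on indicator functions, as an identity of functions. Both sides lie in the span
of the scaling functions of level `n + 1` and have the same inner products with its elements. -/
lemma proj1_succ {r : ℕ} {φ φ' : ℝ → ℝ} (hφ : IsWaveletPair r φ φ')
    (h1R : ∀ x, φ x ≠ 0 → |x| ≤ R) (h2R : ∀ x, φ' x ≠ 0 → |x| ≤ R) (n : ℕ) (s t : ℝ) :
    proj1 φ (n + 1) (ind s t) = proj1 φ n (ind s t) + proj1 φ' n (ind s t) := by
  have hc := hφ.contDiff.continuous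
  have hc' := hφ.contDiff'.continuous
  set h := ind s t with hh
  set U := Submodule.span ℝ (Set.range (dilate φ (n + 1))) with hU
  have hU' := hφ.span_succ n
  rw [← hU] at hU'
  have e1 := fun m => proj1_ind_eq_sum (g := φ) (n := m) (s := s) (t := t) (S := near R m s t)
    (fun k hk => coef_ind_eq_zero h1R hk)
  have e2 := fun m => proj1_ind_eq_sum (g := φ') (n := m) (s := s) (t := t) (S := near R m s t)
    (fun k hk => coef_ind_eq_zero h2R hk)
  have m1 : proj1 φ (n + 1) h ∈ U := by
    have : proj1 φ (n + 1) h = ∑ k ∈ near R (n + 1) s t, coef φ (n + 1) k h • dilate φ (n + 1) k := by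
      ext y
      simp [e1 (n + 1) y, Finset.sum_apply, hh]
    rw [this]
    exact Submodule.sum_mem _ fun k _ => Submodule.smul_mem _ _
      (Submodule.subset_span (Set.mem_range_self k))
  have m2 : proj1 φ n h ∈ U := by
    have : proj1 φ n h = ∑ k ∈ near R n s t, coef φ n k h • dilate φ n k := by
      ext y
      simp [e1 n y, Finset.sum_apply, hh]
    rw [this, ← hU']
    exact Submodule.sum_mem _ fun k _ => Submodule.smul_mem _ _
      (Submodule.mem_sup_left (Submodule.subset_span (Set.mem_range_self k)))
  have m3 : proj1 φ' n h ∈ U := by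
    have : proj1 φ' n h = ∑ k ∈ near R n s t, coef φ' n k h • dilate φ' n k := by
      ext y
      simp [e2 n y, Finset.sum_apply, hh]
    rw [this, ← hU']
    exact Submodule.sum_mem _ fun k _ => Submodule.smul_mem _ _
      (Submodule.mem_sup_right (Submodule.subset_span (Set.mem_range_self k)))
  have hreg : ∀ w ∈ U, Continuous w ∧ HasCompactSupport w := by
    intro w hw
    induction hw using Submodule.span_induction with
    | mem w hw =>
      obtain ⟨k, rfl⟩ := hw
      exact ⟨continuous_dilate hc, hasCompactSupport_dilate h1R⟩
    | zero => exact ⟨continuous_zero, HasCompactSupport.zero⟩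
    | add v w _ _ hv hw => exact ⟨hv.1.add hw.1, hv.2.add hw.2⟩
    | smul c w _ hw => exact ⟨hw.1.const_smul c, hw.2.smul_left (f := fun _ => c)⟩
  have hint : ∀ w ∈ U, Integrable (fun y => w y * h y) := by
    intro w hw
    rw [hh, mul_ind]
    exact ((hreg w hw).1.integrable_of_hasCompactSupport (hreg w hw).2).indicator measurableSet_Ioc
  have hint2 : ∀ w ∈ U, ∀ v ∈ U, Integrable (fun y => w y * v y) := fun w hw v hv =>
    ((hreg w hw).1.mul (hreg v hv).1).integrable_of_hasCompactSupport (hreg w hw).2.mul_right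
  -- the inner products of both sides with an element of the span are those of the indicator
  have key : ∀ v ∈ U, ∀ A : Set (ℝ → ℝ), Submodule.span ℝ A = U →
      (∀ w ∈ A, ∫ y, w y * v y = ∫ y, w y * h y) → ∀ w ∈ U, ∫ y, w y * v y = ∫ y, w y * h y := by
    intro v hv A hA hAv w hw
    rw [← hA] at hw
    induction hw using Submodule.span_induction with
    | mem w hw => exact hAv w hw
    | zero => simp
    | add w₁ w₂ h₁ h₂ e₁ e₂ =>
      rw [hA] at h₁ h₂
      simp only [Pi.add_apply, add_mul]
      rw [integral_add (hint2 _ h₁ _ hv) (hint2 _ h₂ _ hv), integral_add (hint _ h₁) (hint _ h₂),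
        e₁, e₂]
    | smul c w _ e =>
      simp only [Pi.smul_apply, smul_eq_mul, mul_assoc]
      rw [integral_const_mul, integral_const_mul, e]
  have k1 := key _ m1 _ rfl (by
    rintro _ ⟨j, rfl⟩
    simp_rw [hh, e1 (n + 1)]
    rw [integral_mul_sum (continuous_dilate hc) (hasCompactSupport_dilate h1R) hc]
    simp_rw [hφ.orthonormal]
    change _ = coef φ (n + 1) j (ind s t)
    by_cases hj : j ∈ near R (n + 1) s t
    · simp [hj]
    · simp [hj, coef_ind_eq_zero h1R hj])
  have k2 := key _ (U.add_mem m2 m3) (Set.range (dilate φ n) ∪ Set.range (dilate φ' n))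
    (by rw [Submodule.span_union, hU']) (by
    rintro w hw
    have hwU : w ∈ U := by
      rw [← hU', ← Submodule.span_union]
      exact Submodule.subset_span hw
    simp only [Pi.add_apply, mul_add]
    rw [integral_add (hint2 _ hwU _ m2) (hint2 _ hwU _ m3)]
    simp_rw [hh, e1 n, e2 n]
    rw [integral_mul_sum (hreg w hwU).1 (hreg w hwU).2 hc,
      integral_mul_sum (hreg w hwU).1 (hreg w hwU).2 hc']
    rcases hw with ⟨j, rfl⟩ | ⟨j, rfl⟩
    · simp_rw [hφ.orthonormal, hφ.orthogonal n n le_rfl]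
      change _ = coef φ n j (ind s t)
      by_cases hj : j ∈ near R n s t
      · simp [hj]
      · simp [hj, coef_ind_eq_zero h1R hj]
    · have : ∀ k, ∫ y, dilate φ' n j y * dilate φ n k y = 0 := by
        intro k
        rw [← hφ.orthogonal n n le_rfl k j]
        congr 1 with y
        ring
      simp_rw [hφ.orthonormal', this]
      change _ = coef φ' n j (ind s t)
      by_cases hj : j ∈ near R n s t
      · simp [hj]
      · simp [hj, coef_ind_eq_zero h2R hj])
  have hv : proj1 φ (n + 1) h - (proj1 φ n h + proj1 φ' n h) ∈ U := U.sub_mem m1 (U.add_mem m2 m3)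
  set v := proj1 φ (n + 1) h - (proj1 φ n h + proj1 φ' n h) with hvd
  have hv0 : ∫ y, v y * v y = 0 := by
    have : ∀ y, v y * v y = v y * proj1 φ (n + 1) h y - v y * (proj1 φ n h + proj1 φ' n h) y := by
      intro y
      rw [← mul_sub]
      rfl
    simp_rw [this]
    rw [integral_sub (hint2 _ hv _ m1) (hint2 _ hv _ (U.add_mem m2 m3)), k1 _ hv, k2 _ hv, sub_self]
  rw [integral_eq_zero_iff_of_nonneg (fun y => mul_self_nonneg _) (hint2 _ hv _ hv)] at hv0
  have hvv := ((hreg v hv).1.mul (hreg v hv).1).ae_eq_iff_eq volume continuous_zero |>.1 hv0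
  have : v = 0 := by
    ext y
    have := congrFun hvv y
    simpa using this
  rwa [hvd, sub_eq_zero] at this

lemma proj1_add {r : ℕ} {φ φ' : ℝ → ℝ} (hφ : IsWaveletPair r φ φ')
    (h1R : ∀ x, φ x ≠ 0 → |x| ≤ R) (h2R : ∀ x, φ' x ≠ 0 → |x| ≤ R) (n q : ℕ) (s t : ℝ) (y : ℝ) :
    proj1 φ (n + q) (ind s t) y =
      proj1 φ n (ind s t) y + ∑ j ∈ Finset.range q, proj1 φ' (n + j) (ind s t) y := by
  induction q with
  | zero => simp
  | succ q ih =>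
    rw [← add_assoc, proj1_succ hφ h1R h2R, Pi.add_apply, ih, Finset.sum_range_succ, add_assoc]

end OneDim

/-! ### Normalized test functions -/

section TestFunctions

variable {d r : ℕ}

lemma pderiv_smul (i : Fin d) (c : ℝ) (ψ : (Fin d → ℝ) → ℝ) :
    pderiv i (c • ψ) = c • pderiv i ψ := by
  ext x
  simp [pderiv, fderiv_const_smul_field]

lemma iterate_pderiv_smul (i : Fin d) (n : ℕ) (c : ℝ) (ψ : (Fin d → ℝ) → ℝ) :
    (pderiv i)^[n] (c • ψ) = c • (pderiv i)^[n] ψ := by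
  induction n generalizing ψ with
  | zero => rfl
  | succ n ih => rw [Function.iterate_succ_apply, Function.iterate_succ_apply, pderiv_smul, ih]

lemma mixedPDeriv_smul (n : Fin d → ℕ) (c : ℝ) (ψ : (Fin d → ℝ) → ℝ) :
    mixedPDeriv n (c • ψ) = c • mixedPDeriv n ψ := by
  unfold mixedPDeriv
  induction List.finRange d with
  | nil => rfl
  | cons i l ih => rw [List.foldr_cons, List.foldr_cons, ih, iterate_pderiv_smul]

lemma mixedPDeriv_zero (ψ : (Fin d → ℝ) → ℝ) : mixedPDeriv (0 : Fin d → ℕ) ψ = ψ := by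
  unfold mixedPDeriv
  induction List.finRange d with
  | nil => rfl
  | cons i l ih => rw [List.foldr_cons, ih]; rfl

lemma crNorm_nonneg (ψ : (Fin d → ℝ) → ℝ) : 0 ≤ crNorm r ψ :=
  Finset.sum_nonneg fun _ _ => Real.iSup_nonneg fun _ => abs_nonneg _

lemma crNorm_smul (c : ℝ) (ψ : (Fin d → ℝ) → ℝ) : crNorm r (c • ψ) = |c| * crNorm r ψ := by
  unfold crNorm
  rw [Finset.mul_sum]
  refine Finset.sum_congr rfl fun n _ => ?_
  rw [mixedPDeriv_smul, Real.mul_iSup_of_nonneg (abs_nonneg c)]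
  simp [abs_mul]

lemma eq_zero_of_crNorm_eq_zero {ψ : (Fin d → ℝ) → ℝ} (hc : Continuous ψ)
    (hs : HasCompactSupport ψ) (h : crNorm r ψ = 0) : ψ = 0 := by
  unfold crNorm at h
  rw [Finset.sum_eq_zero_iff_of_nonneg
    fun _ _ => Real.iSup_nonneg fun _ => abs_nonneg _] at h
  have h0 := h 0 (by simp [Fintype.mem_piFinset])
  rw [mixedPDeriv_zero] at h0
  obtain ⟨C, hC⟩ := hc.bounded_above_of_compact_support hs
  ext x
  have := le_ciSup (f := fun x => |ψ x|) ⟨C, by rintro _ ⟨y, rfl⟩; exact hC y⟩ x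
  rw [h0] at this
  simpa using this

lemma IsTest.smul {K : Set (Fin d → ℝ)} {ψ : (Fin d → ℝ) → ℝ} (h : IsTest r K ψ) (c : ℝ) :
    IsTest r K (c • ψ) :=
  ⟨h.1.const_smul c, (tsupport_smul_subset_right (fun _ => c) ψ).trans h.2⟩

lemma IsTest.add {K : Set (Fin d → ℝ)} {ψ χ : (Fin d → ℝ) → ℝ} (h : IsTest r K ψ)
    (h' : IsTest r K χ) : IsTest r K (ψ + χ) :=
  ⟨h.1.add h'.1, (tsupport_add ψ χ).trans (Set.union_subset h.2 h'.2)⟩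

lemma IsTest.zero {K : Set (Fin d → ℝ)} : IsTest r K (0 : (Fin d → ℝ) → ℝ) :=
  ⟨contDiff_const, by
    have : tsupport (0 : (Fin d → ℝ) → ℝ) = ∅ := tsupport_eq_empty_iff.2 rfl
    simp [this]⟩

/-- Every test function supported in `[1/4,3/4]^d` is a multiple of a normalized one, or zero. -/
lemma exists_testBall {ψ : (Fin d → ℝ) → ℝ}
    (h : IsTest r (Set.Icc (fun _ => 1 / 4) (fun _ => 3 / 4)) ψ) :
    ψ = 0 ∨ ∃ χ ∈ testBall d r, ψ = crNorm r ψ • χ := by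
  by_cases h0 : crNorm r ψ = 0
  · left
    refine eq_zero_of_crNorm_eq_zero h.1.continuous ?_ h0
    exact isCompact_Icc.of_isClosed_subset (isClosed_tsupport _) h.2
  · right
    refine ⟨(crNorm r ψ)⁻¹ • ψ, ⟨h.smul _, ?_⟩, ?_⟩
    · rw [crNorm_smul, abs_of_nonneg (inv_nonneg.2 (crNorm_nonneg ψ)), inv_mul_cancel₀ h0]
    · rw [smul_smul, mul_inv_cancel₀ h0, one_smul]

lemma rescale_smul (c : ℝ) (ψ : (Fin d → ℝ) → ℝ) (x lam : Fin d → ℝ) :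
    rescale (c • ψ) x lam = c • rescale ψ x lam := by
  ext y
  simp only [rescale, Pi.smul_apply, smul_eq_mul]
  ring

lemma isTest_rescale {ψ : (Fin d → ℝ) → ℝ} (hψ : ψ ∈ testBall d r) {x lam : Fin d → ℝ}
    (hlam : ∀ i, 0 < lam i) {K : Set (Fin d → ℝ)}
    (hK : ∀ y, (∀ i, x i ≤ y i ∧ y i ≤ x i + lam i) → y ∈ K) :
    IsTest r K (rescale ψ x lam) := by
  refine ⟨?_, ?_⟩
  · have h1 : ContDiff ℝ r fun y : Fin d → ℝ => fun i => (y i - x i) / lam i := by fun_prop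
    exact contDiff_const.mul (hψ.1.1.comp h1)
  · have h2 : tsupport (rescale ψ x lam) ⊆ Set.Icc x (x + lam) := by
      refine closure_minimal (fun y hy => ?_) isClosed_Icc
      have h3 : ψ (fun i => (y i - x i) / lam i) ≠ 0 := right_ne_zero_of_mul hy
      have h4 := hψ.1.2 (subset_tsupport _ h3)
      refine ⟨fun i => ?_, fun i => ?_⟩
      · have := (le_div_iff₀ (hlam i)).1 (h4.1 i)
        have := hlam i
        linarith
      · have := (div_le_iff₀ (hlam i)).1 (h4.2 i)
        have := hlam i
        simp only [Pi.add_apply]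
        linarith
    exact fun y hy => hK y fun i => ⟨(h2 hy).1 i, (h2 hy).2 i⟩

end TestFunctions

/-! ### Tensor products of one-dimensional functions -/

section Tensor

variable {d : ℕ}

/-- The function `y ↦ ∏_i u_i(y_i)`. -/
def tensor (u : Fin d → ℝ → ℝ) : (Fin d → ℝ) → ℝ := fun y => ∏ i, u i (y i)

lemma tensor_sum {ι : Type*} (S : Fin d → Finset ι) (v : Fin d → ι → ℝ → ℝ) :
    tensor (fun i => ∑ k ∈ S i, v i k) =
      ∑ k ∈ Fintype.piFinset S, tensor fun i => v i (k i) := by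
  ext y
  simp only [tensor, Finset.sum_apply]
  rw [Finset.prod_univ_sum]

lemma tensor_smul (c : Fin d → ℝ) (v : Fin d → ℝ → ℝ) :
    tensor (fun i => c i • v i) = (∏ i, c i) • tensor v := by
  ext y
  simp [tensor, Finset.prod_mul_distrib]

lemma rectIndicator_eq_tensor (s t : Fin d → ℝ) :
    rectIndicator s t = tensor fun i => ind (s i) (t i) := by
  ext y
  by_cases h : ∀ i, y i ∈ Set.Ioc (s i) (t i)
  · rw [rectIndicator, Set.indicator_of_mem (by simpa using h), tensor,
      Finset.prod_eq_one fun i _ => by simp [ind, h i]]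
  · have h' := h
    push Not at h
    obtain ⟨i, hi⟩ := h
    rw [rectIndicator, Set.indicator_of_notMem (by simpa using h'), tensor,
      Finset.prod_eq_zero (Finset.mem_univ i) (by simp [ind, hi])]

lemma integral_scalingFn_mul_rectIndicator (φ : ℝ → ℝ) (n : Fin d → ℕ) (k : Fin d → ℤ)
    (s t : Fin d → ℝ) :
    ∫ y, scalingFn φ n k y * rectIndicator s t y =
      ∏ i, coef φ (n i) (k i) (ind (s i) (t i)) := by
  simp only [coef]
  rw [← integral_fintype_prod_volume_eq_prod]
  congr 1 with y
  rw [rectIndicator_eq_tensor, scalingFn, tensor, Finset.prod_mul_distrib]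

/-- The projection of the indicator of a rectangle is a tensor product of one-dimensional ones. -/
lemma waveletProj_rectIndicator {φ : ℝ → ℝ} {R : ℝ} (hR : ∀ x, φ x ≠ 0 → |x| ≤ R)
    (n : Fin d → ℕ) (s t : Fin d → ℝ) :
    waveletProj φ n (rectIndicator s t) =
      tensor fun i => proj1 φ (n i) (ind (s i) (t i)) := by
  ext z
  rw [waveletProj, tensor, Finset.prod_congr rfl fun i _ => proj1_ind_eq_sum
    (S := near R (n i) (s i) (t i)) (fun k hk => coef_ind_eq_zero hR hk) (z i),
    Finset.prod_univ_sum]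
  simp_rw [integral_scalingFn_mul_rectIndicator]
  rw [finsum_eq_sum_of_support_subset (s := Fintype.piFinset fun i => near R (n i) (s i) (t i))]
  · refine Finset.sum_congr rfl fun k _ => ?_
    rw [scalingFn, Finset.prod_mul_distrib]
  · intro k hk
    rw [Finset.mem_coe, Fintype.mem_piFinset]
    intro i
    by_contra h
    refine hk ?_
    simp only
    rw [Finset.prod_eq_zero (Finset.mem_univ i) (coef_ind_eq_zero hR h), zero_mul]

/-- The function `z ↦ ∏_i g_i(4R z_i - 2R)`, which is supported in `[1/4,3/4]^d` if all `g_i` are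
supported in `[-R,R]`; the tensor products of wavelets are its rescaled translates. -/
def template (R : ℝ) (g : Fin d → ℝ → ℝ) : (Fin d → ℝ) → ℝ :=
  tensor fun i z => g i (4 * R * z - 2 * R)

lemma isTest_template {r : ℕ} {R : ℝ} (hR : 0 < R) {g : Fin d → ℝ → ℝ}
    (hg : ∀ i, ContDiff ℝ r (g i)) (hgR : ∀ i x, g i x ≠ 0 → |x| ≤ R) :
    IsTest r (Set.Icc (fun _ => 1 / 4) (fun _ => 3 / 4)) (template R g) := by
  refine ⟨?_, closure_minimal (fun z hz => ?_) isClosed_Icc⟩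
  · unfold template tensor
    refine contDiff_prod fun i _ => (hg i).comp ?_
    fun_prop
  · have h : ∀ i, |4 * R * z i - 2 * R| ≤ R := fun i => hgR i _
      (Finset.prod_ne_zero_iff.1 (show ∏ i, g i (4 * R * z i - 2 * R) ≠ 0 from hz) i
        (Finset.mem_univ i))
    refine ⟨fun i => ?_, fun i => ?_⟩
    · have := (abs_le.1 (h i)).1
      nlinarith
    · have := (abs_le.1 (h i)).2
      nlinarith

lemma tensor_dilate_eq {R : ℝ} (hR : 0 < R) (g : Fin d → ℝ → ℝ) (n : Fin d → ℕ) (k : Fin d → ℤ) :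
    tensor (fun i => dilate (g i) (n i) (k i)) =
      (∏ i, 4 * R * ((2 : ℝ) ^ ((n i : ℝ) / 2))⁻¹) •
        rescale (template R g) (fun i => (k i - 2 * R) / 2 ^ n i) (fun i => 4 * R / 2 ^ n i) := by
  ext y
  simp only [tensor, template, rescale, Pi.smul_apply, smul_eq_mul]
  rw [← mul_assoc, ← Finset.prod_mul_distrib, ← Finset.prod_mul_distrib]
  refine Finset.prod_congr rfl fun i _ => ?_
  have h1 : (0 : ℝ) < 2 ^ ((n i : ℝ) / 2) := by positivity
  have h2 : (0 : ℝ) < 2 ^ n i := by positivity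
  rw [dilate_eq]
  have h3 : 4 * R * ((y i - (k i - 2 * R) / 2 ^ n i) / (4 * R / 2 ^ n i)) - 2 * R =
      2 ^ n i * y i - k i := by
    field_simp
    ring
  rw [h3]
  congr 1
  rw [inv_div, ← sq_two_rpow_half]
  field_simp

/-- Quantitative data of a wavelet basis: the father and the mother have support in `[-R,R]` and
`L^1` norm at most `G`, and the `C^r` norms of their tensor products are at most `C₀`. -/
structure WaveletBounds (d r : ℕ) (φ φ' : ℝ → ℝ) (R G C₀ : ℝ) : Prop where
  isWaveletPair : IsWaveletPair r φ φ'
  one_le : 1 ≤ R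
  father_support : ∀ x, φ x ≠ 0 → |x| ≤ R
  mother_support : ∀ x, φ' x ≠ 0 → |x| ≤ R
  father_le : ∫ x, |φ x| ≤ G
  mother_le : ∫ x, |φ' x| ≤ G
  crNorm_le : ∀ g : Fin d → ℝ → ℝ, (∀ i, g i = φ ∨ g i = φ') → crNorm r (template R g) ≤ C₀

lemma IsWaveletPair.exists_waveletBounds {r : ℕ} {φ φ' : ℝ → ℝ} (h : IsWaveletPair r φ φ')
    (d : ℕ) : ∃ R G C₀ : ℝ, WaveletBounds d r φ φ' R G C₀ := by
  obtain ⟨R₁, h₁⟩ := (Metric.isBounded_iff_subset_closedBall (0 : ℝ)).1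
    h.hasCompactSupport.isCompact.isBounded
  obtain ⟨R₂, h₂⟩ := (Metric.isBounded_iff_subset_closedBall (0 : ℝ)).1
    h.hasCompactSupport'.isCompact.isBounded
  set R := max 1 (max R₁ R₂)
  refine ⟨R, max (∫ x, |φ x|) (∫ x, |φ' x|),
    ∑ b : Fin d → Bool, crNorm r (template R fun i => if b i then φ else φ'), h,
    le_max_left _ _, fun x hx => ?_, fun x hx => ?_, le_max_left _ _, le_max_right _ _, ?_⟩
  · have := h₁ (subset_tsupport _ hx)
    rw [mem_closedBall_zero_iff] at this
    exact this.trans ((le_max_left _ _).trans (le_max_right _ _))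
  · have := h₂ (subset_tsupport _ hx)
    rw [mem_closedBall_zero_iff] at this
    exact this.trans ((le_max_right _ _).trans (le_max_right _ _))
  · intro g hg
    classical
    have : g = fun i => if (fun i => decide (g i = φ)) i then φ else φ' := by
      ext1 i
      by_cases hi : g i = φ
      · simp [hi]
      · simp [(hg i).resolve_left hi]
    rw [this]
    exact Finset.single_le_sum (f := fun b : Fin d → Bool =>
      crNorm r (template R fun i => if b i then φ else φ')) (fun _ _ => crNorm_nonneg _)
      (Finset.mem_univ _)

namespace WaveletBounds

variable {r : ℕ} {φ φ' : ℝ → ℝ} {R G C₀ : ℝ}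

lemma R_pos (h : WaveletBounds d r φ φ' R G C₀) : 0 < R := zero_lt_one.trans_le h.one_le

lemma G_nonneg (h : WaveletBounds d r φ φ' R G C₀) : 0 ≤ G :=
  (integral_nonneg fun _ => abs_nonneg _).trans h.father_le

lemma C₀_nonneg (h : WaveletBounds d r φ φ' R G C₀) : 0 ≤ C₀ :=
  (crNorm_nonneg _).trans (h.crNorm_le (fun _ => φ) fun _ => Or.inl rfl)

lemma support (h : WaveletBounds d r φ φ' R G C₀) {g : ℝ → ℝ} (hg : g = φ ∨ g = φ') (x : ℝ)
    (hx : g x ≠ 0) : |x| ≤ R := by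
  rcases hg with rfl | rfl
  · exact h.father_support x hx
  · exact h.mother_support x hx

lemma contDiff (h : WaveletBounds d r φ φ' R G C₀) {g : ℝ → ℝ} (hg : g = φ ∨ g = φ') :
    ContDiff ℝ r g := by
  rcases hg with rfl | rfl
  · exact h.isWaveletPair.contDiff
  · exact h.isWaveletPair.contDiff'

lemma abs_coef_le (h : WaveletBounds d r φ φ' R G C₀) {g : ℝ → ℝ} (hg : g = φ ∨ g = φ')
    (n : ℕ) (k : ℤ) (s t : ℝ) :
    |coef g n k (ind s t)| ≤ ((2 : ℝ) ^ ((n : ℝ) / 2))⁻¹ * G := by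
  refine (abs_coef_ind_le (h.contDiff hg).continuous (h.support hg)).trans ?_
  gcongr
  rcases hg with rfl | rfl
  · exact h.father_le
  · exact h.mother_le

/-- A tensor product of wavelets is zero or a multiple of a normalized rescaled test function. -/
lemma tensor_dilate (h : WaveletBounds d r φ φ' R G C₀) {g : Fin d → ℝ → ℝ}
    (hg : ∀ i, g i = φ ∨ g i = φ') (n : Fin d → ℕ) (k : Fin d → ℤ) :
    tensor (fun i => dilate (g i) (n i) (k i)) = 0 ∨ ∃ χ ∈ testBall d r, ∃ c : ℝ,
      |c| ≤ C₀ * ∏ i, (4 * R * ((2 : ℝ) ^ ((n i : ℝ) / 2))⁻¹) ∧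
      tensor (fun i => dilate (g i) (n i) (k i)) =
        c • rescale χ (fun i => (k i - 2 * R) / 2 ^ n i) (fun i => 4 * R / 2 ^ n i) := by
  have hR := h.R_pos
  have h0 : 0 ≤ ∏ i, 4 * R * ((2 : ℝ) ^ ((n i : ℝ) / 2))⁻¹ :=
    Finset.prod_nonneg fun i _ => by positivity
  rcases exists_testBall (isTest_template hR (fun i => h.contDiff (hg i))
    fun i => h.support (hg i)) with h1 | ⟨χ, hχ, h1⟩
  · left
    rw [tensor_dilate_eq hR, h1]
    ext y
    simp [rescale]
  · right
    refine ⟨χ, hχ, (∏ i, 4 * R * ((2 : ℝ) ^ ((n i : ℝ) / 2))⁻¹) * crNorm r (template R g), ?_, ?_⟩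
    · rw [abs_of_nonneg (mul_nonneg h0 (crNorm_nonneg _)), mul_comm C₀]
      gcongr
      exact h.crNorm_le g hg
    · rw [tensor_dilate_eq hR, mul_smul, ← rescale_smul _ χ, ← h1]

end WaveletBounds

end Tensor

/-! ### Convergence of the wavelet expansion of a rectangle -/

section Interior

variable {d : ℕ}

/-- The levels from which on an interval `(s,t]` is expanded when a relative margin `e` is available
on both sides: `2^{-N}` is comparable to `(e ∧ 1)(t - s)`. -/
structure IsBaseLevel (R T s t e : ℝ) (N : ℕ) : Prop where
  lower : 4 * R * max 1 T ≤ 2 ^ N * (min e 1 * (t - s))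
  upper : 2 ^ N * (min e 1 * (t - s)) ≤ 2 * (4 * R * max 1 T)

variable {R T : ℝ}

lemma exists_isBaseLevel (hR : 1 ≤ R) {s t e : ℝ} (hst : s < t) (hT : t - s ≤ T) (he : 0 < e) :
    ∃ N, IsBaseLevel R T s t e N := by
  have h0 : 0 < min e 1 * (t - s) := mul_pos (lt_min he one_pos) (sub_pos.2 hst)
  have h1 : min e 1 * (t - s) ≤ 4 * R * max 1 T := by
    have h2 : min e 1 * (t - s) ≤ 1 * (t - s) :=
      mul_le_mul_of_nonneg_right (min_le_right _ _) (sub_pos.2 hst).le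
    have h3 : T ≤ max 1 T := le_max_right _ _
    have h4 : 1 ≤ max 1 T := le_max_left _ _
    nlinarith
  obtain ⟨n, hn1, hn2⟩ := exists_nat_pow_near (x := 4 * R * max 1 T / (min e 1 * (t - s)))
    ((one_le_div h0).2 h1) (one_lt_two (α := ℝ))
  refine ⟨n + 1, ?_, ?_⟩
  · exact ((div_lt_iff₀ h0).1 hn2).le
  · rw [pow_succ]
    have := (le_div_iff₀ h0).1 hn1
    nlinarith

namespace IsBaseLevel

variable {s t e : ℝ} {N : ℕ}

/-- Beyond the base level, the cells of the wavelets which meet `(s,t]` fit into the interval enlarged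
by its margin, and they are not longer than `1` and `t - s`. -/
lemma cell (h : IsBaseLevel R T s t e N) (hR : 1 ≤ R) (hst : s < t)
    (hT : t - s ≤ T) {n : ℕ}     (hn : N ≤ n) {k : ℤ} (hk : k ∈ near R n s t) :
    s - |t - s| * e ≤ (k - 2 * R) / 2 ^ n ∧ (k - 2 * R) / 2 ^ n + 4 * R / 2 ^ n ≤ t + |t - s| * e ∧
      4 * R / 2 ^ n ≤ 1 ∧ 4 * R / 2 ^ n ≤ t - s := by
  have h2 : (0 : ℝ) < 2 ^ n := by positivity
  have hN : (2 : ℝ) ^ N ≤ 2 ^ n := pow_le_pow_right₀ one_le_two hn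
  have hts := sub_pos.2 hst
  have hM : 1 ≤ max 1 T := le_max_left _ _
  have h3 := h.lower
  have h0 : 0 < min e 1 * (t - s) := by
    by_contra h0
    have : (2 : ℝ) ^ N * (min e 1 * (t - s)) ≤ 0 :=
      mul_nonpos_of_nonneg_of_nonpos (by positivity) (not_lt.1 h0)
    nlinarith
  have h4 : 4 * R * max 1 T ≤ 2 ^ n * (min e 1 * (t - s)) :=
    h3.trans (mul_le_mul_of_nonneg_right hN h0.le)
  have h5 : 4 * R ≤ 2 ^ n * (min e 1 * (t - s)) := by nlinarith
  have h6 : min e 1 * (t - s) ≤ e * (t - s) :=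
    mul_le_mul_of_nonneg_right (min_le_left _ _) hts.le
  have h7 : min e 1 * (t - s) ≤ 1 * (t - s) :=
    mul_le_mul_of_nonneg_right (min_le_right _ _) hts.le
  rw [mem_near] at hk
  rw [abs_of_pos hts]
  have h8 := mul_le_mul_of_nonneg_left h6 h2.le
  have h9 := mul_le_mul_of_nonneg_left h7 h2.le
  refine ⟨?_, ?_, ?_, ?_⟩
  · rw [le_div_iff₀ h2]
    nlinarith
  · rw [← add_div, div_le_iff₀ h2]
    nlinarith
  · rw [div_le_one h2]
    have h10 : min e 1 * (t - s) ≤ max 1 T := by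
      have : T ≤ max 1 T := le_max_right _ _
      linarith
    have h11 : 4 * R * max 1 T ≤ 2 ^ n * max 1 T := h4.trans (mul_le_mul_of_nonneg_left h10 h2.le)
    exact le_of_mul_le_mul_right h11 (by linarith)
  · rw [div_le_iff₀ h2]
    nlinarith

/-- At the base level `N`, the cell length `4R 2^{-N}` is at least a constant times `(e ∧ 1)(t - s)`. -/
lemma rpow_le (h : IsBaseLevel R T s t e N) (hst : s < t) (he : 0 < e) {α : ℝ}
    (hα : -1 < α ∧ α < 0) :
    (4 * R / 2 ^ N) ^ α ≤ 2 * max 1 T * ((min e 1) ^ α * (t - s) ^ α) := by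
  have h2 : (0 : ℝ) < 2 ^ N := by positivity
  have hM : 1 ≤ max 1 T := le_max_left _ _
  have he1 : 0 < min e 1 := lt_min he one_pos
  have hts := sub_pos.2 hst
  have h0 : 0 < min e 1 * (t - s) := mul_pos he1 hts
  have h3 : (2 * max 1 T)⁻¹ * (min e 1 * (t - s)) ≤ 4 * R / 2 ^ N := by
    rw [inv_mul_eq_div, div_le_div_iff₀ (by positivity) h2]
    have := h.upper
    nlinarith
  refine (Real.rpow_le_rpow_of_nonpos (by positivity) h3 hα.2.le).trans ?_
  rw [Real.mul_rpow (by positivity) h0.le, Real.mul_rpow he1.le hts.le,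
    Real.inv_rpow (by positivity), ← Real.rpow_neg (by positivity)]
  gcongr
  calc (2 * max 1 T) ^ (-α) ≤ (2 * max 1 T) ^ (1 : ℝ) :=
        Real.rpow_le_rpow_of_exponent_le (by linarith) (by linarith [hα.1])
    _ = 2 * max 1 T := Real.rpow_one _

end IsBaseLevel

/-- The generators of the blocks: scaling functions in block `0`, wavelets in the other ones. -/
def blockGen (φ φ' : ℝ → ℝ) : ℕ → ℝ → ℝ
  | 0 => φ
  | _ + 1 => φ'

/-- The level of block `q` of an expansion which starts at level `N`. -/
def blockLevel (N q : ℕ) : ℕ := N + (q - 1)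

/-- Block `q` of the expansion of the indicator of `(s,t]` from level `N`: the father wavelets of level
`N` for `q = 0`, and the mother wavelets of level `N + q - 1` for `q > 0`. -/
def block (φ φ' : ℝ → ℝ) (N : ℕ) (s t : ℝ) (q : ℕ) : ℝ → ℝ :=
  proj1 (blockGen φ φ' q) (blockLevel N q) (ind s t)

/-- The indices which contribute to block `q`. -/
def blockIdx (R : ℝ) (N : ℕ) (s t : ℝ) : ℕ → Finset ℤ
  | 0 => near R N s t
  | q + 1 => (near R (N + q) s s ∪ near R (N + q) t t) ∩ near R (N + q) s t

lemma blockIdx_subset (R : ℝ) (N : ℕ) (s t : ℝ) (q : ℕ) :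
    blockIdx R N s t q ⊆ near R (blockLevel N q) s t := by
  cases q with
  | zero => exact subset_rfl
  | succ q => exact Finset.inter_subset_right

lemma blockGen_eq (φ φ' : ℝ → ℝ) (q : ℕ) : blockGen φ φ' q = φ ∨ blockGen φ φ' q = φ' := by
  cases q
  · exact Or.inl rfl
  · exact Or.inr rfl

variable {r : ℕ} {φ φ' : ℝ → ℝ} {G C₀ : ℝ}

lemma WaveletBounds.proj1_eq_sum_block (h : WaveletBounds d r φ φ' R G C₀) (N q : ℕ) (s t : ℝ) :
    proj1 φ (N + q) (ind s t) = ∑ j ∈ Finset.range (q + 1), block φ φ' N s t j := by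
  ext y
  rw [proj1_add h.isWaveletPair h.father_support h.mother_support, Finset.sum_apply,
    Finset.sum_range_succ', add_comm]
  rfl

lemma WaveletBounds.block_eq_sum (h : WaveletBounds d r φ φ' R G C₀) (N q : ℕ) (s t : ℝ) :
    block φ φ' N s t q = ∑ k ∈ blockIdx R N s t q,
      coef (blockGen φ φ' q) (blockLevel N q) k (ind s t) •
        dilate (blockGen φ φ' q) (blockLevel N q) k := by
  ext y
  rw [Finset.sum_apply]
  refine proj1_ind_eq_sum (fun k hk => ?_) y
  cases q with
  | zero => exact coef_ind_eq_zero h.father_support hk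
  | succ q =>
    simp only [blockIdx, Finset.mem_inter, not_and_or] at hk
    rcases hk with hk | hk
    · refine coef_ind_eq_zero_of_integral h.mother_support ?_ hk
      exact show ∫ x, φ' x = 0 by simpa using h.isWaveletPair.moments 0 (Nat.zero_le _)
    · exact coef_ind_eq_zero h.mother_support hk

/-- The contributions of the blocks in one direction decay geometrically: block `0` has about
`2^N (t - s)` terms, the other ones have a bounded number of terms. -/
lemma card_blockIdx_mul_le (hR : 1 ≤ R) (hG : 0 ≤ G) {s t e : ℝ} {N : ℕ} (hst : s < t)
    (h : IsBaseLevel R T s t e N) {α : ℝ} (hα : -1 < α ∧ α < 0) (q : ℕ) :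
    ((blockIdx R N s t q).card : ℝ) * (4 * R * G * (2 ^ blockLevel N q)⁻¹ *
        (4 * R / 2 ^ blockLevel N q) ^ α) ≤
      24 * R * G * (t - s) * (4 * R / 2 ^ N) ^ α * ((1 / 2 : ℝ) ^ (1 + α)) ^ q := by
  have hN : (0 : ℝ) < 2 ^ N := by positivity
  have hts := sub_pos.2 hst
  have hR0 : 0 < R := by linarith
  have h4 : 4 * R ≤ 2 ^ N * (t - s) := by
    have h3 := h.lower
    have h7 : min e 1 * (t - s) ≤ 1 * (t - s) :=
      mul_le_mul_of_nonneg_right (min_le_right _ _) hts.le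
    have h8 : 1 ≤ max 1 T := le_max_left _ _
    have h9 := mul_le_mul_of_nonneg_left h7 hN.le
    nlinarith
  have hlam : 0 < (4 * R / 2 ^ N) ^ α := by positivity
  cases q with
  | zero =>
    have hc : ((blockIdx R N s t 0).card : ℝ) ≤ 3 * (2 ^ N * (t - s)) := by
      have := card_near_le hR0.le N hst.le
      change ((near R N s t).card : ℝ) ≤ _
      linarith
    simp only [blockLevel, Nat.zero_sub, add_zero, pow_zero, mul_one]
    calc ((blockIdx R N s t 0).card : ℝ) * (4 * R * G * (2 ^ N)⁻¹ * (4 * R / 2 ^ N) ^ α)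
        ≤ 3 * (2 ^ N * (t - s)) * (4 * R * G * (2 ^ N)⁻¹ * (4 * R / 2 ^ N) ^ α) := by gcongr
      _ = 12 * R * G * (t - s) * (4 * R / 2 ^ N) ^ α := by field_simp; ring
      _ ≤ 24 * R * G * (t - s) * (4 * R / 2 ^ N) ^ α := by gcongr; norm_num
  | succ q =>
    have hc : ((blockIdx R N s t (q + 1)).card : ℝ) ≤ 6 * R := by
      have h1 := card_near_le hR0.le (N + q) (le_refl s)
      have h2 := card_near_le hR0.le (N + q) (le_refl t)
      have h3 : (blockIdx R N s t (q + 1)).card ≤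
          (near R (N + q) s s).card + (near R (N + q) t t).card :=
        (Finset.card_le_card Finset.inter_subset_left).trans (Finset.card_union_le _ _)
      have h4 : ((blockIdx R N s t (q + 1)).card : ℝ) ≤
          (near R (N + q) s s).card + (near R (N + q) t t).card := by exact_mod_cast h3
      simp only [sub_self, mul_zero, zero_add] at h1 h2
      linarith
    have hq : (1 / 2 : ℝ) ^ q = (2 ^ q)⁻¹ := by rw [one_div, inv_pow]
    have hsplit : (4 * R / 2 ^ (N + q)) ^ α = (4 * R / 2 ^ N) ^ α * ((1 / 2 : ℝ) ^ α) ^ q := by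
      rw [pow_add, ← div_div, div_eq_mul_inv _ ((2 : ℝ) ^ q), ← hq,
        Real.mul_rpow (by positivity) (by positivity)]
      congr 1
      rw [← Real.rpow_natCast, ← Real.rpow_natCast, ← Real.rpow_mul (by norm_num),
        ← Real.rpow_mul (by norm_num), mul_comm]
    have hth : (1 / 2 : ℝ) ^ (1 + α) = 1 / 2 * (1 / 2 : ℝ) ^ α := by
      rw [Real.rpow_add (by norm_num), Real.rpow_one]
    have hhalf : (1 : ℝ) ≤ (1 / 2 : ℝ) ^ α :=
      Real.one_le_rpow_of_pos_of_le_one_of_nonpos (by norm_num) (by norm_num) hα.2.le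
    change ((blockIdx R N s t (q + 1)).card : ℝ) * (4 * R * G * (2 ^ (N + q))⁻¹ *
        (4 * R / 2 ^ (N + q)) ^ α) ≤ _
    rw [hsplit, hth, pow_succ, mul_pow, pow_add, mul_inv, ← hq]
    set u := ((1 / 2 : ℝ) ^ α) ^ q
    have hu : 0 < u := by positivity
    calc ((blockIdx R N s t (q + 1)).card : ℝ) * (4 * R * G * ((2 ^ N)⁻¹ * (1 / 2) ^ q) *
          ((4 * R / 2 ^ N) ^ α * u))
        ≤ 6 * R * (4 * R * G * ((2 ^ N)⁻¹ * (1 / 2) ^ q) * ((4 * R / 2 ^ N) ^ α * u)) := by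
          gcongr
      _ = (4 * R) * (2 ^ N)⁻¹ * (6 * R * G * (1 / 2) ^ q * ((4 * R / 2 ^ N) ^ α * u)) := by ring
      _ ≤ (2 ^ N * (t - s)) * (2 ^ N)⁻¹ *
          (6 * R * G * (1 / 2) ^ q * ((4 * R / 2 ^ N) ^ α * u)) := by gcongr
      _ = 6 * R * G * (t - s) * (4 * R / 2 ^ N) ^ α * ((1 / 2) ^ q * u) * 1 := by field_simp
      _ ≤ 12 * R * G * (t - s) * (4 * R / 2 ^ N) ^ α * ((1 / 2) ^ q * u) *
          (1 / 2 * (1 / 2 : ℝ) ^ α * 2) := by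
          gcongr
          · norm_num
          · linarith
      _ = _ := by ring

end Interior

section Interior

variable {d : ℕ} {T : ℝ}

/-- The rectangle `[s,t]`, enlarged by the relative margins `e`, is contained in `[0,T]^d` and in
`[a,b]`. -/
structure HasMargin (T : ℝ) (s t e a b : Fin d → ℝ) : Prop where
  pos : ∀ i, 0 < e i
  nonneg : ∀ i, 0 ≤ s i - |t i - s i| * e i
  le_T : ∀ i, t i + |t i - s i| * e i ≤ T
  le_left : ∀ i, a i ≤ s i - |t i - s i| * e i
  right_le : ∀ i, t i + |t i - s i| * e i ≤ b i

namespace HasMargin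

variable {s t e a b : Fin d → ℝ}

lemma sub_le (h : HasMargin T s t e a b) (i : Fin d) : t i - s i ≤ T := by
  have h1 := h.nonneg i
  have h2 := h.le_T i
  have h3 : 0 ≤ |t i - s i| * e i := mul_nonneg (abs_nonneg _) (h.pos i).le
  linarith

lemma isScale (h : HasMargin T s t e a b) (hst : ∀ i, s i < t i) {R : ℝ} (hR : 1 ≤ R)
    {N n : Fin d → ℕ} (hN : ∀ i, IsBaseLevel R T (s i) (t i) (e i) (N i)) (hn : ∀ i, N i ≤ n i)
    {k : Fin d → ℤ} (hk : ∀ i, k i ∈ near R (n i) (s i) (t i)) :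
    IsScale T (fun i => ((k i - 2 * R) / 2 ^ n i : ℝ)) (fun i => 4 * R / 2 ^ n i) ∧
      (∀ i, a i ≤ (k i - 2 * R) / 2 ^ n i ∧
        (k i - 2 * R) / 2 ^ n i + 4 * R / 2 ^ n i ≤ b i) ∧
      ∀ i, 4 * R / 2 ^ n i ≤ t i - s i := by
  have key := fun i => (hN i).cell hR (hst i) (h.sub_le i) (hn i) (hk i)
  have hR0 : 0 < R := by linarith
  refine ⟨fun i => ⟨by positivity, (key i).2.2.1, (h.nonneg i).trans (key i).1,
    (key i).2.1.trans (h.le_T i)⟩, fun i => ⟨(h.le_left i).trans (key i).1,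
    (key i).2.1.trans (h.right_le i)⟩, fun i => (key i).2.2.2⟩

end HasMargin

variable {r : ℕ} {φ φ' : ℝ → ℝ} {R G C₀ : ℝ} {s t e a b : Fin d → ℝ} {N n : Fin d → ℕ}

lemma tensor_sum_smul (S : Fin d → Finset ℤ) (c : Fin d → ℤ → ℝ) (v : Fin d → ℤ → ℝ → ℝ) :
    tensor (fun i => ∑ k ∈ S i, c i k • v i k) =
      ∑ k ∈ Fintype.piFinset S, (∏ i, c i (k i)) • tensor fun i => v i (k i) := by
  rw [tensor_sum]
  exact Finset.sum_congr rfl fun k _ => tensor_smul _ _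

/-- The approximations of the indicator of a rectangle are combinations of rescaled test functions. -/
lemma WaveletBounds.waveletProj_mem (h : WaveletBounds d r φ φ' R G C₀)
    (hm : HasMargin T s t e a b) (hst : ∀ i, s i < t i)
    (hN : ∀ i, IsBaseLevel R T (s i) (t i) (e i) (N i)) (hn : ∀ i, N i ≤ n i)
    {V : Submodule ℝ ((Fin d → ℝ) → ℝ)}
    (hV : ∀ χ ∈ testBall d r, ∀ x lam, IsScale T x lam → rescale χ x lam ∈ V) :
    waveletProj φ n (rectIndicator s t) ∈ V := by
  rw [waveletProj_rectIndicator h.father_support]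
  have h1 : ∀ i, proj1 φ (n i) (ind (s i) (t i)) = ∑ k ∈ near R (n i) (s i) (t i),
      coef φ (n i) k (ind (s i) (t i)) • dilate φ (n i) k := by
    intro i
    ext y
    rw [Finset.sum_apply]
    exact proj1_ind_eq_sum (fun k hk => coef_ind_eq_zero h.father_support hk) y
  simp_rw [h1]
  rw [tensor_sum_smul]
  refine Submodule.sum_mem _ fun k hk => Submodule.smul_mem _ _ ?_
  rcases h.tensor_dilate (g := fun _ => φ) (fun _ => Or.inl rfl) n k with h2 | ⟨χ, hχ, c, -, h2⟩
  · rw [h2]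
    exact V.zero_mem
  · rw [h2]
    exact V.smul_mem _ (hV χ hχ _ _
      (hm.isScale hst h.one_le hN hn (Fintype.mem_piFinset.1 hk)).1)

variable {E : Type*} [NormedAddCommGroup E] [NormedSpace ℝ E] {α : Fin d → ℝ} {M : ℝ}

/-- The bound on a linear map at the rescaled test functions which are supported in `[a,b]` and whose
scale does not exceed the side lengths of `[s,t]`. -/
def LocalBound (r : ℕ) (T : ℝ) (α s t a b : Fin d → ℝ) (M : ℝ)
    (Ψ : ((Fin d → ℝ) → ℝ) →ₗ[ℝ] E) : Prop :=
  ∀ χ ∈ testBall d r, ∀ x lam, IsScale T x lam → (∀ i, a i ≤ x i ∧ x i + lam i ≤ b i) →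
    (∀ i, lam i ≤ t i - s i) → ‖Ψ (rescale χ x lam)‖ ≤ M * ∏ i, lam i ^ α i

lemma WaveletBounds.norm_tensor_le (h : WaveletBounds d r φ φ' R G C₀)
    (hm : HasMargin T s t e a b) (hst : ∀ i, s i < t i)
    (hN : ∀ i, IsBaseLevel R T (s i) (t i) (e i) (N i)) (hn : ∀ i, N i ≤ n i)
    {Ψ : ((Fin d → ℝ) → ℝ) →ₗ[ℝ] E} (hM : 0 ≤ M) (hΨ : LocalBound r T α s t a b M Ψ)
    {g : Fin d → ℝ → ℝ} (hg : ∀ i, g i = φ ∨ g i = φ') {S : Fin d → Finset ℤ}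
    (hS : ∀ i, S i ⊆ near R (n i) (s i) (t i)) :
    ‖Ψ (tensor fun i => ∑ k ∈ S i, coef (g i) (n i) k (ind (s i) (t i)) • dilate (g i) (n i) k)‖ ≤
      M * C₀ * ∏ i, ((S i).card : ℝ) *
        (4 * R * G * (2 ^ n i)⁻¹ * (4 * R / 2 ^ n i) ^ α i) := by
  have hR := h.R_pos
  have hG := h.G_nonneg
  have hC := h.C₀_nonneg
  rw [tensor_sum_smul, map_sum]
  have hterm : ∀ k ∈ Fintype.piFinset S,
      ‖Ψ ((∏ i, coef (g i) (n i) (k i) (ind (s i) (t i))) •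
        tensor fun i => dilate (g i) (n i) (k i))‖ ≤
      M * C₀ * ∏ i, (4 * R * G * (2 ^ n i)⁻¹ * (4 * R / 2 ^ n i) ^ α i) := by
    intro k hk
    have h1 := hm.isScale hst h.one_le hN hn fun i => hS i (Fintype.mem_piFinset.1 hk i)
    have h2 : ‖Ψ (tensor fun i => dilate (g i) (n i) (k i))‖ ≤
        C₀ * (∏ i, (4 * R * ((2 : ℝ) ^ ((n i : ℝ) / 2))⁻¹)) *
          (M * ∏ i, (4 * R / 2 ^ n i) ^ α i) := by
      have h0 : 0 ≤ C₀ * ∏ i, (4 * R * ((2 : ℝ) ^ ((n i : ℝ) / 2))⁻¹) :=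
        mul_nonneg hC (Finset.prod_nonneg fun i _ => by positivity)
      have h0' : 0 ≤ M * ∏ i, (4 * R / 2 ^ n i) ^ α i :=
        mul_nonneg hM (Finset.prod_nonneg fun i _ => by positivity)
      rcases h.tensor_dilate hg n k with h2 | ⟨χ, hχ, c, hc, h2⟩
      · rw [h2, map_zero, norm_zero]
        exact mul_nonneg h0 h0'
      · rw [h2, map_smul, norm_smul, Real.norm_eq_abs]
        exact mul_le_mul hc (hΨ χ hχ _ _ h1.1 h1.2.1 h1.2.2) (norm_nonneg _) h0
    rw [map_smul, norm_smul, Real.norm_eq_abs, Finset.abs_prod]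
    have h3 : ∏ i, |coef (g i) (n i) (k i) (ind (s i) (t i))| ≤
        ∏ i, (((2 : ℝ) ^ ((n i : ℝ) / 2))⁻¹ * G) :=
      Finset.prod_le_prod (fun _ _ => abs_nonneg _)
        fun i _ => h.abs_coef_le (hg i) (n i) (k i) (s i) (t i)
    refine (mul_le_mul h3 h2 (norm_nonneg _)
      (Finset.prod_nonneg fun i _ => by positivity)).trans (le_of_eq ?_)
    have h4 : ∏ i, (4 * R * G * (2 ^ n i)⁻¹ * (4 * R / 2 ^ n i) ^ α i) =
        (∏ i, (((2 : ℝ) ^ ((n i : ℝ) / 2))⁻¹ * G)) *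
          (∏ i, (4 * R * ((2 : ℝ) ^ ((n i : ℝ) / 2))⁻¹)) * ∏ i, (4 * R / 2 ^ n i) ^ α i := by
      rw [← Finset.prod_mul_distrib, ← Finset.prod_mul_distrib]
      refine Finset.prod_congr rfl fun i _ => ?_
      rw [← sq_two_rpow_half, mul_inv]
      ring
    rw [h4]
    ring
  refine (norm_sum_le_of_le _ hterm).trans (le_of_eq ?_)
  rw [Finset.sum_const, Fintype.card_piFinset, nsmul_eq_mul, Nat.cast_prod,
    Finset.prod_mul_distrib (f := fun i => ((S i).card : ℝ))]
  ring

/-- The tensor products of blocks in the expansion of the indicator of a rectangle. -/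
def blockTensor (φ φ' : ℝ → ℝ) (N : Fin d → ℕ) (s t : Fin d → ℝ) (q : Fin d → ℕ) :
    (Fin d → ℝ) → ℝ :=
  tensor fun i => block φ φ' (N i) (s i) (t i) (q i)

lemma WaveletBounds.waveletProj_eq_sum (h : WaveletBounds d r φ φ' R G C₀)
    (hn : ∀ i, N i ≤ n i) (s t : Fin d → ℝ) :
    waveletProj φ n (rectIndicator s t) =
      ∑ q ∈ Fintype.piFinset fun i => Finset.range (n i - N i + 1),
        blockTensor φ φ' N s t q := by
  rw [waveletProj_rectIndicator h.father_support]
  unfold blockTensor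
  rw [← tensor_sum (fun i => Finset.range (n i - N i + 1))
    fun i q => block φ φ' (N i) (s i) (t i) q]
  congr 1 with i : 1
  rw [← h.proj1_eq_sum_block, Nat.add_sub_cancel' (hn i)]

/-- The ratio of the geometric decay of the blocks. -/
def ratio (α : ℝ) : ℝ := (1 / 2 : ℝ) ^ (1 + α)

lemma ratio_nonneg (α : ℝ) : 0 ≤ ratio α := by unfold ratio; positivity

lemma ratio_lt_one {α : ℝ} (hα : -1 < α) : ratio α < 1 :=
  Real.rpow_lt_one (by norm_num) (by norm_num) (by linarith)

lemma WaveletBounds.norm_blockTensor_le (h : WaveletBounds d r φ φ' R G C₀)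
    (hα : ∀ i, -1 < α i ∧ α i < 0)
    (hm : HasMargin T s t e a b) (hst : ∀ i, s i < t i)
    (hN : ∀ i, IsBaseLevel R T (s i) (t i) (e i) (N i))
    {Ψ : ((Fin d → ℝ) → ℝ) →ₗ[ℝ] E} (hM : 0 ≤ M) (hΨ : LocalBound r T α s t a b M Ψ)
    (q : Fin d → ℕ) :
    ‖Ψ (blockTensor φ φ' N s t q)‖ ≤ M * C₀ *
      ∏ i, (24 * R * G * (t i - s i) * (4 * R / 2 ^ N i) ^ α i * ratio (α i) ^ q i) := by
  have hR := h.R_pos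
  have hG := h.G_nonneg
  unfold blockTensor
  simp_rw [h.block_eq_sum]
  refine (h.norm_tensor_le hm hst hN (n := fun i => blockLevel (N i) (q i))
    (fun i => Nat.le_add_right _ _) hM hΨ (fun i => blockGen_eq φ φ' (q i))
    fun i => blockIdx_subset R (N i) (s i) (t i) (q i)).trans ?_
  refine mul_le_mul_of_nonneg_left (Finset.prod_le_prod (fun i _ => by positivity) fun i _ => ?_)
    (mul_nonneg hM h.C₀_nonneg)
  exact card_blockIdx_mul_le h.one_le hG (hst i) (hN i) (hα i) (q i)

lemma sum_piFinset_prod_le {A θ : Fin d → ℝ} (hA : ∀ i, 0 ≤ A i) (hθ : ∀ i, 0 ≤ θ i)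
    (hθ1 : ∀ i, θ i < 1) (S : Finset (Fin d → ℕ)) :
    ∑ q ∈ S, ∏ i, A i * θ i ^ q i ≤ ∏ i, A i * (1 - θ i)⁻¹ := by
  classical
  have h1 : S ⊆ Fintype.piFinset fun i => S.image fun q => q i := by
    intro q hq
    rw [Fintype.mem_piFinset]
    exact fun i => Finset.mem_image_of_mem _ hq
  have h0 : ∀ i (j : ℕ), 0 ≤ A i * θ i ^ j := fun i j => mul_nonneg (hA i) (pow_nonneg (hθ i) _)
  refine (Finset.sum_le_sum_of_subset_of_nonneg h1
    fun q _ _ => Finset.prod_nonneg fun i _ => h0 i (q i)).trans ?_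
  rw [← Finset.prod_univ_sum (fun i => S.image fun q => q i) fun i (j : ℕ) => A i * θ i ^ j]
  refine Finset.prod_le_prod (fun i _ => Finset.sum_nonneg fun j _ => h0 i j) fun i _ => ?_
  rw [← Finset.mul_sum, ← tsum_geometric_of_lt_one (hθ i) (hθ1 i)]
  exact mul_le_mul_of_nonneg_left ((summable_geometric_of_lt_one (hθ i) (hθ1 i)).sum_le_tsum _
    fun j _ => pow_nonneg (hθ i) j) (hA i)

lemma summable_prod_geometric {A θ : Fin d → ℝ} (hA : ∀ i, 0 ≤ A i) (hθ : ∀ i, 0 ≤ θ i)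
    (hθ1 : ∀ i, θ i < 1) : Summable fun q : Fin d → ℕ => ∏ i, A i * θ i ^ q i :=
  summable_of_sum_le (fun _ => Finset.prod_nonneg fun i _ => mul_nonneg (hA i)
    (pow_nonneg (hθ i) _)) (sum_piFinset_prod_le hA hθ hθ1)

lemma tendsto_piFinset_range (N : Fin d → ℕ) : Tendsto (fun n : Fin d → ℕ =>
    Fintype.piFinset fun i => Finset.range (n i - N i + 1)) atTop atTop := by
  rw [tendsto_atTop]
  intro S
  obtain ⟨B, hB⟩ := S.bddAbove
  filter_upwards [eventually_ge_atTop (B + N)] with n hn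
  intro q hq
  rw [Fintype.mem_piFinset]
  intro i
  have h1 : q i ≤ B i := hB hq i
  have h2 : B i + N i ≤ n i := hn i
  rw [Finset.mem_range]
  omega

lemma exists_baseLevels (hR : 1 ≤ R) (hm : HasMargin T s t e a b) (hst : ∀ i, s i < t i) :
    ∃ N : Fin d → ℕ, ∀ i, IsBaseLevel R T (s i) (t i) (e i) (N i) := by
  choose N hN using fun i => exists_isBaseLevel hR (hst i) (hm.sub_le i) (hm.pos i)
  exact ⟨N, hN⟩

lemma WaveletBounds.exists_tendsto [CompleteSpace E] (h : WaveletBounds d r φ φ' R G C₀)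
    (hα : ∀ i, -1 < α i ∧ α i < 0)
    (hm : HasMargin T s t e a b) (hst : ∀ i, s i < t i)
    {Φ : ((Fin d → ℝ) → ℝ) →ₗ[ℝ] E} (hM : 0 ≤ M) (hΦ : LocalBound r T α s t a b M Φ) :
    ∃ J, Tendsto (fun n => Φ (waveletProj φ n (rectIndicator s t))) atTop (𝓝 J) := by
  have hR := h.R_pos
  have hG := h.G_nonneg
  obtain ⟨N, hN⟩ := exists_baseLevels h.one_le hm hst
  have hs : Summable fun q => Φ (blockTensor φ φ' N s t q) := by
    refine Summable.of_norm_bounded ?_ (h.norm_blockTensor_le hα hm hst hN hM hΦ)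
    refine (summable_prod_geometric (fun i => ?_) (fun i => ratio_nonneg (α i))
      fun i => ratio_lt_one (hα i).1).mul_left _
    have := sub_pos.2 (hst i)
    positivity
  refine ⟨_, (hs.hasSum.comp (tendsto_piFinset_range N)).congr' ?_⟩
  filter_upwards [eventually_ge_atTop N] with n hn
  rw [h.waveletProj_eq_sum hn, map_sum]
  rfl

/-- The factor by which the constant in the bound of the interior primitive grows per direction. -/
def dirConst (R T G α : ℝ) : ℝ := 48 * R * G * max 1 T * (1 - ratio α)⁻¹

lemma WaveletBounds.dirConst_nonneg (h : WaveletBounds d r φ φ' R G C₀) {α : ℝ} (hα : -1 < α) :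
    0 ≤ dirConst R T G α := by
  have h1 := h.R_pos
  have h2 := h.G_nonneg
  have h3 := sub_pos.2 (ratio_lt_one hα)
  have h4 : 0 ≤ max 1 T := zero_le_one.trans (le_max_left _ _)
  unfold dirConst
  positivity

lemma WaveletBounds.norm_lim_le (h : WaveletBounds d r φ φ' R G C₀)
    (hα : ∀ i, -1 < α i ∧ α i < 0)
    (hm : HasMargin T s t e a b) (hst : ∀ i, s i < t i)
    {Ψ : ((Fin d → ℝ) → ℝ) →ₗ[ℝ] E} (hM : 0 ≤ M) (hΨ : LocalBound r T α s t a b M Ψ)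
    {J : E} (hJ : Tendsto (fun n => Ψ (waveletProj φ n (rectIndicator s t))) atTop (𝓝 J)) :
    ‖J‖ ≤ M * C₀ *
      ∏ i, dirConst R T G (α i) * ((min (e i) 1) ^ α i * (t i - s i) ^ (α i + 1)) := by
  have hR := h.R_pos
  have hG := h.G_nonneg
  obtain ⟨N, hN⟩ := exists_baseLevels h.one_le hm hst
  refine le_of_tendsto hJ.norm ?_
  filter_upwards [eventually_ge_atTop N] with n hn
  have hts := fun i => sub_pos.2 (hst i)
  have h1 := fun i => ratio_nonneg (α i)
  have h2 := fun i => ratio_lt_one (hα i).1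
  have hA : ∀ i, 0 ≤ 24 * R * G * (t i - s i) * (4 * R / 2 ^ N i) ^ α i := by
    intro i
    have := hts i
    positivity
  rw [h.waveletProj_eq_sum hn, map_sum]
  refine (norm_sum_le_of_le _ fun q _ => h.norm_blockTensor_le hα hm hst hN hM hΨ q).trans ?_
  rw [← Finset.mul_sum]
  refine mul_le_mul_of_nonneg_left ((sum_piFinset_prod_le hA h1 h2 _).trans
    (Finset.prod_le_prod (fun i _ => ?_) fun i _ => ?_)) (mul_nonneg hM h.C₀_nonneg)
  · exact mul_nonneg (hA i) (inv_nonneg.2 (sub_nonneg.2 (h2 i).le))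
  · have h3 := (hN i).rpow_le (hst i) (hm.pos i) (hα i)
    have h4 : 0 ≤ (1 - ratio (α i))⁻¹ := inv_nonneg.2 (sub_nonneg.2 (h2 i).le)
    have h5 := hts i
    rw [Real.rpow_add h5, Real.rpow_one, dirConst]
    calc 24 * R * G * (t i - s i) * (4 * R / 2 ^ N i) ^ α i * (1 - ratio (α i))⁻¹
        ≤ 24 * R * G * (t i - s i) * (2 * max 1 T * ((min (e i) 1) ^ α i * (t i - s i) ^ α i)) *
            (1 - ratio (α i))⁻¹ := by gcongr
      _ = _ := by ring

end Interior

/-! ### The interior primitive of a linear map on test functions -/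

section RectPrim

variable {d r : ℕ} {T : ℝ} {φ φ' : ℝ → ℝ} {R G C₀ : ℝ}
  {E : Type*} [NormedAddCommGroup E] [NormedSpace ℝ E]

lemma integrable_scalingFn_mul (hφ : Continuous φ) (hR : ∀ x, φ x ≠ 0 → |x| ≤ R)
    (n : Fin d → ℕ) (k : Fin d → ℤ) (s t : Fin d → ℝ) :
    Integrable fun y => scalingFn φ n k y * rectIndicator s t y := by
  have h1 : (fun y => scalingFn φ n k y * rectIndicator s t y) =
      fun y => ∏ i, (dilate φ (n i) (k i) (y i) * ind (s i) (t i) (y i)) := by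
    ext y
    rw [rectIndicator_eq_tensor, scalingFn, tensor, Finset.prod_mul_distrib]
  rw [h1]
  refine Integrable.fintype_prod (f := fun i y => dilate φ (n i) (k i) y * ind (s i) (t i) y)
    fun i => ?_
  rw [mul_ind]
  exact (integrable_dilate hφ hR).indicator measurableSet_Ioc

lemma support_waveletProj_finite (hR : ∀ x, φ x ≠ 0 → |x| ≤ R)
    (n : Fin d → ℕ) (s t z : Fin d → ℝ) :
    (Function.support fun k : Fin d → ℤ =>
      (∫ y, scalingFn φ n k y * rectIndicator s t y) * scalingFn φ n k z).Finite := by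
  refine (Fintype.piFinset fun i => near R (n i) (s i) (t i)).finite_toSet.subset fun k hk => ?_
  rw [Finset.mem_coe, Fintype.mem_piFinset]
  intro i
  by_contra h
  refine hk ?_
  simp only
  rw [integral_scalingFn_mul_rectIndicator, Finset.prod_eq_zero (Finset.mem_univ i) (coef_ind_eq_zero hR h), zero_mul]

lemma waveletProj_sum (hφ : Continuous φ) (hR : ∀ x, φ x ≠ 0 → |x| ≤ R) (n : Fin d → ℕ)
    {ι : Type*} (S : Finset ι) (s t : ι → Fin d → ℝ) :
    waveletProj φ n (∑ c ∈ S, rectIndicator (s c) (t c)) =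
      ∑ c ∈ S, waveletProj φ n (rectIndicator (s c) (t c)) := by
  ext z
  rw [Finset.sum_apply]
  unfold waveletProj
  rw [← finsum_sum_comm _ _ fun c _ => support_waveletProj_finite hR n (s c) (t c) z]
  refine finsum_congr fun k => ?_
  simp_rw [Finset.sum_apply, Finset.mul_sum]
  rw [integral_finsetSum _ fun c _ => integrable_scalingFn_mul hφ hR n k (s c) (t c),
    Finset.sum_mul]

lemma rectIndicator_eq_zero {s t : Fin d → ℝ} {i : Fin d} (h : t i ≤ s i) :
    rectIndicator s t = 0 := by
  rw [rectIndicator_eq_tensor]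
  ext y
  exact Finset.prod_eq_zero (Finset.mem_univ i) (by simp [ind, Set.Ioc_eq_empty (not_lt.2 h)])

lemma waveletProj_eq_zero {s t : Fin d → ℝ} {i : Fin d} (h : t i ≤ s i) (n : Fin d → ℕ) :
    waveletProj φ n (rectIndicator s t) = 0 := by
  ext z
  simp [waveletProj, rectIndicator_eq_zero h]

/-- The bound of order `α` with additional order `δ` in the directions `η`, at the rescaled test functions
which are supported in `[a,b]`. -/
def TestBound (r : ℕ) (T : ℝ) (α δ a b : Fin d → ℝ) (η : Finset (Fin d)) (N : ℝ)
    (Ψ : ((Fin d → ℝ) → ℝ) →ₗ[ℝ] E) : Prop :=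
  ∀ χ ∈ testBall d r, ∀ x lam, IsScale T x lam → (∀ i, a i ≤ x i ∧ x i + lam i ≤ b i) →
    ‖Ψ (rescale χ x lam)‖ ≤ N * (multiPow Finset.univ lam α * multiPow η lam δ)

lemma multiPow_nonneg (θ : Finset (Fin d)) (x a : Fin d → ℝ) : 0 ≤ multiPow θ x a :=
  Finset.prod_nonneg fun _ _ => Real.rpow_nonneg (abs_nonneg _) _

lemma TestBound.localBound {α δ a b s t : Fin d → ℝ} {η : Finset (Fin d)} {N : ℝ}
    {Ψ : ((Fin d → ℝ) → ℝ) →ₗ[ℝ] E} (h : TestBound r T α δ a b η N Ψ) (hN : 0 ≤ N)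
    (hδ : ∀ i, 0 ≤ δ i) :
    LocalBound r T α s t a b (N * multiPow η (t - s) δ) Ψ := by
  intro χ hχ x lam hx hab hlam
  refine (h χ hχ x lam hx hab).trans ?_
  have h1 : multiPow Finset.univ lam α = ∏ i, lam i ^ α i :=
    Finset.prod_congr rfl fun i _ => by rw [abs_of_pos (hx i).1]
  have h2 : multiPow η lam δ ≤ multiPow η (t - s) δ :=
    Finset.prod_le_prod (fun i _ => Real.rpow_nonneg (abs_nonneg _) _) fun i hi => by
      refine Real.rpow_le_rpow (abs_nonneg _) ?_ (hδ i)
      rw [abs_of_pos (hx i).1]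
      exact (hlam i).trans (le_abs_self _)
  have h3 : 0 ≤ ∏ i, lam i ^ α i :=
    Finset.prod_nonneg fun i _ => Real.rpow_nonneg (hx i).1.le _
  rw [h1, mul_assoc, mul_comm (multiPow η (t - s) δ)]
  gcongr

lemma multiPow_sub_add_one {s t : Fin d → ℝ} (hst : s ≤ t) (α : Fin d → ℝ) :
    multiPow Finset.univ (t - s) (α + 1) = ∏ i, (t i - s i) ^ (α i + 1) :=
  Finset.prod_congr rfl fun i _ => by
    rw [Pi.sub_apply, abs_of_nonneg (sub_nonneg.2 (hst i))]; rfl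

/-- `lim_n Φ(P_n 1_{(s,t]})`. -/
def rectPrim (φ : ℝ → ℝ) (Φ : ((Fin d → ℝ) → ℝ) →ₗ[ℝ] E) (s t : Fin d → ℝ) : E :=
  limUnder atTop fun n => Φ (waveletProj φ n (rectIndicator s t))

lemma rectPrim_eq_zero (Φ : ((Fin d → ℝ) → ℝ) →ₗ[ℝ] E) {s t : Fin d → ℝ} {i : Fin d}
    (h : t i ≤ s i) : rectPrim φ Φ s t = 0 := by
  refine Tendsto.limUnder_eq ?_
  simp_rw [waveletProj_eq_zero h, map_zero]
  exact tendsto_const_nhds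

/-- A linear map on functions of `d` variables which is of order `α` at the test functions supported
in `[0,T]^d`. -/
structure IsOfOrder (r : ℕ) (T : ℝ) (φ φ' : ℝ → ℝ) (R G C₀ : ℝ) (α : Fin d → ℝ)
    (Φ : ((Fin d → ℝ) → ℝ) →ₗ[ℝ] E) : Prop where
  bounds : WaveletBounds d r φ φ' R G C₀
  exponent : ∀ i, -1 < α i ∧ α i < 0
  T_pos : 0 < T
  bound : ∃ N : ℝ, 0 ≤ N ∧ TestBound r T α 0 0 (fun _ => T) ∅ N Φ

/-- Rectangles in the interior of `[0,T]^d`. -/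
def IsInterior (T : ℝ) (s t : Fin d → ℝ) : Prop := ∀ i, 0 < s i ∧ s i ≤ t i ∧ t i < T

lemma IsInterior.left_mem {s t : Fin d → ℝ} (h : IsInterior T s t) : s ∈ box d T :=
  ⟨fun i => (h i).1.le, fun i => ((h i).2.1.trans_lt (h i).2.2).le⟩

lemma IsInterior.right_mem {s t : Fin d → ℝ} (h : IsInterior T s t) : t ∈ box d T :=
  ⟨fun i => ((h i).1.trans_le (h i).2.1).le, fun i => (h i).2.2.le⟩

/-- The constant in the bound of the interior primitive. -/
def interiorConst (R T G C₀ : ℝ) (α : Fin d → ℝ) : ℝ := C₀ * ∏ i, dirConst R T G (α i)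

/-- A margin which depends only on the distance `ρ` of the rectangle from the boundary. -/
lemma hasMargin_of_dist {s t : Fin d → ℝ} {ρ : ℝ} (hρ : 0 < ρ) (hs : ∀ i, ρ ≤ s i)
    (ht : ∀ i, t i ≤ T - ρ) (hst : s ≤ t) (hT : 0 < T) :
    HasMargin T s t (fun _ => ρ / T) 0 (fun _ => T) := by
  have h0 : ∀ i, |t i - s i| * (ρ / T) ≤ ρ := by
    intro i
    have h1 : t i - s i ≤ T := by linarith [hs i, ht i]
    rw [abs_of_nonneg (sub_nonneg.2 (hst i)), ← mul_div_assoc, div_le_iff₀ hT, mul_comm]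
    exact mul_le_mul_of_nonneg_left h1 hρ.le
  have h1 : ∀ i, 0 ≤ s i - |t i - s i| * (ρ / T) := fun i => by linarith [h0 i, hs i]
  have h2 : ∀ i, t i + |t i - s i| * (ρ / T) ≤ T := fun i => by linarith [h0 i, ht i]
  exact ⟨fun i => by positivity, h1, h2, h1, h2⟩

lemma IsInterior.exists_dist {s t : Fin d → ℝ} (hst : IsInterior T s t) :
    ∃ ρ > 0, (∀ i, ρ ≤ s i) ∧ ∀ i, t i ≤ T - ρ := by
  have : ∀ i, ∃ ρ > 0, ρ ≤ s i ∧ t i ≤ T - ρ := fun i =>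
    ⟨min (s i) (T - t i), lt_min (hst i).1 (sub_pos.2 (hst i).2.2), min_le_left _ _, by
      linarith [min_le_right (s i) (T - t i)]⟩
  choose ρ h0 h1 h2 using this
  rcases isEmpty_or_nonempty (Fin d) with hd | hd
  · exact ⟨1, one_pos, fun i => hd.elim i, fun i => hd.elim i⟩
  · obtain ⟨j, hj⟩ := Finite.exists_min ρ
    exact ⟨ρ j, h0 j, fun i => (hj i).trans (h1 i), fun i => by linarith [hj i, h2 i]⟩

namespace IsOfOrder

variable {α : Fin d → ℝ} {Φ : ((Fin d → ℝ) → ℝ) →ₗ[ℝ] E} {s t : Fin d → ℝ}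

lemma const_nonneg (h : IsOfOrder r T φ φ' R G C₀ α Φ) : 0 ≤ interiorConst R T G C₀ α :=
  mul_nonneg h.bounds.C₀_nonneg
    (Finset.prod_nonneg fun i _ => h.bounds.dirConst_nonneg (h.exponent i).1)

variable [CompleteSpace E]

lemma tendsto (h : IsOfOrder r T φ φ' R G C₀ α Φ) (hst : IsInterior T s t) :
    Tendsto (fun n => Φ (waveletProj φ n (rectIndicator s t))) atTop (𝓝 (rectPrim φ Φ s t)) := by
  by_cases hlt : ∀ i, s i < t i
  · obtain ⟨ρ, hρ, h1, h2⟩ := hst.exists_dist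
    obtain ⟨N, hN, hb⟩ := h.bound
    have hm := hasMargin_of_dist hρ h1 h2 (fun i => (hst i).2.1) h.T_pos
    exact tendsto_nhds_limUnder (h.bounds.exists_tendsto h.exponent hm hlt
      (mul_nonneg hN (multiPow_nonneg _ _ _)) (hb.localBound hN fun _ => le_rfl))
  · push Not at hlt
    obtain ⟨i, hi⟩ := hlt
    rw [rectPrim_eq_zero Φ hi]
    simp_rw [waveletProj_eq_zero hi, map_zero]
    exact tendsto_const_nhds

/-- The bound of the interior primitive of a rectangle with margins. -/
lemma norm_le (h : IsOfOrder r T φ φ' R G C₀ α Φ) (hst : IsInterior T s t)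
    {e a b δ : Fin d → ℝ} (hm : HasMargin T s t e a b) (hδ : ∀ i, 0 ≤ δ i) {η : Finset (Fin d)}
    {N : ℝ} (hN : 0 ≤ N) (L : E →L[ℝ] E) (hL : TestBound r T α δ a b η N (L.toLinearMap ∘ₗ Φ)) :
    ‖L (rectPrim φ Φ s t)‖ ≤ interiorConst R T G C₀ α * multiPow Finset.univ (fun i => min (e i) 1) α *
      multiPow Finset.univ (t - s) (α + 1) * multiPow η (t - s) δ * N := by
  by_cases hlt : ∀ i, s i < t i
  · have h1 := h.bounds.norm_lim_le h.exponent hm hlt (mul_nonneg hN (multiPow_nonneg _ _ _))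
      (hL.localBound hN hδ) ((L.continuous.tendsto _).comp (h.tendsto hst))
    refine h1.trans (le_of_eq ?_)
    have e1 : multiPow Finset.univ (fun i => min (e i) 1) α = ∏ i, (min (e i) 1) ^ α i :=
      Finset.prod_congr rfl fun i _ => by rw [abs_of_pos (lt_min (hm.pos i) one_pos)]
    rw [e1, multiPow_sub_add_one fun i => (hlt i).le, interiorConst, Finset.prod_mul_distrib, Finset.prod_mul_distrib]
    ring
  · push Not at hlt
    obtain ⟨i, hi⟩ := hlt
    rw [rectPrim_eq_zero Φ hi, map_zero, norm_zero]
    have := h.const_nonneg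
    exact mul_nonneg (mul_nonneg (mul_nonneg (mul_nonneg this (multiPow_nonneg _ _ _))
      (multiPow_nonneg _ _ _)) (multiPow_nonneg _ _ _)) hN

/-- Every decomposition of the indicator of a rectangle yields a decomposition of the primitive. -/
lemma eq_sum (h : IsOfOrder r T φ φ' R G C₀ α Φ) {ι : Type*} {S : Finset ι} {lo hi : ι → Fin d → ℝ}
    (hst : IsInterior T s t) (hS : ∀ c ∈ S, IsInterior T (lo c) (hi c))
    (hsum : rectIndicator s t = ∑ c ∈ S, rectIndicator (lo c) (hi c)) :
    rectPrim φ Φ s t = ∑ c ∈ S, rectPrim φ Φ (lo c) (hi c) := by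
  refine tendsto_nhds_unique (h.tendsto hst) ?_
  simp_rw [hsum, waveletProj_sum h.bounds.isWaveletPair.contDiff.continuous
    h.bounds.father_support, map_sum]
  exact tendsto_finsetSum _ fun c hc => h.tendsto (hS c hc)

end IsOfOrder

end RectPrim

/-! ### Additive functions of rectangles -/

section Additive

variable {d : ℕ} {T : ℝ} {E : Type*} [NormedAddCommGroup E]

lemma coordProj_apply_self {i : Fin d} (u x : Fin d → ℝ) : coordProj {i} u x i = u i := by
  simp [coordProj]

lemma coordProj_apply_ne {i j : Fin d} (h : j ≠ i) (u x : Fin d → ℝ) :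
    coordProj {i} u x j = x j := by
  simp [coordProj, h]

lemma coordProj_empty (x y : Fin d → ℝ) : coordProj ∅ x y = y := by
  ext j; simp [coordProj]

lemma coordProj_univ (x y : Fin d → ℝ) : coordProj Finset.univ x y = x := by
  ext j; simp [coordProj]

lemma le_coordProj {θ : Finset (Fin d)} {w x y : Fin d → ℝ} (hx : w ≤ x) (hy : w ≤ y) :
    w ≤ coordProj θ x y := fun j => by
  simp only [coordProj]; split_ifs
  exacts [hx j, hy j]

lemma coordProj_le {θ : Finset (Fin d)} {w x y : Fin d → ℝ} (hx : x ≤ w) (hy : y ≤ w) :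
    coordProj θ x y ≤ w := fun j => by
  simp only [coordProj]; split_ifs
  exacts [hx j, hy j]

lemma coordProj_mem {A : Set ℝ} {θ : Finset (Fin d)} {x y : Fin d → ℝ} (hx : ∀ j, x j ∈ A)
    (hy : ∀ j, y j ∈ A) (j : Fin d) : coordProj θ x y j ∈ A := by
  simp only [coordProj]; split_ifs
  exacts [hx j, hy j]

lemma coordProj_mem_box {θ : Finset (Fin d)} {x y : Fin d → ℝ} (hx : x ∈ box d T)
    (hy : y ∈ box d T) : coordProj θ x y ∈ box d T :=
  ⟨le_coordProj hx.1 hy.1, coordProj_le hx.2 hy.2⟩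

lemma rpow_le_max_one {x β : ℝ} (h0 : 0 ≤ x) (hx : x ≤ T) (hβ : 0 ≤ β) (hβ1 : β ≤ 1) :
    x ^ β ≤ max 1 T :=
  calc x ^ β ≤ (max 1 T) ^ β := Real.rpow_le_rpow h0 (hx.trans (le_max_right _ _)) hβ
    _ ≤ (max 1 T) ^ (1 : ℝ) := Real.rpow_le_rpow_of_exponent_le (le_max_left _ _) hβ1
    _ = max 1 T := Real.rpow_one _

lemma ind_add {s u t : ℝ} (hsu : s ≤ u) (hut : u ≤ t) : ind s t = ind s u + ind u t := by
  ext y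
  simp only [ind, Set.indicator_apply, Set.mem_Ioc, Pi.add_apply]
  by_cases h1 : s < y <;> by_cases h2 : y ≤ u <;> by_cases h3 : y ≤ t <;>
    simp [h1, h2, h3] <;> linarith

lemma rectIndicator_add {s u t : Fin d → ℝ} {i : Fin d} (hsu : s i ≤ u i) (hut : u i ≤ t i) :
    rectIndicator s t =
      rectIndicator s (coordProj {i} u t) + rectIndicator (coordProj {i} u s) t := by
  ext y
  simp only [rectIndicator_eq_tensor, tensor, Pi.add_apply]
  have h1 : ∏ j ∈ Finset.univ.erase i, ind (s j) (coordProj {i} u t j) (y j) =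
      ∏ j ∈ Finset.univ.erase i, ind (s j) (t j) (y j) :=
    Finset.prod_congr rfl fun j hj => by rw [coordProj_apply_ne (Finset.ne_of_mem_erase hj)]
  have h2 : ∏ j ∈ Finset.univ.erase i, ind (coordProj {i} u s j) (t j) (y j) =
      ∏ j ∈ Finset.univ.erase i, ind (s j) (t j) (y j) :=
    Finset.prod_congr rfl fun j hj => by rw [coordProj_apply_ne (Finset.ne_of_mem_erase hj)]
  rw [← Finset.mul_prod_erase _ _ (Finset.mem_univ i), ← Finset.mul_prod_erase _ (fun j =>
    ind (s j) (coordProj {i} u t j) (y j)) (Finset.mem_univ i), ← Finset.mul_prod_erase _ (fun j =>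
    ind (coordProj {i} u s j) (t j) (y j)) (Finset.mem_univ i), h1, h2, coordProj_apply_self,
    coordProj_apply_self, ind_add hsu hut, Pi.add_apply, add_mul]

/-- A thin slab: the bound of a rectangle is proportional to its bound in any one direction. -/
lemma prod_rpow_le {x y β : Fin d → ℝ} (hxy : ∀ j, x j ≤ y j) (hT : ∀ j, y j - x j ≤ T)
    (hβ : ∀ j, 0 < β j ∧ β j ≤ 1) (i : Fin d) :
    ∏ j, (y j - x j) ^ β j ≤ (max 1 T) ^ d * (y i - x i) ^ β i := by
  have hM : 1 ≤ max 1 T := le_max_left _ _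
  have h0 : ∀ j, 0 ≤ y j - x j := fun j => sub_nonneg.2 (hxy j)
  rw [← Finset.mul_prod_erase _ _ (Finset.mem_univ i), mul_comm]
  refine mul_le_mul_of_nonneg_right ?_ (Real.rpow_nonneg (h0 i) _)
  calc ∏ j ∈ Finset.univ.erase i, (y j - x j) ^ β j
      ≤ ∏ _j ∈ Finset.univ.erase i, max 1 T := by
        exact Finset.prod_le_prod (fun j _ => Real.rpow_nonneg (h0 j) _) fun j _ =>
          rpow_le_max_one (h0 j) (hT j) (hβ j).1.le (hβ j).2
    _ = (max 1 T) ^ (Finset.univ.erase i).card := by rw [Finset.prod_const]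
    _ ≤ (max 1 T) ^ d := pow_le_pow_right₀ hM (by
        simp)

lemma coordProj_insert [DecidableEq (Fin d)] (i : Fin d) (D : Finset (Fin d)) (x y : Fin d → ℝ) :
    coordProj (insert i D) x y = coordProj {i} x (coordProj D x y) := by
  ext j
  by_cases hj : j = i <;> simp [coordProj, hj]

/-- A bounded additive function of rectangles is continuous: the difference between a rectangle and a
smaller one consists of two thin slabs per direction. -/
lemma norm_sub_le_of_additive {J : (Fin d → ℝ) → (Fin d → ℝ) → E} {A : Set ℝ} {B : ℝ}
    {β : Fin d → ℝ} (hβ : ∀ j, 0 < β j ∧ β j ≤ 1) (hB : 0 ≤ B)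
    (hAT : ∀ x ∈ A, ∀ y ∈ A, y - x ≤ T)
    (hadd : ∀ s u t : Fin d → ℝ, (∀ i, s i ∈ A ∧ u i ∈ A ∧ t i ∈ A) → s ≤ u → u ≤ t → ∀ i,
      J s t = J s (coordProj {i} u t) + J (coordProj {i} u s) t)
    (hbd : ∀ s t : Fin d → ℝ, (∀ i, s i ∈ A ∧ t i ∈ A) → s ≤ t →
      ‖J s t‖ ≤ B * ∏ i, (t i - s i) ^ β i)
    {s s' t' t : Fin d → ℝ} (hA : ∀ i, s i ∈ A ∧ s' i ∈ A ∧ t' i ∈ A ∧ t i ∈ A)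
    (h1 : s ≤ s') (h2 : s' ≤ t') (h3 : t' ≤ t) :
    ‖J s t - J s' t'‖ ≤
      B * (max 1 T) ^ d * ∑ i, ((s' i - s i) ^ β i + (t i - t' i) ^ β i) := by
  have slab : ∀ x y : Fin d → ℝ, (∀ i, x i ∈ A ∧ y i ∈ A) → x ≤ y → ∀ i,
      ‖J x y‖ ≤ B * (max 1 T) ^ d * (y i - x i) ^ β i := by
    intro x y hxyA hxy i
    refine (hbd x y hxyA hxy).trans ?_
    rw [mul_assoc]
    exact mul_le_mul_of_nonneg_left (prod_rpow_le hxy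
      (fun j => hAT _ (hxyA j).1 _ (hxyA j).2) hβ i) hB
  have key : ∀ D : Finset (Fin d), ‖J s t - J (coordProj D s' s) (coordProj D t' t)‖ ≤
      ∑ i ∈ D, B * (max 1 T) ^ d * ((s' i - s i) ^ β i + (t i - t' i) ^ β i) := by
    intro D
    induction D using Finset.induction_on with
    | empty =>
      simp [coordProj_empty]
    | insert i D hi ih =>
      set x := coordProj D s' s with hx
      set y := coordProj D t' t with hy
      have hxi : x i = s i := by simp [hx, coordProj, hi]
      have hyi : y i = t i := by simp [hy, coordProj, hi]
      have hs'A := fun j => (hA j).2.1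
      have ht'A := fun j => (hA j).2.2.1
      have hxA : ∀ j, x j ∈ A := coordProj_mem hs'A fun j => (hA j).1
      have hyA : ∀ j, y j ∈ A := coordProj_mem ht'A fun j => (hA j).2.2.2
      have hxs : x ≤ s' := coordProj_le le_rfl h1
      have hyt : t' ≤ y := le_coordProj le_rfl h3
      have hxy : x ≤ y := hxs.trans (h2.trans hyt)
      rw [coordProj_insert, coordProj_insert, ← hx, ← hy]
      have hx' : coordProj {i} s' x ≤ s' := coordProj_le le_rfl hxs
      -- cut off the two slabs in direction `i`
      have e1 := hadd x s' y (fun j => ⟨hxA j, hs'A j, hyA j⟩) hxs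
        (h2.trans hyt) i
      have e2 := hadd (coordProj {i} s' x) t' y
        (fun j => ⟨coordProj_mem hs'A hxA j, ht'A j, hyA j⟩) (hx'.trans h2) hyt i
      have b1 := slab x (coordProj {i} s' y) (fun j => ⟨hxA j, coordProj_mem hs'A hyA j⟩)
        (le_coordProj hxs hxy) i
      have b2 := slab (coordProj {i} t' (coordProj {i} s' x)) y
        (fun j => ⟨coordProj_mem ht'A (coordProj_mem hs'A hxA) j, hyA j⟩)
        (coordProj_le hyt (hx'.trans (h2.trans hyt))) i
      rw [coordProj_apply_self, hxi] at b1
      rw [coordProj_apply_self, hyi] at b2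
      rw [Finset.sum_insert hi]
      have e3 : J s t - J (coordProj {i} s' x) (coordProj {i} t' y) =
          J x (coordProj {i} s' y) + J (coordProj {i} t' (coordProj {i} s' x)) y +
            (J s t - J x y) := by
        rw [e1, e2]
        abel
      rw [e3]
      refine (norm_add_le _ _).trans (add_le_add ((norm_add_le _ _).trans ?_) ih)
      rw [mul_add]
      exact add_le_add b1 b2
  have := key Finset.univ
  rwa [coordProj_univ, coordProj_univ, ← Finset.mul_sum] at this

end Additive

/-! ### The dyadic expansion of a rectangle -/

section Dyadic

/-- The points of `[s,t]` which halve the distance to `s` at each step, starting at the midpoint. -/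
def lowPt (s t : ℝ) (k : ℕ) : ℝ := s + (1 / 2) ^ k * ((t - s) / 2)

/-- The points of `[s,t]` which halve the distance to `t` at each step, starting at the midpoint. -/
def highPt (s t : ℝ) (k : ℕ) : ℝ := t - (1 / 2) ^ k * ((t - s) / 2)

variable {d r : ℕ} {T : ℝ} {s t : Fin d → ℝ}

lemma cellLo_apply (θ : Finset (Fin d)) (s t : Fin d → ℝ) (k : Fin d → ℕ) (i : Fin d) :
    cellLo θ (coordProj θ s (mid s t)) (coordProj θ (mid s t) t) k i =
      if i ∈ θ then lowPt (s i) (t i) (k i + 1) else highPt (s i) (t i) (k i) := by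
  by_cases h : i ∈ θ <;> simp [cellLo, coordProj, mid, lowPt, highPt, h] <;> ring

lemma cellHi_apply (θ : Finset (Fin d)) (s t : Fin d → ℝ) (k : Fin d → ℕ) (i : Fin d) :
    cellHi θ (coordProj θ s (mid s t)) (coordProj θ (mid s t) t) k i =
      if i ∈ θ then lowPt (s i) (t i) (k i) else highPt (s i) (t i) (k i + 1) := by
  by_cases h : i ∈ θ <;> simp [cellHi, coordProj, mid, lowPt, highPt, h] <;> ring

/-- The lower corner of a cell in the dyadic expansion of `[s,t]`. -/
def dyLo (θ : Finset (Fin d)) (s t : Fin d → ℝ) (k : Fin d → ℕ) : Fin d → ℝ :=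
  cellLo θ (coordProj θ s (mid s t)) (coordProj θ (mid s t) t) k

/-- The upper corner of a cell in the dyadic expansion of `[s,t]`. -/
def dyHi (θ : Finset (Fin d)) (s t : Fin d → ℝ) (k : Fin d → ℕ) : Fin d → ℝ :=
  cellHi θ (coordProj θ s (mid s t)) (coordProj θ (mid s t) t) k

/-- The side lengths of the cells. -/
lemma dyHi_sub_dyLo (θ : Finset (Fin d)) (s t : Fin d → ℝ) (k : Fin d → ℕ) (i : Fin d) :
    dyHi θ s t k i - dyLo θ s t k i = (1 / 4) * (1 / 2) ^ k i * (t i - s i) := by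
  rw [dyHi, dyLo, cellHi_apply, cellLo_apply]
  split_ifs <;> simp only [lowPt, highPt, pow_succ] <;> ring

/-- The cells keep a distance from the boundary of `[s,t]` which is at least their own length. -/
lemma dy_margin (θ : Finset (Fin d)) {s t : Fin d → ℝ} (k : Fin d → ℕ) {i : Fin d}
    (hst : s i ≤ t i) :
    s i ≤ dyLo θ s t k i - (dyHi θ s t k i - dyLo θ s t k i) ∧
      dyHi θ s t k i + (dyHi θ s t k i - dyLo θ s t k i) ≤ t i := by
  rw [dyHi_sub_dyLo, dyHi, dyLo, cellHi_apply, cellLo_apply]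
  have h1 : (1 / 2 : ℝ) ^ k i ≤ 1 := pow_le_one₀ (by norm_num) (by norm_num)
  have h2 : 0 ≤ (1 / 2 : ℝ) ^ k i := by positivity
  have h3 := sub_nonneg.2 hst
  have h4 := mul_le_mul_of_nonneg_right h1 h3
  have h5 := mul_nonneg h2 h3
  split_ifs <;> simp only [lowPt, highPt, pow_succ] <;> constructor <;> linarith

lemma lowPt_succ_le {s t : ℝ} (hst : s ≤ t) (k : ℕ) : lowPt s t (k + 1) ≤ lowPt s t k := by
  have h2 : 0 ≤ (1 / 2 : ℝ) ^ k * (t - s) := mul_nonneg (by positivity) (sub_nonneg.2 hst)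
  simp only [lowPt, pow_succ]
  linarith

lemma le_highPt_succ {s t : ℝ} (hst : s ≤ t) (k : ℕ) : highPt s t k ≤ highPt s t (k + 1) := by
  have h2 : 0 ≤ (1 / 2 : ℝ) ^ k * (t - s) := mul_nonneg (by positivity) (sub_nonneg.2 hst)
  simp only [highPt, pow_succ]
  linarith

lemma lowPt_le_mid {s t : ℝ} (hst : s ≤ t) (k : ℕ) : lowPt s t k ≤ (s + t) / 2 := by
  have h1 : (1 / 2 : ℝ) ^ k ≤ 1 := pow_le_one₀ (by norm_num) (by norm_num)
  have h4 := mul_le_mul_of_nonneg_right h1 (sub_nonneg.2 hst)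
  simp only [lowPt]
  linarith

lemma mid_le_highPt {s t : ℝ} (hst : s ≤ t) (k : ℕ) : (s + t) / 2 ≤ highPt s t k := by
  have h1 : (1 / 2 : ℝ) ^ k ≤ 1 := pow_le_one₀ (by norm_num) (by norm_num)
  have h4 := mul_le_mul_of_nonneg_right h1 (sub_nonneg.2 hst)
  simp only [highPt]
  linarith

lemma lt_lowPt {s t : ℝ} (hst : s < t) (k : ℕ) : s < lowPt s t k := by
  have h2 : 0 < (1 / 2 : ℝ) ^ k * ((t - s) / 2) :=
    mul_pos (by positivity) (half_pos (sub_pos.2 hst))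
  simp only [lowPt]
  linarith

lemma highPt_lt {s t : ℝ} (hst : s < t) (k : ℕ) : highPt s t k < t := by
  have h2 : 0 < (1 / 2 : ℝ) ^ k * ((t - s) / 2) :=
    mul_pos (by positivity) (half_pos (sub_pos.2 hst))
  simp only [highPt]
  linarith

lemma ind_dyadic {s t : ℝ} (hst : s ≤ t) (K : ℕ) :
    ind (lowPt s t K) (highPt s t K) =
      ∑ k ∈ Finset.range K, ind (lowPt s t (k + 1)) (lowPt s t k) +
        ∑ k ∈ Finset.range K, ind (highPt s t k) (highPt s t (k + 1)) := by
  have h1 : ∀ K, ind (lowPt s t K) ((s + t) / 2) =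
      ∑ k ∈ Finset.range K, ind (lowPt s t (k + 1)) (lowPt s t k) := by
    intro K
    induction K with
    | zero =>
      have : lowPt s t 0 = (s + t) / 2 := by simp only [lowPt, pow_zero]; ring
      ext y
      simp [ind, this]
    | succ K ih =>
      rw [Finset.sum_range_succ, ← ih, add_comm (ind _ _)]
      exact ind_add (lowPt_succ_le hst K) (lowPt_le_mid hst K)
  have h2 : ∀ K, ind ((s + t) / 2) (highPt s t K) =
      ∑ k ∈ Finset.range K, ind (highPt s t k) (highPt s t (k + 1)) := by
    intro K
    induction K with
    | zero =>
      have : highPt s t 0 = (s + t) / 2 := by simp only [highPt, pow_zero]; ring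
      ext y
      simp [ind, this]
    | succ K ih =>
      rw [Finset.sum_range_succ, ← ih]
      exact ind_add (mid_le_highPt hst K) (le_highPt_succ hst K)
  rw [← h1, ← h2]
  exact ind_add (lowPt_le_mid hst K) (mid_le_highPt hst K)

/-- The union of the first `K^d` cells of each of the `2^d` blocks is a rectangle. -/
lemma rectIndicator_dyadic {s t : Fin d → ℝ} (hst : s ≤ t) (K : ℕ) :
    rectIndicator (fun i => lowPt (s i) (t i) K) (fun i => highPt (s i) (t i) K) =
      ∑ c ∈ (Finset.univ : Finset (Finset (Fin d))) ×ˢ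
        Fintype.piFinset (fun _ : Fin d => Finset.range K),
        rectIndicator (dyLo c.1 s t c.2) (dyHi c.1 s t c.2) := by
  ext y
  rw [Finset.sum_product, rectIndicator_eq_tensor, tensor]
  simp_rw [ind_dyadic (hst _), Pi.add_apply]
  rw [Finset.prod_add, Finset.powerset_univ, Finset.sum_apply]
  refine Finset.sum_congr rfl fun θ _ => ?_
  have h1 : ∀ k : Fin d → ℕ, rectIndicator (dyLo θ s t k) (dyHi θ s t k) y = ∏ i,
      if i ∈ θ then ind (lowPt (s i) (t i) (k i + 1)) (lowPt (s i) (t i) (k i)) (y i)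
      else ind (highPt (s i) (t i) (k i)) (highPt (s i) (t i) (k i + 1)) (y i) := by
    intro k
    rw [rectIndicator_eq_tensor, tensor]
    refine Finset.prod_congr rfl fun i _ => ?_
    rw [dyLo, dyHi, cellLo_apply, cellHi_apply]
    split_ifs <;> rfl
  rw [Finset.sum_apply]
  simp_rw [h1]
  rw [← Finset.prod_univ_sum (fun _ : Fin d => Finset.range K) fun i k =>
    if i ∈ θ then ind (lowPt (s i) (t i) (k + 1)) (lowPt (s i) (t i) k) (y i)
    else ind (highPt (s i) (t i) k) (highPt (s i) (t i) (k + 1)) (y i)]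
  simp_rw [Finset.sum_ite_irrel, Finset.sum_apply]
  rw [Finset.prod_ite, Finset.filter_mem_eq_inter, Finset.filter_notMem_eq_sdiff,
    Finset.univ_inter]

end Dyadic

/-! ### The integral as an element of a Banach space -/

section BoxPrim

variable {d r : ℕ} {T : ℝ} {φ φ' : ℝ → ℝ} {R G C₀ : ℝ}
  {E : Type*} [NormedAddCommGroup E] [NormedSpace ℝ E] {s t : Fin d → ℝ}

lemma dyHi_sub_nonneg (θ : Finset (Fin d)) (hst : s ≤ t) (k : Fin d → ℕ) (i : Fin d) :
    0 ≤ dyHi θ s t k i - dyLo θ s t k i := by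
  rw [dyHi_sub_dyLo]
  have := sub_nonneg.2 (hst i)
  positivity

lemma dy_isInterior (θ : Finset (Fin d)) (hs : s ∈ box d T) (ht : t ∈ box d T)
    (hst : ∀ i, s i < t i) (k : Fin d → ℕ) : IsInterior T (dyLo θ s t k) (dyHi θ s t k) := by
  intro i
  have h1 : 0 < dyHi θ s t k i - dyLo θ s t k i := by
    rw [dyHi_sub_dyLo]
    have := sub_pos.2 (hst i)
    positivity
  have h2 := dy_margin θ k (hst i).le
  have h3 := hs.1 i
  have h4 := ht.2 i
  refine ⟨?_, ?_, ?_⟩ <;> linarith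

lemma dy_hasMargin (θ : Finset (Fin d)) (hs : s ∈ box d T) (ht : t ∈ box d T)
    (hst : s ≤ t) {a b : Fin d → ℝ} (ha : a ≤ s) (hb : t ≤ b) (k : Fin d → ℕ) :
    HasMargin T (dyLo θ s t k) (dyHi θ s t k) (fun _ => 1) a b := by
  have h0 := dyHi_sub_nonneg θ hst k
  have h1 := fun i => dy_margin θ k (hst i)
  refine ⟨fun _ => one_pos, fun i => ?_, fun i => ?_, fun i => ?_, fun i => ?_⟩ <;>
    rw [abs_of_nonneg (h0 i), mul_one]
  · exact (hs.1 i).trans (h1 i).1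
  · exact (h1 i).2.trans (ht.2 i)
  · exact (ha i).trans (h1 i).1
  · exact (h1 i).2.trans (hb i)

/-- `∫_s^t`, for a linear map on test functions: the sum of the interior primitives over all dyadic
cells. -/
def boxPrim (φ : ℝ → ℝ) (Φ : ((Fin d → ℝ) → ℝ) →ₗ[ℝ] E) (s t : Fin d → ℝ) : E :=
  ∑ θ : Finset (Fin d), ∑' k : Fin d → ℕ, rectPrim φ Φ (dyLo θ s t k) (dyHi θ s t k)

/-- The constant in the bound of the integral. -/
def integralConst (R T G C₀ : ℝ) (α : Fin d → ℝ) : ℝ :=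
  2 ^ d * interiorConst R T G C₀ α * ∏ i, (1 - ratio (α i))⁻¹

lemma rectPrim_dy_eq_zero (Φ : ((Fin d → ℝ) → ℝ) →ₗ[ℝ] E) {i : Fin d} (h : t i = s i)
    (θ : Finset (Fin d)) (k : Fin d → ℕ) : rectPrim φ Φ (dyLo θ s t k) (dyHi θ s t k) = 0 := by
  refine rectPrim_eq_zero Φ (i := i) ?_
  have := dyHi_sub_dyLo θ s t k i
  rw [h, sub_self, mul_zero] at this
  exact (sub_eq_zero.1 this).le

lemma boxPrim_eq_zero (Φ : ((Fin d → ℝ) → ℝ) →ₗ[ℝ] E) {i : Fin d} (h : t i = s i) :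
    boxPrim φ Φ s t = 0 := by
  simp only [boxPrim, rectPrim_dy_eq_zero Φ h, tsum_zero, Finset.sum_const_zero]

namespace IsOfOrder

variable {α : Fin d → ℝ} {Φ : ((Fin d → ℝ) → ℝ) →ₗ[ℝ] E}

lemma integralConst_nonneg (h : IsOfOrder r T φ φ' R G C₀ α Φ) :
    0 ≤ integralConst R T G C₀ α :=
  mul_nonneg (mul_nonneg (by positivity) h.const_nonneg) (Finset.prod_nonneg fun i _ =>
    inv_nonneg.2 (sub_nonneg.2 (ratio_lt_one (h.exponent i).1).le))

variable [CompleteSpace E]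

lemma norm_cell_le (h : IsOfOrder r T φ φ' R G C₀ α Φ) (hs : s ∈ box d T) (ht : t ∈ box d T)
    (hst : s ≤ t) {a b δ : Fin d → ℝ} (ha : a ≤ s) (hb : t ≤ b) (hδ : ∀ i, 0 ≤ δ i)
    {η : Finset (Fin d)} {N : ℝ} (hN : 0 ≤ N) (L : E →L[ℝ] E)
    (hL : TestBound r T α δ a b η N (L.toLinearMap ∘ₗ Φ)) (θ : Finset (Fin d)) (k : Fin d → ℕ) :
    ‖L (rectPrim φ Φ (dyLo θ s t k) (dyHi θ s t k))‖ ≤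
      interiorConst R T G C₀ α * multiPow η (t - s) δ * N *
        ∏ i, ((t i - s i) ^ (α i + 1) * ratio (α i) ^ k i) := by
  have hC := h.const_nonneg
  have hts := fun i => sub_nonneg.2 (hst i)
  have h0 : 0 ≤ ∏ i, ((t i - s i) ^ (α i + 1) * ratio (α i) ^ k i) :=
    Finset.prod_nonneg fun i _ => mul_nonneg (Real.rpow_nonneg (hts i) _)
      (pow_nonneg (ratio_nonneg _) _)
  have hη := multiPow_nonneg η (t - s) δ
  by_cases hlt : ∀ i, s i < t i
  · refine (h.norm_le (dy_isInterior θ hs ht hlt k) (dy_hasMargin θ hs ht hst ha hb k) hδ hN L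
      hL).trans ?_
    have hlen : ∀ i, |(dyHi θ s t k - dyLo θ s t k) i| = 1 / 4 * (1 / 2) ^ k i * (t i - s i) := by
      intro i
      rw [Pi.sub_apply, abs_of_nonneg (dyHi_sub_nonneg θ hst k i), dyHi_sub_dyLo]
    have e1 : multiPow Finset.univ (fun _ : Fin d => min (1 : ℝ) 1) α = 1 := by
      simp [multiPow]
    have e2 : multiPow Finset.univ (dyHi θ s t k - dyLo θ s t k) (α + 1) ≤
        ∏ i, ((t i - s i) ^ (α i + 1) * ratio (α i) ^ k i) := by
      refine Finset.prod_le_prod (fun i _ => Real.rpow_nonneg (abs_nonneg _) _) fun i _ => ?_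
      have hα : 0 < α i + 1 := by linarith [(h.exponent i).1]
      rw [hlen, Pi.add_apply, Pi.one_apply]
      have e3 : ratio (α i) ^ k i = ((1 / 2 : ℝ) ^ k i) ^ (α i + 1) := by
        rw [ratio, ← Real.rpow_natCast, ← Real.rpow_natCast, ← Real.rpow_mul (by norm_num),
          ← Real.rpow_mul (by norm_num), add_comm (1 : ℝ), mul_comm]
      rw [e3, ← Real.mul_rpow (hts i) (by positivity)]
      have hq : 0 ≤ (1 / 2 : ℝ) ^ k i := by positivity
      refine Real.rpow_le_rpow ?_ ?_ hα.le
      · have := hts i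
        positivity
      · nlinarith [mul_nonneg hq (hts i)]
    have e3 : multiPow η (dyHi θ s t k - dyLo θ s t k) δ ≤ multiPow η (t - s) δ := by
      refine Finset.prod_le_prod (fun i _ => Real.rpow_nonneg (abs_nonneg _) _) fun i _ => ?_
      refine Real.rpow_le_rpow (abs_nonneg _) ?_ (hδ i)
      rw [hlen, Pi.sub_apply, abs_of_nonneg (hts i)]
      have hq : (1 / 2 : ℝ) ^ k i ≤ 1 := pow_le_one₀ (by norm_num) (by norm_num)
      have h5 := mul_le_mul_of_nonneg_right hq (hts i)
      have := hts i
      linarith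
    rw [e1, mul_one]
    have h6 := multiPow_nonneg η (dyHi θ s t k - dyLo θ s t k) δ
    calc interiorConst R T G C₀ α * multiPow Finset.univ (dyHi θ s t k - dyLo θ s t k) (α + 1) *
          multiPow η (dyHi θ s t k - dyLo θ s t k) δ * N
        ≤ interiorConst R T G C₀ α * (∏ i, ((t i - s i) ^ (α i + 1) * ratio (α i) ^ k i)) *
          multiPow η (t - s) δ * N := by gcongr
      _ = _ := by ring
  · push Not at hlt
    obtain ⟨i, hi⟩ := hlt
    rw [rectPrim_dy_eq_zero Φ (le_antisymm hi (hst i)), map_zero, norm_zero]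
    exact mul_nonneg (mul_nonneg (mul_nonneg hC hη) hN) h0

lemma hasSum_cell (h : IsOfOrder r T φ φ' R G C₀ α Φ) (hs : s ∈ box d T) (ht : t ∈ box d T)
    (hst : s ≤ t) (θ : Finset (Fin d)) :
    HasSum (fun k => rectPrim φ Φ (dyLo θ s t k) (dyHi θ s t k))
      (∑' k, rectPrim φ Φ (dyLo θ s t k) (dyHi θ s t k)) := by
  obtain ⟨N, hN, hb⟩ := h.bound
  refine (Summable.of_norm_bounded ?_ (h.norm_cell_le hs ht hst hs.1 ht.2 (fun _ => le_rfl) hN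
    (ContinuousLinearMap.id ℝ E) hb θ)).hasSum
  exact (summable_prod_geometric (fun i => Real.rpow_nonneg (sub_nonneg.2 (hst i)) _)
    (fun i => ratio_nonneg _) fun i => ratio_lt_one (h.exponent i).1).mul_left _

lemma norm_boxPrim_le (h : IsOfOrder r T φ φ' R G C₀ α Φ) (hs : s ∈ box d T) (ht : t ∈ box d T)
    (hst : s ≤ t) {a b δ : Fin d → ℝ} (ha : a ≤ s) (hb : t ≤ b) (hδ : ∀ i, 0 ≤ δ i)
    {η : Finset (Fin d)} {N : ℝ} (hN : 0 ≤ N) (L : E →L[ℝ] E)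
    (hL : TestBound r T α δ a b η N (L.toLinearMap ∘ₗ Φ)) :
    ‖L (boxPrim φ Φ s t)‖ ≤ integralConst R T G C₀ α * multiPow Finset.univ (t - s) (α + 1) *
      multiPow η (t - s) δ * N := by
  have hC := h.const_nonneg
  have hts := fun i => sub_nonneg.2 (hst i)
  have hη := multiPow_nonneg η (t - s) δ
  have h1 : ∀ θ : Finset (Fin d), ‖L (∑' k, rectPrim φ Φ (dyLo θ s t k) (dyHi θ s t k))‖ ≤
      interiorConst R T G C₀ α * multiPow η (t - s) δ * N *
        ∏ i, ((t i - s i) ^ (α i + 1) * (1 - ratio (α i))⁻¹) := by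
    intro θ
    refine le_of_tendsto ((h.hasSum_cell hs ht hst θ).mapL L).norm (Eventually.of_forall ?_)
    intro S
    refine (norm_sum_le_of_le _ fun k _ =>
      h.norm_cell_le hs ht hst ha hb hδ hN L hL θ k).trans ?_
    rw [← Finset.mul_sum]
    exact mul_le_mul_of_nonneg_left (sum_piFinset_prod_le
      (fun i => Real.rpow_nonneg (hts i) _) (fun i => ratio_nonneg _)
      (fun i => ratio_lt_one (h.exponent i).1) S) (mul_nonneg (mul_nonneg hC hη) hN)
  rw [boxPrim, map_sum]
  refine (norm_sum_le_of_le _ fun θ _ => h1 θ).trans (le_of_eq ?_)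
  rw [Finset.sum_const, Finset.card_univ, Fintype.card_finset, Fintype.card_fin, nsmul_eq_mul,
    Finset.prod_mul_distrib, multiPow_sub_add_one hst, integralConst]
  push_cast
  ring

/-- The sum over the first cells of all blocks is the interior primitive of a smaller rectangle. -/
lemma tendsto_dyadic (h : IsOfOrder r T φ φ' R G C₀ α Φ) (hs : s ∈ box d T) (ht : t ∈ box d T)
    (hst : ∀ i, s i < t i) :
    Tendsto (fun K : ℕ => rectPrim φ Φ (fun i => lowPt (s i) (t i) K)
      (fun i => highPt (s i) (t i) K)) atTop (𝓝 (boxPrim φ Φ s t)) := by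
  have hle : s ≤ t := fun i => (hst i).le
  have h1 : Tendsto (fun K : ℕ => Fintype.piFinset fun _ : Fin d => Finset.range K)
      atTop atTop := by
    rw [← tendsto_add_atTop_iff_nat 1]
    exact (tendsto_piFinset_range (0 : Fin d → ℕ)).comp
      (tendsto_atTop.2 fun n => by
        obtain ⟨B, hB⟩ := (Set.finite_range n).bddAbove
        filter_upwards [eventually_ge_atTop B] with K hK i
        exact (hB (Set.mem_range_self i)).trans hK : Tendsto (fun (K : ℕ) (_ : Fin d) => K) _ _)
  have h2 : Tendsto (fun K : ℕ => ∑ θ : Finset (Fin d),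
      ∑ k ∈ Fintype.piFinset fun _ : Fin d => Finset.range K,
        rectPrim φ Φ (dyLo θ s t k) (dyHi θ s t k)) atTop (𝓝 (boxPrim φ Φ s t)) :=
    tendsto_finsetSum _ fun θ _ => (h.hasSum_cell hs ht hle θ).comp h1
  refine h2.congr fun K => ?_
  rw [h.eq_sum (fun i => ⟨(hs.1 i).trans_lt (lt_lowPt (hst i) K),
    (lowPt_le_mid (hst i).le K).trans (mid_le_highPt (hst i).le K),
    (highPt_lt (hst i) K).trans_le (ht.2 i)⟩) (fun c _ => dy_isInterior c.1 hs ht hst c.2)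
    (rectIndicator_dyadic hle K), Finset.sum_product]

end IsOfOrder

end BoxPrim

/-! ### Agreement with the interior primitive, and additivity up to the boundary -/

section BoxPrimAdd

variable {d r : ℕ} {T : ℝ} {φ φ' : ℝ → ℝ} {R G C₀ : ℝ}
  {E : Type*} [NormedAddCommGroup E] [NormedSpace ℝ E] [CompleteSpace E] {s t : Fin d → ℝ}
  {α : Fin d → ℝ} {Φ : ((Fin d → ℝ) → ℝ) →ₗ[ℝ] E}

/-- The point of `[h, T - h]^d` closest to `x`. -/
def clamp (T h : ℝ) (x : Fin d → ℝ) : Fin d → ℝ := fun i => max h (min (T - h) (x i))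

lemma clamp_mono {h : ℝ} : Monotone (clamp (d := d) T h) := fun _ _ hxy i =>
  max_le_max le_rfl (min_le_min le_rfl (hxy i))

lemma clamp_coordProj {h : ℝ} (θ : Finset (Fin d)) (x y : Fin d → ℝ) :
    clamp T h (coordProj θ x y) = coordProj θ (clamp T h x) (clamp T h y) := by
  ext i
  by_cases hi : i ∈ θ <;> simp [clamp, coordProj, hi]

lemma clamp_mem {h : ℝ} (hT : 2 * h < T) (x : Fin d → ℝ) (i : Fin d) :
    h ≤ clamp T h x i ∧ clamp T h x i ≤ T - h :=
  ⟨le_max_left _ _, max_le (by linarith) (min_le_left _ _)⟩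

lemma clamp_sub_le {h : ℝ} {x y : Fin d → ℝ} (hxy : x ≤ y) (i : Fin d) :
    clamp T h y i - clamp T h x i ≤ y i - x i := by
  have := hxy i
  simp only [clamp]
  rcases max_cases h (min (T - h) (x i)) with h1 | h1 <;>
  rcases max_cases h (min (T - h) (y i)) with h2 | h2 <;>
  rcases min_cases (T - h) (x i) with h3 | h3 <;>
  rcases min_cases (T - h) (y i) with h4 | h4 <;> linarith

lemma clamp_isInterior {h : ℝ} (h0 : 0 < h) (hT : 2 * h < T) (hst : s ≤ t) :
    IsInterior T (clamp T h s) (clamp T h t) := fun i =>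
  ⟨h0.trans_le (clamp_mem hT s i).1, clamp_mono hst i,
    (clamp_mem hT t i).2.trans_lt (by linarith)⟩

lemma clamp_eventually_eq {x : Fin d → ℝ} (hx : ∀ i, 0 < x i ∧ x i < T) :
    ∀ᶠ h in 𝓝[>] (0 : ℝ), clamp T h x = x := by
  have : ∀ᶠ h in 𝓝 (0 : ℝ), ∀ i, h < x i ∧ h < T - x i := by
    rw [eventually_all]
    exact fun i => (eventually_lt_nhds (hx i).1).and
      (eventually_lt_nhds (sub_pos.2 (hx i).2))
  filter_upwards [nhdsWithin_le_nhds this] with h hh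
  ext i
  simp only [clamp]
  rw [min_eq_right (by linarith [(hh i).2]), max_eq_right (hh i).1.le]

lemma tendsto_half_pow_rpow {β : ℝ} (hβ : 0 < β) (w : ℝ) :
    Tendsto (fun K : ℕ => ((1 / 2 : ℝ) ^ K * w) ^ β) atTop (𝓝 0) := by
  have h1 : Tendsto (fun K : ℕ => (1 / 2 : ℝ) ^ K * w) atTop (𝓝 0) := by
    simpa using (tendsto_pow_atTop_nhds_zero_of_lt_one (r := (1 / 2 : ℝ)) (by norm_num)
      (by norm_num)).mul_const w
  have := h1.rpow_const (p := β) (Or.inr hβ.le)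
  rwa [Real.zero_rpow hβ.ne'] at this

/-- The volume of the slabs which are cut off at step `K` of the dyadic expansion, up to constants. -/
def slabSum (α : Fin d → ℝ) (s t : Fin d → ℝ) (K : ℕ) : ℝ :=
  ∑ i, (((1 / 2 : ℝ) ^ K * ((t i - s i) / 2)) ^ (α i + 1) +
    ((1 / 2 : ℝ) ^ K * ((t i - s i) / 2)) ^ (α i + 1))

lemma tendsto_slabSum (hα : ∀ i, -1 < α i ∧ α i < 0) (s t : Fin d → ℝ) :
    Tendsto (slabSum α s t) atTop (𝓝 0) := by
  unfold slabSum
  have := tendsto_finsetSum (Finset.univ : Finset (Fin d)) (fun i _ =>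
    (tendsto_half_pow_rpow (β := α i + 1) (by linarith [(hα i).1]) ((t i - s i) / 2)).add
      (tendsto_half_pow_rpow (β := α i + 1) (by linarith [(hα i).1]) ((t i - s i) / 2)))
  simpa using this

namespace IsOfOrder

/-- Additivity of the interior primitive in each direction. -/
lemma rectPrim_add (h : IsOfOrder r T φ φ' R G C₀ α Φ) {s u t : Fin d → ℝ}
    (hsut : ∀ i, 0 < s i ∧ s i ≤ u i ∧ u i ≤ t i ∧ t i < T) (i : Fin d) :
    rectPrim φ Φ s t =
      rectPrim φ Φ s (coordProj {i} u t) + rectPrim φ Φ (coordProj {i} u s) t := by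
  have h1 : IsInterior T s t := fun j =>
    ⟨(hsut j).1, (hsut j).2.1.trans (hsut j).2.2.1, (hsut j).2.2.2⟩
  have key := h.eq_sum (S := (Finset.univ : Finset Bool))
    (lo := fun c => if c then s else coordProj {i} u s)
    (hi := fun c => if c then coordProj {i} u t else t) h1 ?_ ?_
  · simpa using key
  · intro c _ j
    have := hsut j
    by_cases hj : j = i <;> cases c <;> simp [coordProj, hj] at this ⊢ <;>
      (try subst hj) <;> refine ⟨?_, ?_, ?_⟩ <;> linarith
  · simpa using rectIndicator_add (hsut i).2.1 (hsut i).2.2.1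

/-- Continuity of the interior primitive, with a constant which depends only on its bound. -/
lemma norm_rectPrim_sub_le (h : IsOfOrder r T φ φ' R G C₀ α Φ) {ρ B : ℝ} (hρ : 0 < ρ)
    (hB : 0 ≤ B)
    (hbd : ∀ s t : Fin d → ℝ, (∀ i, s i ∈ Set.Icc ρ (T - ρ) ∧ t i ∈ Set.Icc ρ (T - ρ)) → s ≤ t →
      ‖rectPrim φ Φ s t‖ ≤ B * ∏ i, (t i - s i) ^ (α i + 1))
    {s s' t' t : Fin d → ℝ} (hs : ∀ i, ρ ≤ s i) (ht : ∀ i, t i ≤ T - ρ)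
    (h1 : s ≤ s') (h2 : s' ≤ t') (h3 : t' ≤ t) :
    ‖rectPrim φ Φ s t - rectPrim φ Φ s' t'‖ ≤
      B * (max 1 T) ^ d * ∑ i, ((s' i - s i) ^ (α i + 1) + (t i - t' i) ^ (α i + 1)) := by
  refine norm_sub_le_of_additive (β := fun i => α i + 1) (A := Set.Icc ρ (T - ρ))
    (fun i => ⟨by linarith [(h.exponent i).1], by linarith [(h.exponent i).2]⟩) hB
    (fun x hx y hy => by linarith [hx.1, hy.2]) (fun s u t hA hsu hut i => ?_) hbd ?_ h1 h2 h3
  · exact h.rectPrim_add (fun j => ⟨hρ.trans_le (hA j).1.1, hsu j, hut j,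
      (hA j).2.2.2.trans_lt (by linarith)⟩) i
  · intro i
    have e1 := hs i
    have e2 := ht i
    have e3 := h1 i
    have e4 := h2 i
    have e5 := h3 i
    refine ⟨⟨?_, ?_⟩, ⟨?_, ?_⟩, ⟨?_, ?_⟩, ⟨?_, ?_⟩⟩ <;> linarith

/-- The integral extends the interior primitive. -/
lemma boxPrim_eq_rectPrim (h : IsOfOrder r T φ φ' R G C₀ α Φ) (hst : IsInterior T s t) :
    boxPrim φ Φ s t = rectPrim φ Φ s t := by
  by_cases hlt : ∀ i, s i < t i
  swap
  · push Not at hlt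
    obtain ⟨i, hi⟩ := hlt
    rw [rectPrim_eq_zero Φ hi, boxPrim_eq_zero Φ (le_antisymm hi (hst i).2.1)]
  obtain ⟨ρ, hρ, h1, h2⟩ := hst.exists_dist
  obtain ⟨N, hN, hb⟩ := h.bound
  refine tendsto_nhds_unique (h.tendsto_dyadic hst.left_mem hst.right_mem hlt) ?_
  -- the rectangles are compared inside `[ρ, T - ρ]^d`, where the margins are bounded from below
  set B := interiorConst R T G C₀ α * multiPow Finset.univ (fun _ : Fin d => min (ρ / T) 1) α * N
    with hBdef
  have hB : 0 ≤ B := mul_nonneg (mul_nonneg h.const_nonneg (multiPow_nonneg _ _ _)) hN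
  have hbd : ∀ s t : Fin d → ℝ, (∀ i, s i ∈ Set.Icc ρ (T - ρ) ∧ t i ∈ Set.Icc ρ (T - ρ)) →
      s ≤ t → ‖rectPrim φ Φ s t‖ ≤ B * ∏ i, (t i - s i) ^ (α i + 1) := by
    intro s t hA hst
    have hi : IsInterior T s t := fun i => ⟨hρ.trans_le (hA i).1.1, hst i,
      (hA i).2.2.trans_lt (by linarith)⟩
    refine (h.norm_le hi (hasMargin_of_dist hρ (fun i => (hA i).1.1) (fun i => (hA i).2.2) hst
      h.T_pos) (fun _ => le_rfl) hN (ContinuousLinearMap.id ℝ E) hb).trans (le_of_eq ?_)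
    rw [multiPow_sub_add_one hst, hBdef]
    simp only [multiPow, Finset.prod_empty]
    ring
  rw [tendsto_iff_norm_sub_tendsto_zero]
  refine squeeze_zero (fun _ => norm_nonneg _) (fun K => ?_) (g := fun K =>
    B * (max 1 T) ^ d * slabSum α s t K) ?_
  swap
  · simpa using (tendsto_slabSum h.exponent s t).const_mul (B * (max 1 T) ^ d)
  rw [norm_sub_rev]
  refine (h.norm_rectPrim_sub_le hρ hB hbd h1 h2 (fun i => (lt_lowPt (hlt i) K).le)
    (fun i => (lowPt_le_mid (hlt i).le K).trans (mid_le_highPt (hlt i).le K))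
    (fun i => (highPt_lt (hlt i) K).le)).trans (le_of_eq ?_)
  simp only [slabSum, lowPt, highPt, add_sub_cancel_left, sub_sub_cancel]

/-- The integral is the limit of the primitives of the rectangles moved into the interior. -/
lemma tendsto_clamp (h : IsOfOrder r T φ φ' R G C₀ α Φ) (hs : s ∈ box d T) (ht : t ∈ box d T)
    (hst : s ≤ t) :
    Tendsto (fun ρ => rectPrim φ Φ (clamp T ρ s) (clamp T ρ t)) (𝓝[>] 0)
      (𝓝 (boxPrim φ Φ s t)) := by
  by_cases hlt : ∀ i, s i < t i
  swap
  · push Not at hlt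
    obtain ⟨i, hi⟩ := hlt
    have hi' := le_antisymm hi (hst i)
    rw [boxPrim_eq_zero Φ hi']
    refine tendsto_const_nhds.congr fun ρ => ?_
    rw [rectPrim_eq_zero Φ (i := i)]
    simp [clamp, hi']
  obtain ⟨N, hN, hb⟩ := h.bound
  set B := integralConst R T G C₀ α * N with hBdef
  have hB : 0 ≤ B := mul_nonneg h.integralConst_nonneg hN
  -- the bound of the integral is uniform up to the boundary, in contrast to that of the primitive
  have hbd : ∀ ρ > 0, ∀ s t : Fin d → ℝ,
      (∀ i, s i ∈ Set.Icc ρ (T - ρ) ∧ t i ∈ Set.Icc ρ (T - ρ)) →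
      s ≤ t → ‖rectPrim φ Φ s t‖ ≤ B * ∏ i, (t i - s i) ^ (α i + 1) := by
    intro ρ hρ s t hA hst
    have hi : IsInterior T s t := fun i => ⟨hρ.trans_le (hA i).1.1, hst i,
      (hA i).2.2.trans_lt (by linarith)⟩
    rw [← h.boxPrim_eq_rectPrim hi]
    refine (h.norm_boxPrim_le hi.left_mem hi.right_mem hst hi.left_mem.1 hi.right_mem.2 (fun _ => le_rfl) hN
      (ContinuousLinearMap.id ℝ E) hb).trans (le_of_eq ?_)
    rw [multiPow_sub_add_one hst, hBdef]
    simp only [multiPow, Finset.prod_empty]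
    ring
  set lo := fun K : ℕ => fun i => lowPt (s i) (t i) K with hlo
  set hi := fun K : ℕ => fun i => highPt (s i) (t i) K with hhi
  have o1 : ∀ K, s ≤ lo K := fun K i => (lt_lowPt (hlt i) K).le
  have o2 : ∀ K, lo K ≤ hi K := fun K i =>
    (lowPt_le_mid (hlt i).le K).trans (mid_le_highPt (hlt i).le K)
  have o3 : ∀ K, hi K ≤ t := fun K i => (highPt_lt (hlt i) K).le
  rw [Metric.tendsto_nhds]
  intro ε hε
  have hsl : Tendsto (fun K => B * (max 1 T) ^ d * slabSum α s t K) atTop (𝓝 0) := by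
    simpa using (tendsto_slabSum h.exponent s t).const_mul (B * (max 1 T) ^ d)
  obtain ⟨K, hK1, hK2⟩ := ((hsl.eventually (gt_mem_nhds (half_pos hε))).and
    (Metric.tendsto_nhds.1 (h.tendsto_dyadic hs ht hlt) (ε / 2) (half_pos hε))).exists
  have c1 : ∀ᶠ ρ in 𝓝[>] (0 : ℝ), clamp T ρ (lo K) = lo K :=
    clamp_eventually_eq fun i => ⟨(hs.1 i).trans_lt (lt_lowPt (hlt i) K),
      ((o2 K i).trans_lt (highPt_lt (hlt i) K)).trans_le (ht.2 i)⟩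
  have c2 : ∀ᶠ ρ in 𝓝[>] (0 : ℝ), clamp T ρ (hi K) = hi K :=
    clamp_eventually_eq fun i => ⟨((hs.1 i).trans_lt (lt_lowPt (hlt i) K)).trans_le (o2 K i),
      (highPt_lt (hlt i) K).trans_le (ht.2 i)⟩
  have c3 : ∀ᶠ ρ in 𝓝[>] (0 : ℝ), ρ < T / 2 :=
    nhdsWithin_le_nhds (eventually_lt_nhds (half_pos h.T_pos))
  filter_upwards [c1, c2, c3, self_mem_nhdsWithin] with ρ h1 h2 h3 hρ
  have hρ0 : 0 < ρ := hρ
  have h3' : 2 * ρ < T := by linarith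
  have key := h.norm_rectPrim_sub_le hρ0 hB (hbd ρ hρ0) (fun i => (clamp_mem h3' s i).1)
    (fun i => (clamp_mem h3' t i).2) (clamp_mono (o1 K)) (clamp_mono (o2 K)) (clamp_mono (o3 K))
  have key2 : B * (max 1 T) ^ d * ∑ i, ((clamp T ρ (lo K) i - clamp T ρ s i) ^ (α i + 1) +
      (clamp T ρ t i - clamp T ρ (hi K) i) ^ (α i + 1)) ≤ B * (max 1 T) ^ d * slabSum α s t K := by
    refine mul_le_mul_of_nonneg_left (Finset.sum_le_sum fun i _ => ?_) (by positivity)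
    have hα : 0 ≤ α i + 1 := by linarith [(h.exponent i).1]
    refine add_le_add (Real.rpow_le_rpow (sub_nonneg.2 (clamp_mono (o1 K) i)) ?_ hα)
      (Real.rpow_le_rpow (sub_nonneg.2 (clamp_mono (o3 K) i)) ?_ hα)
    · refine (clamp_sub_le (o1 K) i).trans (le_of_eq ?_)
      simp only [hlo, lowPt, add_sub_cancel_left]
    · refine (clamp_sub_le (o3 K) i).trans (le_of_eq ?_)
      simp only [hhi, highPt, sub_sub_cancel]
  rw [h1, h2] at key key2
  rw [dist_eq_norm] at hK2 ⊢
  calc ‖rectPrim φ Φ (clamp T ρ s) (clamp T ρ t) - boxPrim φ Φ s t‖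
      = ‖(rectPrim φ Φ (clamp T ρ s) (clamp T ρ t) - rectPrim φ Φ (lo K) (hi K)) +
          (rectPrim φ Φ (lo K) (hi K) - boxPrim φ Φ s t)‖ := by congr 1; abel
    _ ≤ _ := norm_add_le _ _
    _ < ε / 2 + ε / 2 := add_lt_add ((key.trans key2).trans_lt hK1) hK2
    _ = ε := add_halves ε

/-- Additivity of the integral in each direction. -/
lemma boxPrim_add (h : IsOfOrder r T φ φ' R G C₀ α Φ) {s u t : Fin d → ℝ} (hs : s ∈ box d T)
    (ht : t ∈ box d T) (hsu : s ≤ u) (hut : u ≤ t) (i : Fin d) :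
    boxPrim φ Φ s t =
      boxPrim φ Φ s (coordProj {i} u t) + boxPrim φ Φ (coordProj {i} u s) t := by
  have hu : u ∈ box d T := ⟨hs.1.trans hsu, hut.trans ht.2⟩
  refine tendsto_nhds_unique (h.tendsto_clamp hs ht (hsu.trans hut))
    (((h.tendsto_clamp hs (coordProj_mem_box hu ht) (le_coordProj hsu (hsu.trans hut))).add
      (h.tendsto_clamp (coordProj_mem_box hu hs) ht
        (coordProj_le hut (hsu.trans hut)))).congr' ?_)
  have c3 : ∀ᶠ ρ in 𝓝[>] (0 : ℝ), ρ < T / 2 :=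
    nhdsWithin_le_nhds (eventually_lt_nhds (half_pos h.T_pos))
  filter_upwards [c3, self_mem_nhdsWithin] with ρ h3 hρ
  have h3' : 2 * ρ < T := by linarith
  rw [clamp_coordProj, clamp_coordProj]
  exact (h.rectPrim_add (fun j => ⟨(clamp_isInterior hρ h3' (hsu.trans hut) j).1,
    clamp_mono hsu j, clamp_mono hut j, (clamp_isInterior hρ h3' (hsu.trans hut) j).2.2⟩) i).symm

end IsOfOrder

end BoxPrimAdd

/-! ### Random distributions as linear maps into `L_m` -/

section Transfer

variable {d : ℕ} {T : ℝ} {m : ℝ≥0∞} {Ω : Type*} {mΩ : MeasurableSpace Ω} {P : Measure Ω}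

lemma tendstoLm_iff [Fact (1 ≤ m)] {ι : Type*} {l : Filter ι} {X : ι → Ω → ℝ} {ξ : ι → Lp ℝ m P}
    {Z : Ω → ℝ} {ζ : Lp ℝ m P} (hX : ∀ᶠ i in l, X i =ᵐ[P] ξ i) (hZ : Z =ᵐ[P] ζ) :
    TendstoLm m P l X Z ↔ Tendsto ξ l (𝓝 ζ) := by
  have h1 : MemLp Z m P := (memLp_congr_ae hZ).2 (Lp.memLp ζ)
  have h2 : (fun i => eLpNorm (X i - Z) m P) =ᶠ[l] fun i => eLpNorm (ξ i - ζ : Ω → ℝ) m P := by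
    filter_upwards [hX] with i hi
    exact eLpNorm_congr_ae (hi.sub hZ)
  rw [TendstoLm, Lp.tendsto_Lp_iff_tendsto_eLpNorm', tendsto_congr' h2]
  exact ⟨fun h => h.2, fun h => ⟨h1, h⟩⟩

/-- A convergent family has its limit as `limLm`. -/
lemma limLm_ae_eq [Fact (1 ≤ m)] {ι : Type*} {l : Filter ι} [l.NeBot] {X : ι → Ω → ℝ}
    {ξ : ι → Lp ℝ m P} {ζ : Lp ℝ m P} (hX : ∀ᶠ i in l, X i =ᵐ[P] ξ i)
    (hξ : Tendsto ξ l (𝓝 ζ)) : limLm m P l X =ᵐ[P] ζ := by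
  have h : ∃ Z, TendstoLm m P l X Z := ⟨ζ, (tendstoLm_iff hX (ae_eq_refl _)).2 hξ⟩
  have h1 : TendstoLm m P l X (limLm m P l X) := by
    rw [limLm, dif_pos h]
    exact h.choose_spec
  have h2 := h1.1.coeFn_toLp
  have h3 := (tendstoLm_iff hX h2.symm).1 h1
  rw [tendsto_nhds_unique hξ h3]
  exact h2.symm

/-- Conditional expectation as a contraction of `L_m`. -/
def condLp [Fact (1 ≤ m)] [IsProbabilityMeasure P] (𝒢 : MeasurableSpace Ω) :
    Lp ℝ m P →L[ℝ] Lp ℝ m P :=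
  LinearMap.mkContinuous
    { toFun := fun ζ => MemLp.toLp (P[ζ | 𝒢]) ((Lp.memLp ζ).condExp Fact.out)
      map_add' := fun ζ ξ => by
        rw [← MemLp.toLp_add, MemLp.toLp_eq_toLp_iff]
        refine (condExp_congr_ae (Lp.coeFn_add ζ ξ)).trans (condExp_add ?_ ?_ 𝒢)
        exacts [(Lp.memLp ζ).integrable Fact.out, (Lp.memLp ξ).integrable Fact.out]
      map_smul' := fun c ζ => by
        rw [RingHom.id_apply, ← MemLp.toLp_const_smul, MemLp.toLp_eq_toLp_iff]
        exact (condExp_congr_ae (Lp.coeFn_smul c ζ)).trans (condExp_smul c _ 𝒢) } 1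
    (fun ζ => by
      rw [one_mul, LinearMap.coe_mk, AddHom.coe_mk, Lp.norm_toLp, Lp.norm_def]
      exact ENNReal.toReal_mono (Lp.eLpNorm_ne_top ζ) (eLpNorm_condExp_le_eLpNorm _ Fact.out))

lemma condLp_ae_eq [Fact (1 ≤ m)] [IsProbabilityMeasure P] (𝒢 : MeasurableSpace Ω)
    {X : Ω → ℝ} {ζ : Lp ℝ m P} (h : X =ᵐ[P] ζ) : P[X | 𝒢] =ᵐ[P] condLp 𝒢 ζ :=
  (condExp_congr_ae h).trans (MemLp.coeFn_toLp ((Lp.memLp ζ).condExp Fact.out)).symm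

lemma eLpNorm_eq_of_ae_eq {X : Ω → ℝ} {ζ : Lp ℝ m P} (h : X =ᵐ[P] ζ) :
    eLpNorm X m P = ENNReal.ofReal ‖ζ‖ := by
  rw [eLpNorm_congr_ae h, Lp.norm_def, ENNReal.ofReal_toReal (Lp.eLpNorm_ne_top ζ)]

lemma marginal_le (ℱ : Filtration (Fin d → ℝ) mΩ) (η : Finset (Fin d)) (x : Fin d → ℝ) :
    marginal ℱ η x ≤ mΩ := iSup_le fun _ => ℱ.le _

lemma marginal_mono (ℱ : Filtration (Fin d → ℝ) mΩ) (η : Finset (Fin d)) {x y : Fin d → ℝ}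
    (hxy : ∀ i ∈ η, x i ≤ y i) : marginal ℱ η x ≤ marginal ℱ η y := by
  refine iSup_mono fun s => ℱ.mono fun i => ?_
  simp only [coordProj]
  split_ifs with h
  exacts [hxy i h, le_rfl]

/-- The filtration is contained in the `σ`-algebra of the future in all directions. -/
lemma le_marginal_empty (ℱ : Filtration (Fin d → ℝ) mΩ) (x t : Fin d → ℝ) :
    ℱ t ≤ marginal ℱ ∅ x := by
  exact coordProj_empty x t ▸ le_iSup (fun s => ℱ (coordProj ∅ x s)) t

variable {α δ : Fin d → ℝ} {ℱ : Filtration (Fin d → ℝ) mΩ} {f : ((Fin d → ℝ) → ℝ) → Ω → ℝ}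

lemma IsRandomDistribution.map_zero {r : ℕ} (h : IsRandomDistribution T r P f) :
    f 0 =ᵐ[P] 0 := by
  have := h.map_smul 0 0 IsTest.zero
  simpa using this

/-- The test functions on `[0,T]^d` at which a random distribution takes values in `L_m`. -/
def testSpace {r : ℕ} (m : ℝ≥0∞) (h : IsRandomDistribution T r P f) :
    Submodule ℝ ((Fin d → ℝ) → ℝ) where
  carrier := {ψ | IsTest r (box d T) ψ ∧ MemLp (f ψ) m P}
  add_mem' := fun {ψ χ} hψ hχ => ⟨hψ.1.add hχ.1,
    (memLp_congr_ae (h.map_add ψ χ hψ.1 hχ.1)).2 (hψ.2.add hχ.2)⟩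
  zero_mem' := ⟨IsTest.zero, (memLp_congr_ae h.map_zero).2 MemLp.zero⟩
  smul_mem' := fun c ψ hψ => ⟨hψ.1.smul c,
    (memLp_congr_ae (h.map_smul c ψ hψ.1)).2 (hψ.2.const_smul c)⟩

/-- A random distribution which is linear almost surely agrees on the test functions with values in `L_m`
with a linear map into `L_m`, which is extended to all functions. -/
lemma IsRandomDistribution.exists_linearMap [Fact (1 ≤ m)] {r : ℕ}
    (h : IsRandomDistribution T r P f) :
    ∃ Φ : ((Fin d → ℝ) → ℝ) →ₗ[ℝ] Lp ℝ m P, ∀ ψ ∈ testSpace m h, f ψ =ᵐ[P] Φ ψ := by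
  let Φ₀ : testSpace m h →ₗ[ℝ] Lp ℝ m P :=
    { toFun := fun ψ => MemLp.toLp (f ψ) ψ.2.2
      map_add' := fun ψ χ => by
        rw [← MemLp.toLp_add, MemLp.toLp_eq_toLp_iff]
        exact h.map_add ψ χ ψ.2.1 χ.2.1
      map_smul' := fun c ψ => by
        rw [RingHom.id_apply, ← MemLp.toLp_const_smul, MemLp.toLp_eq_toLp_iff]
        exact h.map_smul c ψ ψ.2.1 }
  obtain ⟨Φ, hΦ⟩ := Φ₀.exists_extend
  refine ⟨Φ, fun ψ hψ => ?_⟩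
  have : Φ ψ = Φ₀ ⟨ψ, hψ⟩ := by rw [← hΦ]; rfl
  rw [this]
  exact (MemLp.coeFn_toLp hψ.2).symm

namespace MemNegHolder

lemma isTest_rescale_box {r : ℕ} {χ : (Fin d → ℝ) → ℝ} (hχ : χ ∈ testBall d r)
    {x lam : Fin d → ℝ} (hx : IsScale T x lam) : IsTest r (box d T) (rescale χ x lam) :=
  isTest_rescale hχ (fun i => (hx i).1) fun _ hy =>
    ⟨fun i => (hx i).2.2.1.trans (hy i).1, fun i => (hy i).2.trans (hx i).2.2.2⟩

lemma rescale_mem (h : MemNegHolder T m α δ P ℱ f) {χ : (Fin d → ℝ) → ℝ}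
    (hχ : χ ∈ testBall d (distOrder α)) {x lam : Fin d → ℝ} (hx : IsScale T x lam) :
    rescale χ x lam ∈ testSpace m h.isRandomDistribution :=
  ⟨isTest_rescale_box hχ hx, h.memLp χ hχ x lam hx⟩

/-- The norm of `C^{α,δ}L_m` as a real number. -/
def realNorm (T : ℝ) (m : ℝ≥0∞) (α δ : Fin d → ℝ) (P : Measure Ω)
    (ℱ : Filtration (Fin d → ℝ) mΩ) (f : ((Fin d → ℝ) → ℝ) → Ω → ℝ) : ℝ :=
  (negHolderNorm T m α δ P ℱ f).toReal

lemma ofReal_realNorm (h : MemNegHolder T m α δ P ℱ f) :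
    ENNReal.ofReal (realNorm T m α δ P ℱ f) = negHolderNorm T m α δ P ℱ f :=
  ENNReal.ofReal_toReal h.norm_lt_top.ne

lemma realNorm_nonneg : 0 ≤ realNorm T m α δ P ℱ f := ENNReal.toReal_nonneg

lemma eLpNorm_condExp_le (h : MemNegHolder T m α δ P ℱ f) {χ : (Fin d → ℝ) → ℝ}
    (hχ : χ ∈ testBall d (distOrder α)) {x lam : Fin d → ℝ} (hx : IsScale T x lam)
    (η : Finset (Fin d)) :
    eLpNorm (P[f (rescale χ x lam) | marginal ℱ η x]) m P ≤
      ENNReal.ofReal (realNorm T m α δ P ℱ f *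
        (multiPow Finset.univ lam α * multiPow η lam δ)) := by
  rw [ENNReal.ofReal_mul realNorm_nonneg, h.ofReal_realNorm]
  have hpos : 0 < multiPow Finset.univ lam α * multiPow η lam δ :=
    mul_pos (Finset.prod_pos fun i _ => Real.rpow_pos_of_pos (abs_pos.2 (hx i).1.ne') _)
      (Finset.prod_pos fun i _ => Real.rpow_pos_of_pos (abs_pos.2 (hx i).1.ne') _)
  rw [← ENNReal.div_le_iff (ENNReal.ofReal_pos.2 hpos).ne' ENNReal.ofReal_ne_top]
  exact le_iSup₂_of_le χ hχ (le_iSup₂_of_le x lam (le_iSup₂_of_le hx η le_rfl))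

lemma norm_le_of_eLpNorm_le {X : Ω → ℝ} {ζ : Lp ℝ m P} (h : X =ᵐ[P] ζ) {c : ℝ} (hc : 0 ≤ c)
    (hX : eLpNorm X m P ≤ ENNReal.ofReal c) : ‖ζ‖ ≤ c := by
  rw [eLpNorm_eq_of_ae_eq h] at hX
  exact (ENNReal.ofReal_le_ofReal_iff hc).1 hX

lemma bound_nonneg (lam : Fin d → ℝ) (η : Finset (Fin d)) :
    0 ≤ realNorm T m α δ P ℱ f * (multiPow Finset.univ lam α * multiPow η lam δ) :=
  mul_nonneg realNorm_nonneg (mul_nonneg (multiPow_nonneg _ _ _) (multiPow_nonneg _ _ _))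

variable [Fact (1 ≤ m)] [IsProbabilityMeasure P] {Φ : ((Fin d → ℝ) → ℝ) →ₗ[ℝ] Lp ℝ m P}

lemma condExp_eq_self (h : MemNegHolder T m α δ P ℱ f) {χ : (Fin d → ℝ) → ℝ}
    (hχ : χ ∈ testBall d (distOrder α)) {x lam : Fin d → ℝ} (hx : IsScale T x lam)
    {t : Fin d → ℝ} (ht : t ∈ box d T) (hxt : ∀ i, x i + lam i ≤ t i)
    {𝒢 : MeasurableSpace Ω} (h1 : ℱ t ≤ 𝒢) (h2 : 𝒢 ≤ mΩ) :
    P[f (rescale χ x lam) | 𝒢] =ᵐ[P] f (rescale χ x lam) := by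
  refine condExp_of_aestronglyMeasurable' h2 ?_ ((h.memLp χ hχ x lam hx).integrable Fact.out)
  refine (h.adapted t ht _ (isTest_rescale hχ (fun i => (hx i).1) fun y hy => ⟨?_, ?_⟩)).mono h1
  · exact ⟨fun i => (hx i).2.2.1.trans (hy i).1, fun i => (hy i).2.trans (hx i).2.2.2⟩
  · exact fun i => (hy i).2.trans (hxt i)

/-- Unconditional bound: conditioning on the future in all directions is no conditioning. -/
lemma testBound_id (h : MemNegHolder T m α δ P ℱ f) (hT : 0 < T)
    (hΦ : ∀ ψ ∈ testSpace m h.isRandomDistribution, f ψ =ᵐ[P] Φ ψ) (δ' : Fin d → ℝ) :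
    TestBound (distOrder α) T α δ' 0 (fun _ => T) ∅ (realNorm T m α δ P ℱ f) Φ := by
  intro χ hχ x lam hx hab
  have h1 := h.eLpNorm_condExp_le hχ hx ∅
  rw [eLpNorm_congr_ae (h.condExp_eq_self hχ hx (t := fun _ => T) ⟨fun _ => hT.le, fun _ => le_rfl⟩
    (fun i => (hab i).2) (le_marginal_empty ℱ x _) (marginal_le ℱ ∅ x))] at h1
  exact norm_le_of_eLpNorm_le (hΦ _ (h.rescale_mem hχ hx)) (bound_nonneg lam ∅) h1

/-- Conditional bound: a test function supported in `[a,T]^d` is conditioned on more than `F^η_a`. -/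
lemma testBound_condLp (h : MemNegHolder T m α δ P ℱ f)
    (hΦ : ∀ ψ ∈ testSpace m h.isRandomDistribution, f ψ =ᵐ[P] Φ ψ)
    (η : Finset (Fin d)) (a : Fin d → ℝ) :
    TestBound (distOrder α) T α δ a (fun _ => T) η (realNorm T m α δ P ℱ f)
      ((condLp (marginal ℱ η a)).toLinearMap ∘ₗ Φ) := by
  intro χ hχ x lam hx hab
  refine norm_le_of_eLpNorm_le (condLp_ae_eq _ (hΦ _ (h.rescale_mem hχ hx)))
    (bound_nonneg lam η) (le_trans ?_ (h.eLpNorm_condExp_le hχ hx η))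
  have h1 := condExp_condExp_of_le (μ := P) (f := f (rescale χ x lam))
    (marginal_mono ℱ η fun i _ => (hab i).1) (marginal_le ℱ η x)
  rw [← eLpNorm_congr_ae h1]
  exact eLpNorm_condExp_le_eLpNorm _ Fact.out

/-- Adaptedness as a bound with constant zero: the random variable belonging to a test function supported
in `(-∞,t]` does not change when it is conditioned on `F_t`. -/
lemma testBound_sub_condLp (h : MemNegHolder T m α δ P ℱ f)
    (hΦ : ∀ ψ ∈ testSpace m h.isRandomDistribution, f ψ =ᵐ[P] Φ ψ) {t : Fin d → ℝ}
    (ht : t ∈ box d T) :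
    TestBound (distOrder α) T α 0 0 t ∅ 0
      ((ContinuousLinearMap.id ℝ (Lp ℝ m P) - condLp (ℱ t)).toLinearMap ∘ₗ Φ) := by
  intro χ hχ x lam hx hab
  have h1 := hΦ _ (h.rescale_mem hχ hx)
  have h2 : condLp (ℱ t) (Φ (rescale χ x lam)) = Φ (rescale χ x lam) := by
    refine Lp.ext ?_
    exact (condLp_ae_eq _ h1).symm.trans ((h.condExp_eq_self hχ hx ht (fun i => (hab i).2) le_rfl
      (ℱ.le t)).trans h1)
  have h3 : (((ContinuousLinearMap.id ℝ (Lp ℝ m P) - condLp (ℱ t)).toLinearMap ∘ₗ Φ)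
      (rescale χ x lam)) = 0 := by
    change Φ (rescale χ x lam) - condLp (ℱ t) (Φ (rescale χ x lam)) = 0
    rw [h2, sub_self]
  rw [h3, norm_zero, zero_mul]

end MemNegHolder

/-! ### Primitives of random distributions -/

/-- A random distribution `f` of class `C^{α,δ}L_m` together with a linear map which represents it. -/
structure IsRepresentation [Fact (1 ≤ m)] (T : ℝ) (φ φ' : ℝ → ℝ) (R G C₀ : ℝ) (α δ : Fin d → ℝ)
    (P : Measure Ω) (ℱ : Filtration (Fin d → ℝ) mΩ) (f : ((Fin d → ℝ) → ℝ) → Ω → ℝ)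
    (Φ : ((Fin d → ℝ) → ℝ) →ₗ[ℝ] Lp ℝ m P) : Prop where
  mem : MemNegHolder T m α δ P ℱ f
  ae_eq : ∀ ψ ∈ testSpace m mem.isRandomDistribution, f ψ =ᵐ[P] Φ ψ
  isOfOrder : IsOfOrder (distOrder α) T φ φ' R G C₀ α Φ

lemma MemNegHolder.exists_isRepresentation [Fact (1 ≤ m)] [IsProbabilityMeasure P]
    (h : MemNegHolder T m α δ P ℱ f) (hT : 0 < T) (hα : ∀ i, -1 < α i ∧ α i < 0) {φ φ' : ℝ → ℝ}
    {R G C₀ : ℝ} (hb : WaveletBounds d (distOrder α) φ φ' R G C₀) :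
    ∃ Φ : ((Fin d → ℝ) → ℝ) →ₗ[ℝ] Lp ℝ m P, IsRepresentation T φ φ' R G C₀ α δ P ℱ f Φ := by
  obtain ⟨Φ, hΦ⟩ := h.isRandomDistribution.exists_linearMap (m := m)
  exact ⟨Φ, h, hΦ, hb, hα, hT, _, realNorm_nonneg, h.testBound_id hT hΦ 0⟩

namespace IsRepresentation

variable [Fact (1 ≤ m)] {φ φ' : ℝ → ℝ} {R G C₀ : ℝ} {Φ : ((Fin d → ℝ) → ℝ) →ₗ[ℝ] Lp ℝ m P}
  {s t : Fin d → ℝ}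

lemma interiorApprox_ae_eq_of_le (h : IsRepresentation T φ φ' R G C₀ α δ P ℱ f Φ) {i : Fin d}
    (hi : t i ≤ s i) (n : Fin d → ℕ) :
    interiorApprox φ f s t n =ᵐ[P] Φ (waveletProj φ n (rectIndicator s t)) := by
  refine h.ae_eq _ ?_
  rw [waveletProj_eq_zero hi]
  exact Submodule.zero_mem _

lemma interiorApprox_ae_eq (h : IsRepresentation T φ φ' R G C₀ α δ P ℱ f Φ)
    (hst : IsInterior T s t) : ∀ᶠ n in atTop,
      interiorApprox φ f s t n =ᵐ[P] Φ (waveletProj φ n (rectIndicator s t)) := by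
  by_cases hlt : ∀ i, s i < t i
  · obtain ⟨ρ, hρ, h1, h2⟩ := hst.exists_dist
    have hm := hasMargin_of_dist hρ h1 h2 (fun i => (hst i).2.1) h.isOfOrder.T_pos
    obtain ⟨N, hN⟩ := exists_baseLevels h.isOfOrder.bounds.one_le hm hlt
    filter_upwards [eventually_ge_atTop N] with n hn
    exact h.ae_eq _ (h.isOfOrder.bounds.waveletProj_mem hm hlt hN hn
      fun χ hχ x lam hx => h.mem.rescale_mem hχ hx)
  · push Not at hlt
    obtain ⟨i, hi⟩ := hlt
    exact Eventually.of_forall (h.interiorApprox_ae_eq_of_le hi)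

lemma interiorPrimitive_ae_eq (h : IsRepresentation T φ φ' R G C₀ α δ P ℱ f Φ)
    (hst : IsInterior T s t) : interiorPrimitive m P φ f s t =ᵐ[P] (rectPrim φ Φ s t : Lp ℝ m P) :=
  limLm_ae_eq (h.interiorApprox_ae_eq hst) (h.isOfOrder.tendsto hst)

lemma interiorPrimitive_ae_eq_of_le (h : IsRepresentation T φ φ' R G C₀ α δ P ℱ f Φ) {i : Fin d}
    (hi : t i ≤ s i) : interiorPrimitive m P φ f s t =ᵐ[P] (rectPrim φ Φ s t : Lp ℝ m P) := by
  refine limLm_ae_eq (Eventually.of_forall (h.interiorApprox_ae_eq_of_le hi)) ?_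
  rw [rectPrim_eq_zero Φ hi]
  simp_rw [waveletProj_eq_zero hi, map_zero]
  exact tendsto_const_nhds

lemma tendstoLm_interiorPrimitive (h : IsRepresentation T φ φ' R G C₀ α δ P ℱ f Φ)
    (hst : IsInterior T s t) :
    TendstoLm m P atTop (interiorApprox φ f s t) (interiorPrimitive m P φ f s t) :=
  (tendstoLm_iff (h.interiorApprox_ae_eq hst) (h.interiorPrimitive_ae_eq hst)).2
    (h.isOfOrder.tendsto hst)

lemma dyadicApprox_ae_eq (h : IsRepresentation T φ φ' R G C₀ α δ P ℱ f Φ) (hs : s ∈ box d T)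
    (ht : t ∈ box d T) (hst : s ≤ t) (θ : Finset (Fin d)) (S : Finset (Fin d → ℕ)) :
    dyadicApprox m P φ f θ (coordProj θ s (mid s t)) (coordProj θ (mid s t) t) S =ᵐ[P]
      (∑ k ∈ S, rectPrim φ Φ (dyLo θ s t k) (dyHi θ s t k) : Lp ℝ m P) := by
  refine EventuallyEq.trans ?_ (Lp.coeFn_finsetSum _ _).symm
  refine eventuallyEq_sum fun k _ => ?_
  by_cases hlt : ∀ i, s i < t i
  · exact h.interiorPrimitive_ae_eq (dy_isInterior θ hs ht hlt k)
  · push Not at hlt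
    obtain ⟨i, hi⟩ := hlt
    refine h.interiorPrimitive_ae_eq_of_le (i := i) ?_
    have := dyHi_sub_dyLo θ s t k i
    rw [le_antisymm hi (hst i), sub_self, mul_zero] at this
    exact (sub_eq_zero.1 this).le

lemma dyadicPrimitive_ae_eq (h : IsRepresentation T φ φ' R G C₀ α δ P ℱ f Φ) (hs : s ∈ box d T)
    (ht : t ∈ box d T) (hst : s ≤ t) (θ : Finset (Fin d)) :
    dyadicPrimitive m P φ f θ (coordProj θ s (mid s t)) (coordProj θ (mid s t) t) =ᵐ[P]
      (∑' k, rectPrim φ Φ (dyLo θ s t k) (dyHi θ s t k) : Lp ℝ m P) :=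
  limLm_ae_eq (Eventually.of_forall (h.dyadicApprox_ae_eq hs ht hst θ))
    (h.isOfOrder.hasSum_cell hs ht hst θ)

lemma tendstoLm_dyadicPrimitive (h : IsRepresentation T φ φ' R G C₀ α δ P ℱ f Φ)
    (hs : s ∈ box d T) (ht : t ∈ box d T) (hst : s ≤ t) (θ : Finset (Fin d)) :
    TendstoLm m P atTop
      (dyadicApprox m P φ f θ (coordProj θ s (mid s t)) (coordProj θ (mid s t) t))
      (dyadicPrimitive m P φ f θ (coordProj θ s (mid s t)) (coordProj θ (mid s t) t)) :=
  (tendstoLm_iff (Eventually.of_forall (h.dyadicApprox_ae_eq hs ht hst θ))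
    (h.dyadicPrimitive_ae_eq hs ht hst θ)).2 (h.isOfOrder.hasSum_cell hs ht hst θ)

lemma primitiveIntegral_ae_eq (h : IsRepresentation T φ φ' R G C₀ α δ P ℱ f Φ) (hs : s ∈ box d T)
    (ht : t ∈ box d T) (hst : s ≤ t) :
    primitiveIntegral m P φ f s t =ᵐ[P] (boxPrim φ Φ s t : Lp ℝ m P) :=
  (eventuallyEq_sum fun θ _ => h.dyadicPrimitive_ae_eq hs ht hst θ).trans
    (Lp.coeFn_finsetSum _ _).symm

/-- The integral over `[s,t]` is measurable with respect to `F_t`, up to a null set. -/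
lemma aestronglyMeasurable_boxPrim [IsProbabilityMeasure P]
    (h : IsRepresentation T φ φ' R G C₀ α δ P ℱ f Φ) (hs : s ∈ box d T) (ht : t ∈ box d T)
    (hst : s ≤ t) : AEStronglyMeasurable[ℱ t] (boxPrim φ Φ s t : Lp ℝ m P) P := by
  have h1 := h.isOfOrder.norm_boxPrim_le hs ht hst hs.1 le_rfl (fun _ => le_rfl) le_rfl _
    (h.mem.testBound_sub_condLp h.ae_eq ht)
  rw [mul_zero] at h1
  have h2 : boxPrim φ Φ s t = condLp (ℱ t) (boxPrim φ Φ s t) :=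
    sub_eq_zero.1 (norm_le_zero_iff.1 h1)
  have h3 := condLp_ae_eq (ℱ t) (ae_eq_refl (boxPrim φ Φ s t : Lp ℝ m P))
  rw [← h2] at h3
  exact stronglyMeasurable_condExp.aestronglyMeasurable.congr h3

end IsRepresentation

end Transfer

/-! ### The primitive as a random field -/

section Field

variable {d : ℕ} {T : ℝ}

lemma zero_mem_box (hT : 0 < T) : (0 : Fin d → ℝ) ∈ box d T := ⟨fun _ => le_rfl, fun _ => hT.le⟩

lemma coordProj_zero_le {θ : Finset (Fin d)} {x y : Fin d → ℝ} (hx : x ∈ box d T)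
    (hxy : ∀ i ∈ θ, x i ≤ y i) : coordProj θ x 0 ≤ coordProj θ y x := fun i => by
  simp only [coordProj]; split_ifs with h
  exacts [hxy i h, hx.1 i]

/-- The increments of the field `D(0, ·)` of an additive function `D` of rectangles are the values
of `D`: one direction after the other, additivity turns the difference of two values into one value. -/
lemma sum_powerset_smul_of_additive {E : Type*} [AddCommGroup E] [Module ℝ E]
    {D : (Fin d → ℝ) → (Fin d → ℝ) → E} (hT : 0 < T)
    (hadd : ∀ s u t : Fin d → ℝ, s ∈ box d T → t ∈ box d T → s ≤ u → u ≤ t → ∀ i,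
      D s t = D s (coordProj {i} u t) + D (coordProj {i} u s) t) (θ : Finset (Fin d)) :
    ∀ x y : Fin d → ℝ, x ∈ box d T → y ∈ box d T → (∀ i ∈ θ, x i ≤ y i) →
      ∑ θ' ∈ θ.powerset, (-1 : ℝ) ^ (θ \ θ').card • D 0 (coordProj θ' y x) =
        D (coordProj θ x 0) (coordProj θ y x) := by
  induction θ using Finset.induction_on with
  | empty =>
    intro x y _ _ _
    simp [coordProj_empty]
  | insert i θ hi ih =>
    intro x y hx hy hxy
    have hxy' : ∀ j ∈ θ, x j ≤ y j := fun j hj => hxy j (Finset.mem_insert_of_mem hj)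
    have hne : ∀ j ∈ θ, j ≠ i := fun j hj h => hi (h ▸ hj)
    rw [Finset.sum_powerset_insert hi]
    have e1 : ∑ θ' ∈ θ.powerset, (-1 : ℝ) ^ (insert i θ \ θ').card • D 0 (coordProj θ' y x) =
        -D (coordProj θ x 0) (coordProj θ y x) := by
      rw [← ih x y hx hy hxy', ← Finset.sum_neg_distrib]
      refine Finset.sum_congr rfl fun θ' hθ' => ?_
      have hi' : i ∉ θ' := fun h => hi (Finset.mem_powerset.1 hθ' h)
      rw [Finset.insert_sdiff_of_notMem _ hi', Finset.card_insert_of_notMem (fun h =>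
        hi (Finset.mem_sdiff.1 h).1), pow_succ, mul_neg_one, neg_smul]
    have e2 : ∑ θ' ∈ θ.powerset, (-1 : ℝ) ^ (insert i θ \ insert i θ').card •
        D 0 (coordProj (insert i θ') y x) =
        D (coordProj θ x 0) (coordProj (insert i θ) y x) := by
      have e3 := ih (coordProj {i} y x) y (coordProj_mem_box hy hx) hy fun j hj => by
        rw [coordProj_apply_ne (hne j hj)]
        exact hxy' j hj
      have e4 : ∀ θ' ⊆ θ, coordProj θ' y (coordProj {i} y x) = coordProj (insert i θ') y x := by
        intro θ' _
        ext j
        by_cases h1 : j = i <;> by_cases h2 : j ∈ θ' <;> simp [coordProj, h1, h2]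
      have e5 : coordProj θ (coordProj {i} y x) 0 = coordProj θ x 0 := by
        ext j
        by_cases h2 : j ∈ θ
        · simp [coordProj, h2, hne j h2]
        · simp [coordProj, h2]
      rw [e4 θ subset_rfl, e5] at e3
      rw [← e3]
      refine Finset.sum_congr rfl fun θ' hθ' => ?_
      rw [e4 θ' (Finset.mem_powerset.1 hθ'), Finset.insert_sdiff_insert,
        Finset.sdiff_insert_of_notMem hi]
    have hle := coordProj_zero_le hx hxy
    have e6 : coordProj {i} x (coordProj θ x 0) = coordProj (insert i θ) x 0 :=
      (coordProj_insert i θ x 0).symm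
    have e7 : coordProj {i} x (coordProj (insert i θ) y x) = coordProj θ y x := by
      ext j
      by_cases h1 : j = i
      · subst h1
        simp [coordProj, hi]
      · simp [coordProj, h1]
    have e8 := hadd (coordProj θ x 0) (coordProj (insert i θ) x 0) (coordProj (insert i θ) y x)
      (coordProj_mem_box hx (zero_mem_box hT)) (coordProj_mem_box hy hx)
      (fun j => by
        by_cases h1 : j = i
        · subst h1
          simpa [coordProj, hi] using hx.1 j
        · simp [coordProj, h1]) hle i
    have e9 : coordProj {i} (coordProj (insert i θ) x 0) (coordProj (insert i θ) y x) =
        coordProj θ y x := by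
      rw [← e7]
      ext j
      by_cases h1 : j = i <;> simp [coordProj, h1]
    have e10 : coordProj {i} (coordProj (insert i θ) x 0) (coordProj θ x 0) =
        coordProj (insert i θ) x 0 := by
      rw [← e6]
      ext j
      by_cases h1 : j = i <;> simp [coordProj, h1]
    rw [e9, e10] at e8
    rw [e1, e2, e8]
    abel

variable {m : ℝ≥0∞} {Ω : Type*} {mΩ : MeasurableSpace Ω} {P : Measure Ω}

/-- A field which vanishes on the boundary is recovered from its increments from the origin. -/
lemma rectIncr_zero_ae_eq {Y : (Fin d → ℝ) → Ω → ℝ} {t : Fin d → ℝ} (hT : 0 < T)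
    (hY : ∀ t ∈ box d T, (∃ i, t i = 0) → Y t =ᵐ[P] 0) (ht : t ∈ box d T) :
    (fun ω => rectIncr Finset.univ 0 t (fun z => Y z ω)) =ᵐ[P] Y t := by
  have h1 : ∀ᵐ ω ∂P, ∀ θ' : Finset (Fin d), θ' ≠ Finset.univ → Y (coordProj θ' t 0) ω = 0 := by
    rw [ae_all_iff]
    intro θ'
    by_cases hθ' : θ' = Finset.univ
    · exact ae_of_all _ fun _ h => absurd hθ' h
    · obtain ⟨i, hi⟩ : ∃ i, i ∉ θ' := by
        by_contra h
        push Not at h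
        exact hθ' (Finset.eq_univ_iff_forall.2 h)
      filter_upwards [hY (coordProj θ' t 0) (coordProj_mem_box ht (zero_mem_box hT))
        ⟨i, by simp [coordProj, hi]⟩]
        with ω hω _ using hω
  filter_upwards [h1] with ω hω
  rw [rectIncr, Finset.sum_eq_single Finset.univ]
  · simp [coordProj_univ]
  · intro θ' _ hθ'
    rw [hω θ' hθ', mul_zero]
  · intro h
    exact absurd (Finset.mem_powerset_self _) h

variable [Fact (1 ≤ m)] {φ φ' : ℝ → ℝ} {R G C₀ : ℝ} {Φ : ((Fin d → ℝ) → ℝ) →ₗ[ℝ] Lp ℝ m P}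
  {α δ : Fin d → ℝ} {ℱ : Filtration (Fin d → ℝ) mΩ} {f : ((Fin d → ℝ) → ℝ) → Ω → ℝ}

namespace IsRepresentation

lemma exists_field [IsProbabilityMeasure P] (h : IsRepresentation T φ φ' R G C₀ α δ P ℱ f Φ) :
    ∃ Y : (Fin d → ℝ) → Ω → ℝ,
      (∀ t ∈ box d T, Y t =ᵐ[P] (boxPrim φ Φ 0 t : Lp ℝ m P)) ∧
      (∀ t ∈ box d T, StronglyMeasurable[ℱ t] (Y t)) ∧
      ∀ t ∈ box d T, (∃ i, t i = 0) → Y t = 0 := by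
  classical
  have hm : ∀ t ∈ box d T, AEStronglyMeasurable[ℱ t] (boxPrim φ Φ 0 t : Lp ℝ m P) P :=
    fun t ht => h.aestronglyMeasurable_boxPrim (zero_mem_box h.isOfOrder.T_pos) ht ht.1
  refine ⟨fun t => if ht : t ∈ box d T ∧ ¬ ∃ i, t i = 0 then (hm t ht.1).mk else 0, ?_, ?_, ?_⟩
  · intro t ht
    by_cases h0 : ∃ i, t i = 0
    · simp only [h0, not_true_eq_false, and_false, dite_false]
      obtain ⟨i, hi⟩ := h0
      rw [boxPrim_eq_zero Φ (i := i) hi]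
      exact (Lp.coeFn_zero ℝ m P).symm
    · simp only [ht, h0, not_false_eq_true, and_self, dite_true]
      exact (hm t ht).ae_eq_mk.symm
  · intro t ht
    by_cases h0 : ∃ i, t i = 0
    · simp only [h0, not_true_eq_false, and_false, dite_false]
      exact stronglyMeasurable_zero
    · simp only [ht, h0, not_false_eq_true, and_self, dite_true]
      exact (hm t ht).stronglyMeasurable_mk
  · intro t _ h0
    simp only [h0, not_true_eq_false, and_false, dite_false]

lemma rectIncr_ae_eq (h : IsRepresentation T φ φ' R G C₀ α δ P ℱ f Φ) {Y : (Fin d → ℝ) → Ω → ℝ}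
    (hY : ∀ t ∈ box d T, Y t =ᵐ[P] (boxPrim φ Φ 0 t : Lp ℝ m P)) {θ : Finset (Fin d)}
    {x y : Fin d → ℝ} (hx : x ∈ box d T) (hy : y ∈ box d T) (hxy : ∀ i ∈ θ, x i ≤ y i) :
    (fun ω => rectIncr θ x y (fun z => Y z ω)) =ᵐ[P]
      (boxPrim φ Φ (coordProj θ x 0) (coordProj θ y x) : Lp ℝ m P) := by
  rw [← sum_powerset_smul_of_additive h.isOfOrder.T_pos
    (fun s u t hs ht hsu hut i => h.isOfOrder.boxPrim_add hs ht hsu hut i) θ x y hx hy hxy]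
  refine EventuallyEq.trans ?_ (Lp.coeFn_finsetSum _ _).symm
  have e1 : (fun ω => rectIncr θ x y (fun z => Y z ω)) =
      ∑ θ' ∈ θ.powerset, (-1 : ℝ) ^ (θ \ θ').card • Y (coordProj θ' y x) := by
    ext ω
    simp [rectIncr, Finset.sum_apply]
  rw [e1]
  refine eventuallyEq_sum fun θ' _ => ?_
  exact ((hY _ (coordProj_mem_box hy hx)).const_smul _).trans (Lp.coeFn_smul _ _).symm

variable [IsProbabilityMeasure P] {s t : Fin d → ℝ}

lemma norm_boxPrim_le (h : IsRepresentation T φ φ' R G C₀ α δ P ℱ f Φ) (hs : s ∈ box d T)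
    (ht : t ∈ box d T) (hst : s ≤ t) :
    ‖boxPrim φ Φ s t‖ ≤ integralConst R T G C₀ α * multiPow Finset.univ (t - s) (α + 1) *
      MemNegHolder.realNorm T m α δ P ℱ f := by
  have := h.isOfOrder.norm_boxPrim_le hs ht hst hs.1 ht.2 (fun _ => le_rfl)
    MemNegHolder.realNorm_nonneg (ContinuousLinearMap.id ℝ _)
    (h.mem.testBound_id h.isOfOrder.T_pos h.ae_eq 0)
  simpa [multiPow] using this

lemma norm_condLp_boxPrim_le (h : IsRepresentation T φ φ' R G C₀ α δ P ℱ f Φ)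
    (hδ : ∀ i, 0 ≤ δ i) (hs : s ∈ box d T)
    (ht : t ∈ box d T) (hst : s ≤ t) (η : Finset (Fin d)) :
    ‖condLp (marginal ℱ η s) (boxPrim φ Φ s t)‖ ≤ integralConst R T G C₀ α *
      multiPow Finset.univ (t - s) (α + 1) * multiPow η (t - s) δ *
      MemNegHolder.realNorm T m α δ P ℱ f :=
  h.isOfOrder.norm_boxPrim_le hs ht hst le_rfl ht.2 hδ MemNegHolder.realNorm_nonneg _
    (h.mem.testBound_condLp h.ae_eq η s)

/-- The bound of the increments: the side lengths of the rectangle in the directions outside `θ` are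
bounded by `T`. -/
lemma incrSeminorm_le (h : IsRepresentation T φ φ' R G C₀ α δ P ℱ f Φ) (hδ : ∀ i, 0 ≤ δ i)
    {Y : (Fin d → ℝ) → Ω → ℝ}
    (hY : ∀ t ∈ box d T, Y t =ᵐ[P] (boxPrim φ Φ 0 t : Lp ℝ m P)) {θ η : Finset (Fin d)}
    (hηθ : η ⊆ θ) :
    incrSeminorm T m (α + 1) δ P ℱ Y θ η ≤
      ENNReal.ofReal (integralConst R T G C₀ α * (max 1 T) ^ d) * negHolderNorm T m α δ P ℱ f := by
  refine iSup₂_le fun x hx => iSup₂_le fun y hy => iSup_le fun hxy => ?_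
  refine ENNReal.div_le_of_le_mul ?_
  set s := coordProj θ x 0 with hsd
  set t := coordProj θ y x with htd
  have hs : s ∈ box d T := coordProj_mem_box hx (zero_mem_box h.isOfOrder.T_pos)
  have ht : t ∈ box d T := coordProj_mem_box hy hx
  have hst : s ≤ t := coordProj_zero_le hx hxy
  have hmarg : marginal ℱ η x = marginal ℱ η s := by
    have : ∀ i ∈ η, x i = s i := fun i hi => by simp [hsd, coordProj, hηθ hi]
    exact le_antisymm (marginal_mono ℱ η fun i hi => (this i hi).le)
      (marginal_mono ℱ η fun i hi => (this i hi).ge)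
  have hM : 1 ≤ max 1 T := le_max_left _ _
  have hC := h.isOfOrder.integralConst_nonneg
  have e1 : multiPow η (t - s) δ = multiPow η (x - y) δ :=
    Finset.prod_congr rfl fun i hi => by
      simp [hsd, htd, coordProj, hηθ hi, abs_sub_comm]
  have e2 : multiPow Finset.univ (t - s) (α + 1) ≤ (max 1 T) ^ d * multiPow θ (x - y) (α + 1) := by
    have e3 : multiPow Finset.univ (t - s) (α + 1) =
        multiPow θᶜ (t - s) (α + 1) * multiPow θ (x - y) (α + 1) := by
      have e4 : multiPow θ (t - s) (α + 1) = multiPow θ (x - y) (α + 1) :=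
        Finset.prod_congr rfl fun i hi => by simp [hsd, htd, coordProj, hi, abs_sub_comm]
      rw [← e4, multiPow, multiPow, multiPow, Finset.prod_compl_mul_prod]
    rw [e3]
    refine mul_le_mul_of_nonneg_right ?_ (multiPow_nonneg _ _ _)
    calc multiPow θᶜ (t - s) (α + 1) ≤ ∏ _i ∈ θᶜ, max 1 T := by
          refine Finset.prod_le_prod (fun i _ => Real.rpow_nonneg (abs_nonneg _) _) fun i _ => ?_
          have hα := h.isOfOrder.exponent i
          have h1 : |(t - s) i| ≤ T := by
            rw [Pi.sub_apply, abs_of_nonneg (sub_nonneg.2 (hst i))]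
            have h3 : t i ≤ T := ht.2 i
            have h4 : 0 ≤ s i := hs.1 i
            linarith
          exact rpow_le_max_one (abs_nonneg _) h1 (by rw [Pi.add_apply, Pi.one_apply]; linarith)
            (by rw [Pi.add_apply, Pi.one_apply]; linarith)
      _ = (max 1 T) ^ θᶜ.card := by rw [Finset.prod_const]
      _ ≤ (max 1 T) ^ d := pow_le_pow_right₀ hM (by simpa using Finset.card_le_univ θᶜ)
  rw [hmarg, eLpNorm_eq_of_ae_eq (condLp_ae_eq _ (h.rectIncr_ae_eq hY hx hy hxy)),
    ← h.mem.ofReal_realNorm,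
    ← ENNReal.ofReal_mul (mul_nonneg hC (by positivity)),
    ← ENNReal.ofReal_mul (mul_nonneg (mul_nonneg hC (by positivity))
      MemNegHolder.realNorm_nonneg)]
  refine ENNReal.ofReal_le_ofReal ((h.norm_condLp_boxPrim_le hδ hs ht hst η).trans ?_)
  rw [e1]
  have hN := MemNegHolder.realNorm_nonneg (T := T) (m := m) (α := α) (δ := δ) (P := P) (ℱ := ℱ)
    (f := f)
  have h5 := multiPow_nonneg η (x - y) δ
  calc integralConst R T G C₀ α * multiPow Finset.univ (t - s) (α + 1) * multiPow η (x - y) δ *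
        MemNegHolder.realNorm T m α δ P ℱ f
      ≤ integralConst R T G C₀ α * ((max 1 T) ^ d * multiPow θ (x - y) (α + 1)) *
        multiPow η (x - y) δ * MemNegHolder.realNorm T m α δ P ℱ f := by gcongr
    _ = _ := by ring

lemma eLpNorm_field_le (h : IsRepresentation T φ φ' R G C₀ α δ P ℱ f Φ)
    {Y : (Fin d → ℝ) → Ω → ℝ}
    (hY : ∀ t ∈ box d T, Y t =ᵐ[P] (boxPrim φ Φ 0 t : Lp ℝ m P)) {t : Fin d → ℝ}
    (ht : t ∈ box d T) :
    eLpNorm (Y t) m P ≤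
      ENNReal.ofReal (integralConst R T G C₀ α * (max 1 T) ^ d) * negHolderNorm T m α δ P ℱ f := by
  have hM : 1 ≤ max 1 T := le_max_left _ _
  have hC := h.isOfOrder.integralConst_nonneg
  rw [eLpNorm_eq_of_ae_eq (hY t ht), ← h.mem.ofReal_realNorm,
    ← ENNReal.ofReal_mul (mul_nonneg hC (by positivity))]
  refine ENNReal.ofReal_le_ofReal ((h.norm_boxPrim_le (zero_mem_box h.isOfOrder.T_pos) ht
    ht.1).trans (mul_le_mul_of_nonneg_right (mul_le_mul_of_nonneg_left ?_ hC)
    MemNegHolder.realNorm_nonneg))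
  calc multiPow Finset.univ (t - 0) (α + 1) ≤ ∏ _i : Fin d, max 1 T := by
        refine Finset.prod_le_prod (fun i _ => Real.rpow_nonneg (abs_nonneg _) _) fun i _ => ?_
        have hα := h.isOfOrder.exponent i
        rw [sub_zero, abs_of_nonneg (ht.1 i)]
        exact rpow_le_max_one (ht.1 i) (ht.2 i) (by rw [Pi.add_apply, Pi.one_apply]; linarith)
          (by rw [Pi.add_apply, Pi.one_apply]; linarith)
    _ = (max 1 T) ^ d := by simp

end IsRepresentation

end Field

end

end RectInt

open RectInt in
theorem corollary4p9 {d : ℕ} (hd : 0 < d) {T : ℝ} (hT : 0 < T)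
    {m : ℝ≥0∞} (hm : 1 ≤ m) (hm_top : m ≠ ∞)
    {α δ : Fin d → ℝ} (hα : ∀ i, -1 < α i ∧ α i < 0) (hδ : ∀ i, 0 ≤ δ i)
    {φ φ' : ℝ → ℝ} (hφ : IsWaveletPair (distOrder α) φ φ')
    {Ω : Type*} {mΩ : MeasurableSpace Ω} (P : Measure Ω) [IsProbabilityMeasure P]
    (ℱ : Filtration (Fin d → ℝ) mΩ) (hℱ : IsCommuting ℱ P) :
    ∃ C : ℝ≥0, ∀ f : ((Fin d → ℝ) → ℝ) → Ω → ℝ, MemNegHolder T m α δ P ℱ f →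
      -- the interior primitive exists as a limit in `L_m` ...
      (∀ s t : Fin d → ℝ, (∀ i, 0 < s i ∧ s i ≤ t i ∧ t i < T) →
        TendstoLm m P atTop (interiorApprox φ f s t) (interiorPrimitive m P φ f s t)) ∧
      -- ... is additive in each direction ...
      (∀ s u t : Fin d → ℝ, (∀ i, 0 < s i ∧ s i ≤ u i ∧ u i ≤ t i ∧ t i < T) → ∀ i : Fin d,
        interiorPrimitive m P φ f s t =ᵐ[P]
          interiorPrimitive m P φ f s (coordProj {i} u t) +
            interiorPrimitive m P φ f (coordProj {i} u s) t) ∧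
      -- ... and is bounded, with or without conditioning
      (∀ s t ε : Fin d → ℝ, (∀ i, 0 < s i ∧ s i ≤ t i ∧ t i < T ∧ 0 < ε i) →
        (fun i => s i - |t i - s i| * ε i) ∈ box d T →
        (fun i => t i + |t i - s i| * ε i) ∈ box d T →
        eLpNorm (interiorPrimitive m P φ f s t) m P ≤
            ENNReal.ofReal (C * multiPow Finset.univ (fun i => min (ε i) 1) α *
              multiPow Finset.univ (t - s) (α + 1)) * negHolderNorm T m α δ P ℱ f ∧
        ∀ η : Finset (Fin d),
          eLpNorm (P[interiorPrimitive m P φ f s t |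
              marginal ℱ η (fun i => s i - |t i - s i| * ε i)]) m P ≤
            ENNReal.ofReal (C * multiPow Finset.univ (fun i => min (ε i) 1) α *
              multiPow Finset.univ (t - s) (α + 1) * multiPow η (t - s) δ) *
                negHolderNorm T m α δ P ℱ f) ∧
      -- the dyadic expansions defining the integral converge in `L_m`
      (∀ s t : Fin d → ℝ, s ∈ box d T → t ∈ box d T → s ≤ t → ∀ θ : Finset (Fin d),
        TendstoLm m P atTop
          (dyadicApprox m P φ f θ (coordProj θ s (mid s t)) (coordProj θ (mid s t) t))
          (dyadicPrimitive m P φ f θ (coordProj θ s (mid s t)) (coordProj θ (mid s t) t))) ∧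
      -- the integral extends the interior primitive
      (∀ s t : Fin d → ℝ, (∀ i, 0 < s i ∧ s i ≤ t i ∧ t i < T) →
        primitiveIntegral m P φ f s t =ᵐ[P] interiorPrimitive m P φ f s t) ∧
      -- the integral is additive in each direction
      (∀ s u t : Fin d → ℝ, s ∈ box d T → t ∈ box d T → s ≤ u → u ≤ t → ∀ i : Fin d,
        primitiveIntegral m P φ f s t =ᵐ[P]
          primitiveIntegral m P φ f s (coordProj {i} u t) +
            primitiveIntegral m P φ f (coordProj {i} u s) t) ∧
      -- the integral is adapted and bounded, with or without conditioning
      (∀ s t : Fin d → ℝ, s ∈ box d T → t ∈ box d T → s ≤ t →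
        AEStronglyMeasurable[ℱ t] (primitiveIntegral m P φ f s t) P ∧
        eLpNorm (primitiveIntegral m P φ f s t) m P ≤
            ENNReal.ofReal (C * multiPow Finset.univ (t - s) (α + 1)) *
              negHolderNorm T m α δ P ℱ f ∧
        ∀ η : Finset (Fin d),
          eLpNorm (P[primitiveIntegral m P φ f s t | marginal ℱ η s]) m P ≤
            ENNReal.ofReal (C * multiPow Finset.univ (t - s) (α + 1) * multiPow η (t - s) δ) *
              negHolderNorm T m α δ P ℱ f) ∧
      -- the primitive
      ∃ Y : (Fin d → ℝ) → Ω → ℝ,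
        -- it vanishes on the boundary
        (∀ t ∈ box d T, (∃ i, t i = 0) → Y t = 0) ∧
        -- its rectangular increments are the integrals of `f`
        (∀ x y : Fin d → ℝ, x ∈ box d T → y ∈ box d T → x ≤ y →
          (fun ω => rectIncr Finset.univ x y (fun z => Y z ω)) =ᵐ[P]
            primitiveIntegral m P φ f x y) ∧
        -- it is the only such process, up to modification
        (∀ Y' : (Fin d → ℝ) → Ω → ℝ,
          (∀ t ∈ box d T, (∃ i, t i = 0) → Y' t =ᵐ[P] 0) →
          (∀ x y : Fin d → ℝ, x ∈ box d T → y ∈ box d T → x ≤ y →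
            (fun ω => rectIncr Finset.univ x y (fun z => Y' z ω)) =ᵐ[P]
              primitiveIntegral m P φ f x y) →
          ∀ t ∈ box d T, Y' t =ᵐ[P] Y t) ∧
        -- its lower dimensional increments
        (∀ (θ : Finset (Fin d)) (x y : Fin d → ℝ), x ∈ box d T → y ∈ box d T →
          (∀ i ∈ θ, x i ≤ y i) →
          (fun ω => rectIncr θ x y (fun z => Y z ω)) =ᵐ[P]
            primitiveIntegral m P φ f (coordProj θ x 0) (coordProj θ y x)) ∧
        -- its regularity
        MemHolder T m (α + 1) δ P ℱ Y ∧
        holderNorm T m (α + 1) δ P ℱ Y ≤ C * negHolderNorm T m α δ P ℱ f := by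
  have : Fact (1 ≤ m) := ⟨hm⟩
  obtain ⟨R, G, C₀, hb⟩ := hφ.exists_waveletBounds d
  set CI := interiorConst R T G C₀ α with hCI
  set CB := integralConst R T G C₀ α with hCB
  set M : ℝ := (max 1 T) ^ d with hMd
  have hM1 : 1 ≤ max 1 T := le_max_left _ _
  have hM : 1 ≤ M := one_le_pow₀ hM1
  -- there are at most `4 ^ d` increment seminorms in the norm of the primitive
  set C : ℝ≥0 := Real.toNNReal (CI + CB * M * (1 + 4 ^ d)) with hCd
  refine ⟨C, fun f hf => ?_⟩
  obtain ⟨Φ, h⟩ := hf.exists_isRepresentation hT hα hb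
  have hCI0 : 0 ≤ CI := h.isOfOrder.const_nonneg
  have hCB0 : 0 ≤ CB := h.isOfOrder.integralConst_nonneg
  have hCBM : 0 ≤ CB * M := mul_nonneg hCB0 (by linarith)
  have hC : (C : ℝ) = CI + CB * M * (1 + 4 ^ d) := Real.coe_toNNReal _ (by positivity)
  have hCIC : CI ≤ C := by
    rw [hC]
    have : 0 ≤ CB * M * (1 + 4 ^ d) := by positivity
    linarith
  have hCBC : CB ≤ C := by
    rw [hC]
    have h1 : CB * 1 ≤ CB * M := mul_le_mul_of_nonneg_left hM hCB0
    have h2 : 0 ≤ CB * M * 4 ^ d := by positivity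
    linarith
  have hN := MemNegHolder.realNorm_nonneg (T := T) (m := m) (α := α) (δ := δ) (P := P) (ℱ := ℱ)
    (f := f)
  have hNe := hf.ofReal_realNorm
  have h0box : (0 : Fin d → ℝ) ∈ box d T := zero_mem_box hT
  have hint : ∀ s t : Fin d → ℝ, s ∈ box d T → t ∈ box d T → s ≤ t →
      primitiveIntegral m P φ f s t =ᵐ[P] (boxPrim φ Φ s t : Lp ℝ m P) :=
    fun s t hs ht hst => h.primitiveIntegral_ae_eq hs ht hst
  obtain ⟨Y, hY, hYm, hY0⟩ := h.exists_field
  refine ⟨fun s t hst => h.tendstoLm_interiorPrimitive hst, ?_, ?_,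
    fun s t hs ht hst θ => h.tendstoLm_dyadicPrimitive hs ht hst θ, ?_, ?_, ?_, Y, hY0, ?_, ?_, ?_,
    ?_, ?_⟩
  · intro s u t hsut i
    have h1 : IsInterior T s t := fun j =>
      ⟨(hsut j).1, (hsut j).2.1.trans (hsut j).2.2.1, (hsut j).2.2.2⟩
    have h2 : IsInterior T s (coordProj {i} u t) := fun j => by
      obtain ⟨a1, a2, a3, a4⟩ := hsut j
      simp only [coordProj]; split_ifs
      exacts [⟨a1, a2, a3.trans_lt a4⟩, ⟨a1, a2.trans a3, a4⟩]
    have h3 : IsInterior T (coordProj {i} u s) t := fun j => by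
      obtain ⟨a1, a2, a3, a4⟩ := hsut j
      simp only [coordProj]; split_ifs
      exacts [⟨a1.trans_le a2, a3, a4⟩, ⟨a1, a2.trans a3, a4⟩]
    refine (h.interiorPrimitive_ae_eq h1).trans ?_
    rw [h.isOfOrder.rectPrim_add hsut i]
    exact (Lp.coeFn_add _ _).trans
      ((h.interiorPrimitive_ae_eq h2).add (h.interiorPrimitive_ae_eq h3)).symm
  · intro s t ε hst hs' ht'
    have hi : IsInterior T s t := fun i => ⟨(hst i).1, (hst i).2.1, (hst i).2.2.1⟩
    have hm1 : HasMargin T s t ε 0 (fun _ => T) :=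
      ⟨fun i => (hst i).2.2.2, hs'.1, ht'.2, hs'.1, ht'.2⟩
    have hm2 : HasMargin T s t ε (fun i => s i - |t i - s i| * ε i) (fun _ => T) :=
      ⟨fun i => (hst i).2.2.2, hs'.1, ht'.2, fun _ => le_rfl, ht'.2⟩
    have n1 := multiPow_nonneg Finset.univ (fun i => min (ε i) 1) α
    have n2 := multiPow_nonneg Finset.univ (t - s) (α + 1)
    refine ⟨?_, fun η => ?_⟩
    · have b := h.isOfOrder.norm_le hi hm1 (fun _ => le_rfl) hN (ContinuousLinearMap.id ℝ _)
        (hf.testBound_id hT h.ae_eq 0)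
      rw [eLpNorm_eq_of_ae_eq (h.interiorPrimitive_ae_eq hi), ← hNe,
        ← ENNReal.ofReal_mul (by positivity)]
      refine ENNReal.ofReal_le_ofReal (b.trans ?_)
      simp only [multiPow, Finset.prod_empty, mul_one] at n1 n2 ⊢
      gcongr
    · have n3 := multiPow_nonneg η (t - s) δ
      have b := h.isOfOrder.norm_le hi hm2 hδ hN _
        (hf.testBound_condLp h.ae_eq η (fun i => s i - |t i - s i| * ε i))
      rw [eLpNorm_eq_of_ae_eq (condLp_ae_eq _ (h.interiorPrimitive_ae_eq hi)), ← hNe,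
        ← ENNReal.ofReal_mul (by positivity)]
      refine ENNReal.ofReal_le_ofReal (b.trans ?_)
      gcongr
  · intro s t hst
    have hst' : IsInterior T s t := hst
    refine (hint s t hst'.left_mem hst'.right_mem fun i => (hst i).2.1).trans ?_
    rw [h.isOfOrder.boxPrim_eq_rectPrim hst]
    exact (h.interiorPrimitive_ae_eq hst).symm
  · intro s u t hs ht hsu hut i
    have hu : u ∈ box d T := ⟨hs.1.trans hsu, hut.trans ht.2⟩
    refine (hint s t hs ht (hsu.trans hut)).trans ?_
    rw [h.isOfOrder.boxPrim_add hs ht hsu hut i]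
    exact (Lp.coeFn_add _ _).trans ((hint _ _ hs (coordProj_mem_box hu ht)
      (le_coordProj hsu (hsu.trans hut))).add
      (hint _ _ (coordProj_mem_box hu hs) ht
        (coordProj_le hut (hsu.trans hut)))).symm
  · intro s t hs ht hst
    have n2 := multiPow_nonneg Finset.univ (t - s) (α + 1)
    have hI := hint s t hs ht hst
    refine ⟨(h.aestronglyMeasurable_boxPrim hs ht hst).congr hI.symm, ?_, fun η => ?_⟩
    · rw [eLpNorm_eq_of_ae_eq hI, ← hNe, ← ENNReal.ofReal_mul (by positivity)]
      refine ENNReal.ofReal_le_ofReal ((h.norm_boxPrim_le hs ht hst).trans ?_)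
      gcongr
    · have n3 := multiPow_nonneg η (t - s) δ
      rw [eLpNorm_eq_of_ae_eq (condLp_ae_eq _ hI), ← hNe, ← ENNReal.ofReal_mul (by positivity)]
      refine ENNReal.ofReal_le_ofReal ((h.norm_condLp_boxPrim_le hδ hs ht hst η).trans ?_)
      gcongr
  · intro x y hx hy hxy
    have h1 := h.rectIncr_ae_eq hY (θ := Finset.univ) hx hy fun i _ => hxy i
    rw [coordProj_univ, coordProj_univ] at h1
    exact h1.trans (hint x y hx hy hxy).symm
  · intro Y' hY'0 hY' t ht
    exact (rectIncr_zero_ae_eq hT hY'0 ht).symm.trans ((hY' 0 t h0box ht ht.1).trans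
      ((hint 0 t h0box ht ht.1).trans (hY t ht).symm))
  · intro θ x y hx hy hxy
    exact (h.rectIncr_ae_eq hY hx hy hxy).trans (hint _ _ (coordProj_mem_box hx h0box)
      (coordProj_mem_box hy hx) (coordProj_zero_le hx hxy)).symm
  · refine ⟨hYm, fun t ht => (memLp_congr_ae (hY t ht)).2 (Lp.memLp _), fun θ η hηθ => ?_⟩
    exact (h.incrSeminorm_le hδ hY hηθ).trans_lt
      (ENNReal.mul_lt_top ENNReal.ofReal_lt_top hf.norm_lt_top)
  · set B := ENNReal.ofReal (CB * M) * negHolderNorm T m α δ P ℱ f with hB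
    have h1 : (⨆ x ∈ box d T, eLpNorm (Y x) m P) ≤ B :=
      iSup₂_le fun t ht => h.eLpNorm_field_le hY ht
    have h2 : ∑ θ ∈ Finset.univ.filter (fun θ : Finset (Fin d) => θ.Nonempty), ∑ η ∈ θ.powerset,
        incrSeminorm T m (α + 1) δ P ℱ Y θ η ≤ 4 ^ d * B := by
      calc ∑ θ ∈ Finset.univ.filter (fun θ : Finset (Fin d) => θ.Nonempty), ∑ η ∈ θ.powerset,
            incrSeminorm T m (α + 1) δ P ℱ Y θ η
          ≤ ∑ θ ∈ Finset.univ.filter (fun θ : Finset (Fin d) => θ.Nonempty), 2 ^ d * B := by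
            refine Finset.sum_le_sum fun θ _ => ?_
            refine (Finset.sum_le_card_nsmul _ _ B fun η hη =>
              h.incrSeminorm_le hδ hY (Finset.mem_powerset.1 hη)).trans ?_
            rw [nsmul_eq_mul, Finset.card_powerset]
            gcongr
            push_cast
            exact pow_le_pow_right₀ (by norm_num) (by simpa using Finset.card_le_univ θ)
        _ ≤ ∑ _θ : Finset (Fin d), 2 ^ d * B := Finset.sum_le_sum_of_subset (Finset.filter_subset _ _)
        _ = 4 ^ d * B := by
            rw [Finset.sum_const, Finset.card_univ, Fintype.card_finset, Fintype.card_fin,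
              nsmul_eq_mul, ← mul_assoc]
            congr 1
            push_cast
            rw [← mul_pow]
            norm_num
    refine (add_le_add h1 h2).trans ?_
    have h3 : B + 4 ^ d * B = ENNReal.ofReal (CB * M * (1 + 4 ^ d)) * negHolderNorm T m α δ P ℱ f := by
      rw [hB, ENNReal.ofReal_mul hCBM, ENNReal.ofReal_add zero_le_one (by positivity),
        ENNReal.ofReal_one, ENNReal.ofReal_pow (by norm_num), ENNReal.ofReal_ofNat]
      ring
    rw [h3]
    gcongr
    rw [← ENNReal.ofReal_coe_nnreal, hC]
    exact ENNReal.ofReal_le_ofReal (by linarith)
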